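/- **Setting.** Let $d\ge 1$, let $\mathcal N=\mathbb Z^d$ or $\mathcal N=\mathbb N^d$ (with $0\in\mathbb N$), and $\mathcal Z=\mathcal N\times\{\pm1\}$. For $j=(a,\delta)\in\mathcal Z$ put $\bar j=(a,-\delta)$ and $|j|=|a|$, where $|a|^2=\max(1,a_1^2+\dots+a_d^2)$. For $s\ge 0$ let $\mathcal P_s$ be the Hilbert space of all $z\in\mathbb C^{\mathcal Z}$ with $\|z\|_s^2=\sum_{j\in\mathcal Z}|j|^{2s}|z_j|^2<\infty$. A sequence $z$ is *real* if $z_{\bar j}=\overline{z_j}$ for all $j$. For a tuple $\boldsymbol j=(j_1,\dots,j_r)\in\mathcal Z^r$ let $\mu(\boldsymbol j)$ be the third largest of the numbers $|j_1|,\dots,|j_r|$ (and $\mu(\boldsymbol j)=1$ if $r\le 2$), and let $S(\boldsymbol j)$ be the difference between the largest and the second largest of them; $\bar{\boldsymbol j}=(\bar j_1,\dots,\bar j_r)$ and $z_{\boldsymbol j}=z_{j_1}\cdots z_{j_r}$. *Frequencies.* $\omega\in\mathbb R^{\mathcal Z}$ satisfies $\omega_{\bar j}=-\omega_j$ for all $j$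 and $|\omega_a|\le C|a|^m$ for all $a\in\mathcal N$, with some $C,m>0$ (where $\omega_a=\omega_{(a,+1)}$). For $\boldsymbol j=((a_1,\delta_1),\dots,(a_r,\delta_r))$ let $\Omega(\boldsymbol j)=\delta_1\omega_{a_1}+\dots+\delta_r\omega_{a_r}$. The vector $\omega$ is *non resonant* if for every integer $r\ge3$ there are $\gamma>0$ and $\alpha>0$ such that $$|\Omega(\boldsymbol j)|\ge\frac{\gamma}{\mu(\boldsymbol j)^{\alpha}}\qquad\text{for all }\boldsymbol j\in\mathcal Z^i,\ 1\le i\le r,$$ except for those $\boldsymbol j$ for which $\bar{\boldsymbol j}$ is a permutation of $\boldsymbol j$. *Vector fields.* For $k\ge 1$ and $\nu\ge 0$, the class $\mathcal T_k^{\infty,\nu}$ consists of the polynomial vector fields $P_j(z)=\sum_{m=2}^k\sum_{\boldsymbol\ell\in\mathcal Z^m}a_{j\boldsymbol\ell}z_{\boldsymbol\ell}$, $j\in\mathcal Z$, such that for every $M\in\mathbb N$ there is a constant $C$ with $$|a_{j\boldsymbol\ell}|\le C\,\frac{\mu(j,\boldsymbol\ell)^{M+\nu}}{(\mu(j,\boldsymbol\ell)+S(j,\boldsymbol\ell))^{M}}\qquad\text{for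 all }2\le m\le k,\ \boldsymbol\ell\in\mathcal Z^m,\ j\in\mathcal Z.$$ A vector field $F=(F_j)_{j\in\mathcal Z}$ is in the class $\mathcal T$ if * there is $s_0\ge0$ such that for every $s\ge s_0$, $F$ is a continuous map from a neighborhood of the origin of $\mathcal P_s$ to $\mathcal P_s$ and $\|F(z)\|_s\le C\|z\|_s^2$ for $z$ small in $\mathcal P_s$, with $C$ depending on $s$; * for every $k\ge1$ there are $\nu\ge0$ and a polynomial field $P\in\mathcal T_k^{\infty,\nu}$, with coefficients satisfying $a_{\bar j\bar{\boldsymbol\ell}}=-\overline{a_{j\boldsymbol\ell}}$ (reality) and $a_{\bar j\bar{\boldsymbol\ell}}=-a_{j\boldsymbol\ell}$ (reversibility), which is the Taylor expansion of degree $k$ of $F$ at the origin, in the sense that for all sufficiently large $s$ one has $\|F(z)-P(z)\|_s\le C\|z\|_s^{k+1}$ for $z$ small in $\mathcal P_s$, with $C$ depending on $s$ and $k$. A *solution* of $$i\dot z_j=\omega_jz_j+F_j(z),\quad j\in\mathcal Z,\qquad(1)$$ in $\mathcal P_s$ is a continuous curve $t\mapsto z(t)\in\mathcal P_s$ on an open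 set of times, each of whose components is differentiable and satisfies (1). **Theorem 1.** Let $\omega$ be as above and non resonant, and let $F\in\mathcal T$. For every integer $r\ge 3$ there is $s_0(r)>0$ such that for every $s>s_0(r)$ there are $\epsilon_s>0$, $C_s>0$ and a continuous function $N_s^{(r)}:B(0,\epsilon_s)\to[0,\infty)$ on the ball of radius $\epsilon_s$ centered at the origin of $\mathcal P_s$, such that 1. $\big|N_s^{(r)}(z)-\|z\|_s^2\big|\le C_s\|z\|_s^3$ for all $z\in B(0,\epsilon_s)$; 2. if $t\mapsto z(t)$ is a solution of (1) in $\mathcal P_s$ such that $z(t)$ is real for all $t$, then at every time $t$ with $z(t)\in B(0,\epsilon_s)$ the function $t\mapsto N_s^{(r)}(z(t))$ is differentiable and $$\Big|\frac{\mathrm d}{\mathrm dt}N_s^{(r)}(z(t))\Big|\le C_s\|z(t)\|_s^{r+1}.$$ -/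

import Mathlib

open Filter Topology

noncomputable section

namespace ReversibleSystem

/-- The index set `𝒵 = 𝒩 × {±1}`, for a set `𝒩` of lattice points of `ℤ^d`. -/
abbrev Idx {d : ℕ} (N : Set (Fin d → ℤ)) : Type := N × ℤˣ

variable {d : ℕ} {N : Set (Fin d → ℤ)}

/-- The conjugate index `(a, δ) ↦ (a, -δ)`. -/
def bar (j : Idx N) : Idx N := (j.1, -j.2)

/-- `|j| = |a|` for `j = (a, δ)`, where `|a|² = max (1, a₁² + ⋯ + a_d²)`. -/
def size (j : Idx N) : ℝ := Real.sqrt (max 1 (∑ i, ((j.1.1 i : ℤ) : ℝ) ^ 2))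

/-- The sequence `z` is real: `ρ(z) = z̄`, i.e. `z_{j̄}` is the complex conjugate of `z_j`. -/
def IsRealSeq (z : Idx N → ℂ) : Prop := ∀ j, z (bar j) = (starRingEnd ℂ) (z j)

/-! ### The weighted spaces `𝒫_s` -/

/-- Multiplication of a sequence by the weight `|j|^s`. -/
def weightMap (N : Set (Fin d → ℤ)) (s : ℝ) : (Idx N → ℂ) →ₗ[ℂ] (Idx N → ℂ) where
  toFun z := fun j => ((size j ^ s : ℝ) : ℂ) * z j
  map_add' z w := by funext j; simp [mul_add]
  map_smul' c z := by funext j; simp [mul_left_comm]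

theorem size_pos (j : Idx N) : 0 < size j :=
  Real.sqrt_pos.mpr (lt_of_lt_of_le one_pos (le_max_left _ _))

theorem norm_weightMap_sq (s : ℝ) (z : Idx N → ℂ) (j : Idx N) :
    ‖weightMap N s z j‖ ^ 2 = size j ^ (2 * s) * ‖z j‖ ^ 2 := by
  have h : (0 : ℝ) ≤ size j ^ s := Real.rpow_nonneg (size_pos j).le s
  simp only [weightMap, LinearMap.coe_mk, AddHom.coe_mk, norm_mul, Complex.norm_real,
    Real.norm_of_nonneg h, mul_pow]
  rw [mul_comm 2 s, Real.rpow_mul (size_pos j).le]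
  norm_cast

theorem memℓp_weightMap_iff (s : ℝ) (z : Idx N → ℂ) :
    Memℓp (weightMap N s z) 2 ↔ Summable fun j => size j ^ (2 * s) * ‖z j‖ ^ 2 := by
  rw [memℓp_gen_iff (by norm_num)]
  refine iff_of_eq (congrArg Summable (funext fun j => ?_))
  rw [← norm_weightMap_sq]
  norm_num

/-- The sequences `z` with `∑_j |j|^{2s} |z_j|² < ∞`. -/
def phaseSubmodule (N : Set (Fin d → ℤ)) (s : ℝ) : Submodule ℂ (Idx N → ℂ) where
  carrier := {z | Summable fun j => size j ^ (2 * s) * ‖z j‖ ^ 2}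
  add_mem' {z w} hz hw := by
    have hz' := (memℓp_weightMap_iff s z).2 hz
    have hw' := (memℓp_weightMap_iff s w).2 hw
    refine (memℓp_weightMap_iff s (z + w)).1 ?_
    rw [map_add]
    exact hz'.add hw'
  zero_mem' := by simp
  smul_mem' c z hz := by
    have hz' := (memℓp_weightMap_iff s z).2 hz
    refine (memℓp_weightMap_iff s (c • z)).1 ?_
    rw [map_smul]
    exact hz'.const_smul c

/-- The space `𝒫_s`. -/
def Phase (N : Set (Fin d → ℤ)) (s : ℝ) : Type := phaseSubmodule N s

instance (s : ℝ) : AddCommGroup (Phase N s) := inferInstanceAs (AddCommGroup (phaseSubmodule N s))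

instance (s : ℝ) : Module ℂ (Phase N s) := inferInstanceAs (Module ℂ (phaseSubmodule N s))

/-- The sequence underlying an element of `𝒫_s`. -/
def Phase.seq {s : ℝ} (z : Phase N s) : Idx N → ℂ := z.1

/-- The embedding `z ↦ (|j|^s z_j)_j` of `𝒫_s` into `ℓ²(𝒵)`. -/
def Phase.toL2 (N : Set (Fin d → ℤ)) (s : ℝ) : Phase N s →ₗ[ℂ] lp (fun _ : Idx N => ℂ) 2 where
  toFun z := ⟨weightMap N s z.seq, (memℓp_weightMap_iff s z.seq).2 z.2⟩
  map_add' z w := Subtype.ext (map_add (weightMap N s) z.seq w.seq)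
  map_smul' c z := Subtype.ext (map_smul (weightMap N s) c z.seq)

theorem Phase.toL2_injective (N : Set (Fin d → ℤ)) (s : ℝ) :
    Function.Injective (Phase.toL2 N s) := by
  intro z w h
  refine Subtype.ext (funext fun j => ?_)
  have h1 : weightMap N s z.seq j = weightMap N s w.seq j :=
    congrFun (congrArg Subtype.val h) j
  have h2 : ((size j ^ s : ℝ) : ℂ) ≠ 0 :=
    Complex.ofReal_ne_zero.2 (Real.rpow_pos_of_pos (size_pos j) s).ne'
  exact mul_left_cancel₀ h2 h1

instance (s : ℝ) : NormedAddCommGroup (Phase N s) :=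
  NormedAddCommGroup.induced _ _ (Phase.toL2 N s) (Phase.toL2_injective N s)

instance (s : ℝ) : NormedSpace ℂ (Phase N s) :=
  NormedSpace.induced ℂ _ _ (Phase.toL2 N s)

/-- The norm of `𝒫_s` is given by `‖z‖_s² = ∑_j |j|^{2s} |z_j|²`. -/
theorem Phase.norm_sq_eq {s : ℝ} (z : Phase N s) :
    ‖z‖ ^ 2 = ∑' j, size j ^ (2 * s) * ‖z.seq j‖ ^ 2 := by
  have h := lp.norm_rpow_eq_tsum (p := 2) (by norm_num) (Phase.toL2 N s z)
  simp only [ENNReal.toReal_ofNat, Real.rpow_ofNat] at h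
  refine h.trans (tsum_congr fun j => ?_)
  exact norm_weightMap_sq s z.seq j

/-! ### Multi-indices -/

/-- The numbers `|j₁|, …, |j_r|` in decreasing order. -/
def sortedSizes {r : ℕ} (j : Fin r → Idx N) : List ℝ :=
  (List.ofFn fun i => size (j i)).mergeSort fun x y => decide (y ≤ x)

/-- `μ(j)`: the third largest number among `|j₁|, …, |j_r|`, and `1` if `r < 3`. -/
def mu {r : ℕ} (j : Fin r → Idx N) : ℝ := (sortedSizes j).getD 2 1

/-- `S(j)`: the difference of the largest and the second largest among `|j₁|, …, |j_r|`
(used for `r ≥ 2` only). -/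
def gap {r : ℕ} (j : Fin r → Idx N) : ℝ := (sortedSizes j).getD 0 1 - (sortedSizes j).getD 1 1

/-! ### The class of vector fields -/

/-- A family of coefficients `a_{jℓ}`, for `ℓ ∈ 𝒵^m`, `m ∈ ℕ` and `j ∈ 𝒵`. -/
abbrev Coeffs (N : Set (Fin d → ℤ)) : Type := (m : ℕ) → Idx N → (Fin m → Idx N) → ℂ

/-- The formal polynomial vector field `∑_{m=2}^k ∑_{ℓ ∈ 𝒵^m} a_{jℓ} z_{ℓ₁} ⋯ z_{ℓ_m}`. -/
def polyField (a : Coeffs N) (k : ℕ) (z : Idx N → ℂ) (j : Idx N) : ℂ :=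
  ∑ m ∈ Finset.Icc 2 k, ∑' l : Fin m → Idx N, a m j l * ∏ i, z (l i)

/-- The coefficients define an element of `𝒯_k^{M,ν}`. -/
def InT (a : Coeffs N) (k M : ℕ) (ν : ℝ) : Prop :=
  ∃ C : ℝ, ∀ m, 2 ≤ m → m ≤ k → ∀ (l : Fin m → Idx N) (j : Idx N),
    ‖a m j l‖ ≤ C * (mu (Fin.cons j l : Fin (m + 1) → Idx N) ^ ((M : ℝ) + ν) /
      (mu (Fin.cons j l : Fin (m + 1) → Idx N) + gap (Fin.cons j l : Fin (m + 1) → Idx N)) ^ M)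

/-- The coefficients define an element of `𝒯_k^{∞,ν} = ⋂_M 𝒯_k^{M,ν}`. -/
def InTInf (a : Coeffs N) (k : ℕ) (ν : ℝ) : Prop := ∀ M : ℕ, InT a k M ν

/-- Reality of the coefficients up to degree `k`. -/
def RealCoeffs (a : Coeffs N) (k : ℕ) : Prop :=
  ∀ m, 2 ≤ m → m ≤ k → ∀ (l : Fin m → Idx N) (j : Idx N),
    a m (bar j) (fun i => bar (l i)) = -(starRingEnd ℂ) (a m j l)

/-- Reversibility of the coefficients up to degree `k`. -/
def ReversibleCoeffs (a : Coeffs N) (k : ℕ) : Prop :=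
  ∀ m, 2 ≤ m → m ≤ k → ∀ (l : Fin m → Idx N) (j : Idx N),
    a m (bar j) (fun i => bar (l i)) = -a m j l

/-- The polynomial field with coefficients `a` is the Taylor expansion of degree `k` of `F` at the
origin of `𝒫_s`: the remainder is `O(‖z‖_s^{k+1})` in `𝒫_s`. -/
def IsTaylorAt (F : (Idx N → ℂ) → (Idx N → ℂ)) (a : Coeffs N) (k : ℕ) (s : ℝ) : Prop :=
  ∃ C : ℝ, ∀ᶠ z : Phase N s in 𝓝 0, ∃ w : Phase N s,
    (∀ j, F z.seq j = polyField a k z.seq j + w.seq j) ∧ ‖w‖ ≤ C * ‖z‖ ^ (k + 1)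

/-- The class `𝒯` of vector fields. Only the values of `F` on small balls of the spaces `𝒫_s`
matter; outside of them `F` is arbitrary. -/
structure ClassT (F : (Idx N → ℂ) → (Idx N → ℂ)) : Prop where
  /-- For large `s`, near the origin `F` is a continuous map into `𝒫_s` with a zero of order at
  least `2` at the origin. -/
  regular : ∃ s₀ : ℝ, 0 ≤ s₀ ∧ ∀ s, s₀ ≤ s →
    ∃ (U : Set (Phase N s)) (G : Phase N s → Phase N s), IsOpen U ∧ 0 ∈ U ∧ ContinuousOn G U ∧
      (∀ z ∈ U, (G z).seq = F z.seq) ∧ ∃ C : ℝ, ∀ᶠ z in 𝓝 0, ‖G z‖ ≤ C * ‖z‖ ^ 2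
  /-- The Taylor expansions of `F` at the origin have coefficients with the required bounds and
  symmetries. -/
  taylor : ∀ k : ℕ, 1 ≤ k → ∃ (ν : ℝ) (a : Coeffs N), 0 ≤ ν ∧ InTInf a k ν ∧
    RealCoeffs a k ∧ ReversibleCoeffs a k ∧ ∃ s₁ : ℝ, ∀ s, s₁ ≤ s → IsTaylorAt F a k s

/-! ### Frequencies and solutions -/

/-- `Ω(j) = δ₁ ω_{a₁} + ⋯ + δ_r ω_{a_r}` for `j_i = (a_i, δ_i)`. -/
def Omega (ω : Idx N → ℝ) {r : ℕ} (j : Fin r → Idx N) : ℝ :=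
  ∑ i, (((j i).2 : ℤ) : ℝ) * ω ((j i).1, 1)

/-- `j = j̄` as unordered tuples, i.e. the monomial `z_j` is a function of the actions. -/
def IsActionTuple {r : ℕ} (j : Fin r → Idx N) : Prop :=
  ∃ σ : Equiv.Perm (Fin r), ∀ i, j (σ i) = bar (j i)

/-- Non resonant frequency vectors. -/
def NonResonant (ω : Idx N → ℝ) : Prop :=
  ∀ r : ℕ, 3 ≤ r → ∃ γ α : ℝ, 0 < γ ∧ 0 < α ∧
    ∀ i : ℕ, 1 ≤ i → i ≤ r → ∀ j : Fin i → Idx N, ¬ IsActionTuple j →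
      γ / mu j ^ α ≤ |Omega ω j|

/-- A continuous curve in `𝒫_s`, on an open set `I` of times, that solves the system
`i ż_j = ω_j z_j + F_j(z)`, `j ∈ 𝒵`. -/
structure IsSolution (ω : Idx N → ℝ) (F : (Idx N → ℂ) → (Idx N → ℂ)) (s : ℝ) (I : Set ℝ)
    (z : ℝ → Phase N s) : Prop where
  isOpen : IsOpen I
  continuousOn : ContinuousOn z I
  ode : ∀ t ∈ I, ∀ j, ∃ v : ℂ, HasDerivAt (fun τ => (z τ).seq j) v t ∧
    Complex.I * v = (ω j : ℂ) * (z t).seq j + F (z t).seq j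

end ReversibleSystem

end

/-!
The almost conserved quantity is `‖z‖² + Re h(z)`, where `h` is a polynomial that begins with cubic
terms. It is constructed degree by degree, directly as a modified energy, without a change of
variables.

On real sequences `‖z‖²` agrees with the holomorphic quadratic form `∑_j |j|^{2s} z_j z_{j̄}`
(`energy`), which the linear flow conserves. A homogeneous polynomial is called even or odd
according to its behaviour under the symmetry `τ` that exchanges `z_j` and `z_{j̄}`. Differentiation along the
linear flow exchanges even and odd polynomials, and so does, by reversibility, differentiation
along the Taylor polynomial of `F` (`Form.bracket_mem`). Hence the derivative of an even polynomial
along the flow is odd, and its part of lowest degree can be removed if it is the derivative of some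
even polynomial along the linear flow. On monomials this means division by `i Ω(l)`. The
coefficients of an odd polynomial vanish on the monomials that depend on the actions only, so non
resonance bounds all the divisors that occur (`Form.exists_homological`). After finitely many steps the derivative is
of order `r + 1` (`exists_correction`).

The analytic point is that all polynomials stay in a class stable under both operations. It consists
of the forms that are tame (`Tame`): at most two of the variables are measured in the norm of `𝒫_s`,
the other ones in a weaker norm. Division by the divisors preserves tameness at the cost of
a stronger weak norm (`Tame.exists_div`): on the part with third largest index `j`, the divisors are
bounded below by a multiple of `|j|^{-α}`, and division is an average over the linear flow, which is
isometric (`exists_averaged_form`). Differentiation along the field preserves tameness, because the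
homogeneous components of the Taylor polynomial of `F` are tame maps (`exists_tameMap`). Their
boundedness on a single `𝒫_σ` is inherited from `F` by polarization, and the estimate with one
strong norm follows from boundedness in the weak norm and from the decay of the coefficients off
the diagonal, by a dyadic decomposition (`norm_le_of_layers`).

Solutions are not differentiable curves in `𝒫_s`, as the linear part is unbounded. The derivative
of the modified energy along them is obtained from finite truncations
(`hasDerivAt_along_solution`): the identity between derivatives holds on finite sequences, and its
right-hand side extends continuously to `𝒫_s`.
-/

noncomputable section

namespace ReversibleSystem

variable {d : ℕ} {N : Set (Fin d → ℤ)}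

/-! ### Sequence spaces and their norms -/

section

theorem one_le_size (j : Idx N) : 1 ≤ size j := by
  rw [size, Real.one_le_sqrt]
  exact le_max_left _ _

theorem bar_bar (j : Idx N) : bar (bar j) = j := by
  simp [bar]

/-- Conjugation of indices, as a permutation. -/
def barEquiv (N : Set (Fin d → ℤ)) : Equiv.Perm (Idx N) where
  toFun := bar
  invFun := bar
  left_inv := bar_bar
  right_inv := bar_bar

theorem sum_prod_pi_le {ι J : Type*} [Fintype ι] {f : ι → J → ℝ} (h0 : ∀ i j, 0 ≤ f i j)
    (hf : ∀ i, Summable (f i)) (u : Finset (ι → J)) :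
    ∑ l ∈ u, ∏ i, f i (l i) ≤ ∏ i, ∑' j, f i j := by
  classical
  calc ∑ l ∈ u, ∏ i, f i (l i)
      ≤ ∑ l ∈ Fintype.piFinset fun i => u.image fun l => l i, ∏ i, f i (l i) := by
        refine Finset.sum_le_sum_of_subset_of_nonneg (fun l hl => ?_)
          fun l _ _ => Finset.prod_nonneg fun i _ => h0 i _
        exact Fintype.mem_piFinset.2 fun i => Finset.mem_image_of_mem (fun l => l i) hl
    _ = ∏ i, ∑ j ∈ u.image fun l => l i, f i j := (Finset.prod_univ_sum _ _).symm
    _ ≤ ∏ i, ∑' j, f i j := Finset.prod_le_prod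
        (fun i _ => Finset.sum_nonneg fun j _ => h0 i j)
        fun i _ => (hf i).sum_le_tsum _ fun j _ => h0 i j

theorem summable_prod_pi {ι J : Type*} [Fintype ι] {f : ι → J → ℝ} (h0 : ∀ i j, 0 ≤ f i j)
    (hf : ∀ i, Summable (f i)) : Summable fun l : ι → J => ∏ i, f i (l i) :=
  summable_of_sum_le (fun _ => Finset.prod_nonneg fun i _ => h0 i _) (sum_prod_pi_le h0 hf)

theorem tsum_prod_pi_le {ι J : Type*} [Fintype ι] {f : ι → J → ℝ} (h0 : ∀ i j, 0 ≤ f i j)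
    (hf : ∀ i, Summable (f i)) : ∑' l : ι → J, ∏ i, f i (l i) ≤ ∏ i, ∑' j, f i j :=
  (summable_prod_pi h0 hf).tsum_le_of_sum_le (sum_prod_pi_le h0 hf)

theorem summable_max_one_sq : Summable fun a : ℤ => (max 1 ((a : ℝ) ^ 2))⁻¹ := by
  have h : Summable fun a : ℤ => 1 / (a : ℝ) ^ 2 :=
    Real.summable_one_div_int_pow.2 (by norm_num)
  refine Summable.of_norm_bounded_eventually h ?_
  refine (Set.finite_singleton (0 : ℤ)).subset fun a ha => ?_
  by_contra h0
  refine ha ?_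
  have h1 : (1 : ℝ) ≤ (a : ℝ) ^ 2 := by
    have : (1 : ℤ) ≤ a ^ 2 := by
      have : a ≠ 0 := h0
      have := sq_pos_of_ne_zero this
      omega
    exact_mod_cast this
  change ‖(max 1 ((a : ℝ) ^ 2))⁻¹‖ ≤ 1 / (a : ℝ) ^ 2
  rw [max_eq_right h1, Real.norm_of_nonneg (by positivity), one_div]

/-- There are at most two indices `(a, ±1)` over each lattice point `a`, and `|a|²` is at least
`max 1 a_i²` for each `i`, so the sum is dominated by a product of `d` convergent sums over `ℤ`. -/
theorem summable_size_rpow (N : Set (Fin d → ℤ)) :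
    Summable fun j : Idx N => size j ^ (-(2 * d : ℝ)) := by
  have h1 : Summable fun a : Fin d → ℤ => ∏ i, (max 1 ((a i : ℝ) ^ 2))⁻¹ :=
    summable_prod_pi (f := fun _ (a : ℤ) => (max 1 ((a : ℝ) ^ 2))⁻¹) (fun _ _ => by positivity)
      fun _ => summable_max_one_sq
  have h2 : Summable fun a : N => ∏ i, (max 1 ((a.1 i : ℝ) ^ 2))⁻¹ := h1.subtype N
  have h3 : Summable fun j : Idx N => ∏ i, (max 1 ((j.1.1 i : ℝ) ^ 2))⁻¹ := by
    have := h2.mul_of_nonneg (Summable.of_finite (f := fun _ : ℤˣ => (1 : ℝ)))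
      (fun _ => Finset.prod_nonneg fun _ _ => by positivity) (fun _ => zero_le_one)
    simpa using this
  refine h3.of_nonneg_of_le (fun j => Real.rpow_nonneg (size_pos j).le _) fun j => ?_
  have hsq : size j ^ 2 = max 1 (∑ i, ((j.1.1 i : ℤ) : ℝ) ^ 2) :=
    Real.sq_sqrt (zero_le_one.trans (le_max_left _ _))
  rw [Real.rpow_neg (size_pos j).le, Real.rpow_mul (size_pos j).le, Finset.prod_inv_distrib]
  refine inv_anti₀ (Finset.prod_pos fun i _ => by positivity) ?_
  rw [Real.rpow_ofNat, hsq, Real.rpow_natCast]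
  calc ∏ i, max 1 ((j.1.1 i : ℝ) ^ 2)
      ≤ ∏ _i : Fin d, max 1 (∑ i, ((j.1.1 i : ℤ) : ℝ) ^ 2) := by
        refine Finset.prod_le_prod (fun i _ => by positivity) fun i _ => ?_
        refine max_le_max le_rfl ?_
        exact Finset.single_le_sum (f := fun i => ((j.1.1 i : ℤ) : ℝ) ^ 2)
          (fun i _ => sq_nonneg _) (Finset.mem_univ i)
    _ = _ := by simp

/-- The norm of `𝒫_σ`, as a function on all sequences; it takes the junk value `0` outside of
`𝒫_σ`. -/
def wnorm (σ : ℝ) (u : Idx N → ℂ) : ℝ := Real.sqrt (∑' j, size j ^ (2 * σ) * ‖u j‖ ^ 2)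

theorem wnorm_nonneg (σ : ℝ) (u : Idx N → ℂ) : 0 ≤ wnorm σ u := Real.sqrt_nonneg _

theorem wnorm_sq (σ : ℝ) (u : Idx N → ℂ) :
    wnorm σ u ^ 2 = ∑' j, size j ^ (2 * σ) * ‖u j‖ ^ 2 :=
  Real.sq_sqrt (tsum_nonneg fun j => mul_nonneg (Real.rpow_nonneg (size_pos j).le _) (sq_nonneg _))

theorem Phase.norm_eq {s : ℝ} (z : Phase N s) : ‖z‖ = wnorm s z.seq := by
  rw [wnorm, ← Phase.norm_sq_eq, Real.sqrt_sq (norm_nonneg z)]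

theorem size_rpow_two_mul (j : Idx N) (σ : ℝ) (x : ℝ) :
    size j ^ (2 * σ) * x ^ 2 = (size j ^ σ * x) ^ 2 := by
  rw [mul_pow, mul_comm 2 σ, Real.rpow_mul (size_pos j).le]
  norm_cast

/-- The element of `𝒫_s` with a given underlying sequence. -/
def Phase.ofSeq {s : ℝ} (u : Idx N → ℂ) (hu : u ∈ phaseSubmodule N s) : Phase N s := ⟨u, hu⟩

@[simp] theorem Phase.seq_ofSeq {s : ℝ} (u : Idx N → ℂ) (hu : u ∈ phaseSubmodule N s) :
    (Phase.ofSeq u hu).seq = u := rfl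

theorem Phase.seq_mem {s : ℝ} (z : Phase N s) : z.seq ∈ phaseSubmodule N s := z.2

theorem Phase.ext {s : ℝ} {z w : Phase N s} (h : ∀ j, z.seq j = w.seq j) : z = w :=
  Subtype.ext (funext h)

@[simp] theorem Phase.seq_add {s : ℝ} (z w : Phase N s) : (z + w).seq = z.seq + w.seq := rfl
@[simp] theorem Phase.seq_sub {s : ℝ} (z w : Phase N s) : (z - w).seq = z.seq - w.seq := rfl
@[simp] theorem Phase.seq_neg {s : ℝ} (z : Phase N s) : (-z).seq = -z.seq := rfl
@[simp] theorem Phase.seq_smul {s : ℝ} (c : ℂ) (z : Phase N s) : (c • z).seq = c • z.seq := rfl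
@[simp] theorem Phase.seq_zero {s : ℝ} : (0 : Phase N s).seq = 0 := rfl

/-- The linear map `z ↦ (z_j)_j`. -/
def Phase.seqₗ (N : Set (Fin d → ℤ)) (s : ℝ) : Phase N s →ₗ[ℂ] (Idx N → ℂ) where
  toFun := Phase.seq
  map_add' _ _ := rfl
  map_smul' _ _ := rfl

@[simp] theorem Phase.seq_sum {s : ℝ} {ι : Type*} (t : Finset ι) (z : ι → Phase N s) :
    (∑ i ∈ t, z i).seq = ∑ i ∈ t, (z i).seq := map_sum (Phase.seqₗ N s) z t

/-- Comparison of the weighted norms of two sequences. The membership part matters, since `wnorm`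
takes junk values on sequences that are not square summable. -/
theorem wnorm_le_of_le {s σ c : ℝ} {u v : Idx N → ℂ} (hv : v ∈ phaseSubmodule N σ) (hc : 0 ≤ c)
    (h : ∀ j, size j ^ s * ‖u j‖ ≤ c * (size j ^ σ * ‖v j‖)) :
    u ∈ phaseSubmodule N s ∧ wnorm s u ≤ c * wnorm σ v := by
  have hv' : Summable fun j => c ^ 2 * (size j ^ (2 * σ) * ‖v j‖ ^ 2) :=
    Summable.mul_left _ hv
  have h0 : ∀ j, 0 ≤ size j ^ (2 * s) * ‖u j‖ ^ 2 := fun j =>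
    mul_nonneg (Real.rpow_nonneg (size_pos j).le _) (sq_nonneg _)
  have h1 : ∀ j, size j ^ (2 * s) * ‖u j‖ ^ 2 ≤ c ^ 2 * (size j ^ (2 * σ) * ‖v j‖ ^ 2) := by
    intro j
    rw [size_rpow_two_mul, size_rpow_two_mul, ← mul_pow]
    have := mul_nonneg (Real.rpow_nonneg (size_pos j).le s) (norm_nonneg (u j))
    exact pow_le_pow_left₀ this (h j) 2
  have hu : Summable fun j => size j ^ (2 * s) * ‖u j‖ ^ 2 := hv'.of_nonneg_of_le h0 h1
  refine ⟨hu, ?_⟩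
  refine abs_le_of_sq_le_sq' ?_ (mul_nonneg hc (wnorm_nonneg _ _)) |>.2
  rw [mul_pow, wnorm_sq, wnorm_sq, ← tsum_mul_left]
  exact hu.tsum_le_tsum h1 hv'

theorem wnorm_mono_exp {s σ : ℝ} {u : Idx N → ℂ} (h : σ ≤ s) (hu : u ∈ phaseSubmodule N s) :
    u ∈ phaseSubmodule N σ ∧ wnorm σ u ≤ wnorm s u := by
  have := wnorm_le_of_le (s := σ) (u := u) hu zero_le_one fun j => by
    rw [one_mul]
    exact mul_le_mul_of_nonneg_right (Real.rpow_le_rpow_of_exponent_le (one_le_size j) h)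
      (norm_nonneg _)
  simpa using this

theorem wnorm_le_norm {s σ : ℝ} (h : σ ≤ s) (z : Phase N s) : wnorm σ z.seq ≤ ‖z‖ := by
  rw [Phase.norm_eq]
  exact (wnorm_mono_exp h z.seq_mem).2

theorem wnorm_mono {σ : ℝ} {u v : Idx N → ℂ} (hv : v ∈ phaseSubmodule N σ)
    (h : ∀ j, ‖u j‖ ≤ ‖v j‖) : u ∈ phaseSubmodule N σ ∧ wnorm σ u ≤ wnorm σ v := by
  have := wnorm_le_of_le (s := σ) (u := u) hv zero_le_one fun j => by
    rw [one_mul]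
    exact mul_le_mul_of_nonneg_left (h j) (Real.rpow_nonneg (size_pos j).le _)
  simpa using this

/-- The inclusion of `𝒫_s` into `𝒫_σ` for `σ ≤ s`. -/
def Phase.lower {s σ : ℝ} (h : σ ≤ s) (z : Phase N s) : Phase N σ :=
  Phase.ofSeq z.seq (wnorm_mono_exp h z.seq_mem).1

@[simp] theorem Phase.seq_lower {s σ : ℝ} (h : σ ≤ s) (z : Phase N s) :
    (z.lower h).seq = z.seq := Phase.seq_ofSeq _ _

theorem Phase.norm_lower {s σ : ℝ} (h : σ ≤ s) (z : Phase N s) :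
    ‖z.lower h‖ = wnorm σ z.seq := by
  rw [Phase.norm_eq, Phase.seq_lower]

theorem wnorm_sum_le {σ : ℝ} {ι : Type*} (t : Finset ι) (u : ι → Idx N → ℂ)
    (hu : ∀ i, u i ∈ phaseSubmodule N σ) : wnorm σ (∑ i ∈ t, u i) ≤ ∑ i ∈ t, wnorm σ (u i) := by
  have := norm_sum_le t fun i => Phase.ofSeq (u i) (hu i)
  simp only [Phase.norm_eq, Phase.seq_sum, Phase.seq_ofSeq] at this
  exact this

theorem wnorm_smul (σ : ℝ) (c : ℂ) (u : Idx N → ℂ) : wnorm σ (c • u) = ‖c‖ * wnorm σ u := by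
  rw [wnorm, wnorm]
  simp only [Pi.smul_apply, smul_eq_mul, norm_mul, mul_pow, mul_left_comm _ (‖c‖ ^ 2)]
  rw [tsum_mul_left, Real.sqrt_mul (sq_nonneg _), Real.sqrt_sq (norm_nonneg _)]

/-- Each coordinate is controlled by the weighted norm. -/
theorem size_rpow_mul_norm_le {σ : ℝ} {u : Idx N → ℂ} (hu : u ∈ phaseSubmodule N σ) (j : Idx N) :
    size j ^ σ * ‖u j‖ ≤ wnorm σ u := by
  have h : Summable fun j => size j ^ (2 * σ) * ‖u j‖ ^ 2 := hu
  refine Real.le_sqrt_of_sq_le ?_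
  rw [← size_rpow_two_mul]
  exact h.le_tsum j fun i _ => mul_nonneg (Real.rpow_nonneg (size_pos i).le _) (sq_nonneg _)

theorem norm_apply_le {σ : ℝ} {u : Idx N → ℂ} (hu : u ∈ phaseSubmodule N σ) (j : Idx N) :
    ‖u j‖ ≤ size j ^ (-σ) * wnorm σ u := by
  rw [Real.rpow_neg (size_pos j).le, ← div_eq_inv_mul,
    le_div_iff₀ (Real.rpow_pos_of_pos (size_pos j) _), mul_comm]
  exact size_rpow_mul_norm_le hu j

/-- A coordinate functional on `𝒫_s`. -/
def coord (s : ℝ) (j : Idx N) : Phase N s →L[ℂ] ℂ :=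
  LinearMap.mkContinuous ((LinearMap.proj j).comp (Phase.seqₗ N s)) (size j ^ (-s)) fun z => by
    rw [Phase.norm_eq]
    exact norm_apply_le z.seq_mem j

@[simp] theorem coord_apply (s : ℝ) (j : Idx N) (z : Phase N s) : coord s j z = z.seq j := rfl

/-- The diagonal operator with entries `b_j` in the closed unit disc. -/
def diag (s : ℝ) (b : Idx N → ℂ) (hb : ∀ j, ‖b j‖ ≤ 1) : Phase N s →L[ℂ] Phase N s :=
  LinearMap.mkContinuous
    { toFun := fun z => Phase.ofSeq (fun j => b j * z.seq j)
        (wnorm_mono z.seq_mem fun j => by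
          rw [norm_mul]
          exact mul_le_of_le_one_left (norm_nonneg _) (hb j)).1
      map_add' := fun z w => Phase.ext fun j => mul_add _ _ _
      map_smul' := fun c z => Phase.ext fun j => mul_left_comm _ _ _ } 1 fun z => by
    rw [one_mul, Phase.norm_eq, Phase.norm_eq]
    refine (wnorm_mono z.seq_mem fun j => ?_).2
    change ‖b j * z.seq j‖ ≤ _
    rw [norm_mul]
    exact mul_le_of_le_one_left (norm_nonneg _) (hb j)

@[simp] theorem diag_seq (s : ℝ) (b : Idx N → ℂ) (hb : ∀ j, ‖b j‖ ≤ 1) (z : Phase N s)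
    (j : Idx N) : (diag s b hb z).seq j = b j * z.seq j := rfl

theorem wnorm_diag_le {s σ : ℝ} (h : σ ≤ s) (b : Idx N → ℂ) (hb : ∀ j, ‖b j‖ ≤ 1)
    (z : Phase N s) : wnorm σ (diag s b hb z).seq ≤ wnorm σ z.seq :=
  (wnorm_mono (wnorm_mono_exp h z.seq_mem).1 fun j => by
    rw [diag_seq, norm_mul]
    exact mul_le_of_le_one_left (norm_nonneg _) (hb j)).2

theorem norm_diag_le (s : ℝ) (b : Idx N → ℂ) (hb : ∀ j, ‖b j‖ ≤ 1)
    (z : Phase N s) : ‖diag s b hb z‖ ≤ ‖z‖ := by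
  rw [Phase.norm_eq, Phase.norm_eq]
  exact wnorm_diag_le le_rfl b hb z

open Classical in
/-- The restriction of a sequence to a set of indices. -/
def cut (s : ℝ) (S : Set (Idx N)) : Phase N s →L[ℂ] Phase N s :=
  diag s (fun j => if j ∈ S then 1 else 0) fun j => by split_ifs <;> simp

open Classical in
theorem cut_seq (s : ℝ) (S : Set (Idx N)) (z : Phase N s) (j : Idx N) :
    (cut s S z).seq j = if j ∈ S then z.seq j else 0 := by
  simp [cut]

theorem wnorm_cut_le {s σ : ℝ} (h : σ ≤ s) (S : Set (Idx N)) (z : Phase N s) :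
    wnorm σ (cut s S z).seq ≤ wnorm σ z.seq := wnorm_diag_le h _ _ z

theorem norm_cut_le (s : ℝ) (S : Set (Idx N)) (z : Phase N s) : ‖cut s S z‖ ≤ ‖z‖ :=
  norm_diag_le _ _ _ z

theorem cut_add_cut_compl (s : ℝ) (S : Set (Idx N)) (z : Phase N s) :
    cut s S z + cut s Sᶜ z = z := by
  classical
  refine Phase.ext fun j => ?_
  simp only [Phase.seq_add, Pi.add_apply, cut_seq, Set.mem_compl_iff]
  by_cases h : j ∈ S <;> simp [h]

/-- On sequences supported where `|j| ≤ R`, the norm of `𝒫_s` is controlled by that of `𝒫_σ`. -/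
theorem wnorm_le_of_support_le {s σ R : ℝ} (h : σ ≤ s) (hR : 0 ≤ R) {u : Idx N → ℂ}
    (hu : u ∈ phaseSubmodule N σ) (hs : ∀ j, u j ≠ 0 → size j ≤ R) :
    wnorm s u ≤ R ^ (s - σ) * wnorm σ u := by
  refine (wnorm_le_of_le hu (Real.rpow_nonneg hR _) fun j => ?_).2
  by_cases h0 : u j = 0
  · simp [h0]
  rw [← mul_assoc]
  refine mul_le_mul_of_nonneg_right ?_ (norm_nonneg _)
  calc size j ^ s = size j ^ (s - σ) * size j ^ σ := by
        rw [← Real.rpow_add (size_pos j), sub_add_cancel]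
    _ ≤ R ^ (s - σ) * size j ^ σ := by
        refine mul_le_mul_of_nonneg_right ?_ (Real.rpow_nonneg (size_pos j).le _)
        exact Real.rpow_le_rpow (size_pos j).le (hs j h0) (sub_nonneg.2 h)

/-- On sequences supported where `|j| ≥ R`, the norm of `𝒫_σ` is smaller than that of `𝒫_s`. -/
theorem wnorm_le_of_le_support {s σ R : ℝ} (h : σ ≤ s) (hR : 0 < R) {u : Idx N → ℂ}
    (hu : u ∈ phaseSubmodule N s) (hs : ∀ j, u j ≠ 0 → R ≤ size j) :
    wnorm σ u ≤ R ^ (σ - s) * wnorm s u := by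
  refine (wnorm_le_of_le hu (Real.rpow_nonneg hR.le _) fun j => ?_).2
  by_cases h0 : u j = 0
  · simp [h0]
  rw [← mul_assoc]
  refine mul_le_mul_of_nonneg_right ?_ (norm_nonneg _)
  calc size j ^ σ = size j ^ (σ - s) * size j ^ s := by
        rw [← Real.rpow_add (size_pos j), sub_add_cancel]
    _ ≤ R ^ (σ - s) * size j ^ s := by
        refine mul_le_mul_of_nonneg_right ?_ (Real.rpow_nonneg (size_pos j).le _)
        exact Real.rpow_le_rpow_of_nonpos hR (hs j h0) (sub_nonpos.2 h)

/-- The symmetry `(z_j)_j ↦ (z_{j̄})_j`. -/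
def tau (s : ℝ) : Phase N s →L[ℂ] Phase N s :=
  have key : ∀ z : Phase N s, Summable fun j => size j ^ (2 * s) * ‖z.seq (bar j)‖ ^ 2 :=
    fun z => ((barEquiv N).summable_iff (f := fun j => size j ^ (2 * s) * ‖z.seq j‖ ^ 2)).2
      z.seq_mem
  LinearMap.mkContinuous
    { toFun := fun z => Phase.ofSeq (fun j => z.seq (bar j)) (key z)
      map_add' := fun z w => rfl
      map_smul' := fun c z => rfl } 1 fun z => by
    rw [one_mul, Phase.norm_eq, Phase.norm_eq, wnorm, wnorm]
    exact (congrArg Real.sqrt ((barEquiv N).tsum_eq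
      fun j => size j ^ (2 * s) * ‖z.seq j‖ ^ 2)).le

@[simp] theorem tau_seq (s : ℝ) (z : Phase N s) (j : Idx N) :
    (tau s z).seq j = z.seq (bar j) := rfl

theorem wnorm_tau (s σ : ℝ) (z : Phase N s) : wnorm σ (tau s z).seq = wnorm σ z.seq :=
  congrArg Real.sqrt ((barEquiv N).tsum_eq fun j => size j ^ (2 * σ) * ‖z.seq j‖ ^ 2)

theorem norm_tau (s : ℝ) (z : Phase N s) : ‖tau s z‖ = ‖z‖ := by
  rw [Phase.norm_eq, Phase.norm_eq, wnorm_tau]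

/-- The unit vectors. -/
def unit (s : ℝ) (j : Idx N) : Phase N s :=
  Phase.ofSeq (open Classical in fun i => if i = j then 1 else 0) <| by
    classical
    refine summable_of_hasFiniteSupport ((Set.finite_singleton j).subset fun i hi => ?_)
    by_contra h
    have h : i ≠ j := h
    simp [h] at hi

open Classical in
theorem unit_seq (s : ℝ) (j i : Idx N) : (unit s j).seq i = if i = j then 1 else 0 := rfl

theorem tau_unit (s : ℝ) (j : Idx N) : tau s (unit s j) = unit s (bar j) := by
  classical
  refine Phase.ext fun i => ?_
  rw [tau_seq, unit_seq, unit_seq]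
  exact if_congr ⟨fun h => by rw [← h, bar_bar], fun h => by rw [h, bar_bar]⟩ rfl rfl

theorem diag_unit (s : ℝ) (b : Idx N → ℂ) (hb : ∀ j, ‖b j‖ ≤ 1) (j : Idx N) :
    diag s b hb (unit s j) = b j • unit s j := by
  classical
  refine Phase.ext fun i => ?_
  simp only [diag_seq, unit_seq, Phase.seq_smul, Pi.smul_apply, smul_eq_mul]
  split_ifs with h <;> simp [h]

theorem cut_finset_eq (s : ℝ) (Λ : Finset (Idx N)) (z : Phase N s) :
    cut s ↑Λ z = ∑ j ∈ Λ, z.seq j • unit s j := by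
  classical
  refine Phase.ext fun i => ?_
  simp [cut_seq, unit_seq, Finset.sum_apply]

/-- Finite truncations converge. -/
theorem tendsto_cut (s : ℝ) (z : Phase N s) :
    Tendsto (fun Λ : Finset (Idx N) => cut s ↑Λ z) atTop (𝓝 z) := by
  classical
  rw [tendsto_iff_norm_sub_tendsto_zero]
  have h := tendsto_tsum_compl_atTop_zero fun j => size j ^ (2 * s) * ‖z.seq j‖ ^ 2
  have h2 := (Real.continuous_sqrt.tendsto 0).comp h
  rw [Real.sqrt_zero] at h2
  refine h2.congr fun Λ => ?_
  rw [Phase.norm_eq, wnorm, Function.comp]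
  refine congrArg Real.sqrt ?_
  refine (tsum_subtype {x | x ∉ Λ} fun j => size j ^ (2 * s) * ‖z.seq j‖ ^ 2).trans ?_
  refine tsum_congr fun j => ?_
  by_cases hj : j ∈ Λ <;> simp [cut_seq, hj]

end

/-! ### Tame forms and their derivatives along tame maps -/

section

/-- Continuous multilinear forms on `𝒫_s`, with variables indexed by `ι`. -/
abbrev CForm (N : Set (Fin d → ℤ)) (s : ℝ) (ι : Type) : Type :=
  ContinuousMultilinearMap ℂ (fun _ : ι => Phase N s) ℂ

section Tame

variable {s σ : ℝ} {ι κ : Type} [Fintype ι] [DecidableEq ι] [Fintype κ] [DecidableEq κ]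

/-- The product of the norms of the `u_b`, in `𝒫_s` for `b ∈ A` and in `𝒫_σ` for `b ∉ A`. -/
def weight (σ : ℝ) (A : Finset ι) (u : ι → Phase N s) : ℝ :=
  ∏ b, if b ∈ A then ‖u b‖ else wnorm σ (u b).seq

theorem weight_nonneg (σ : ℝ) (A : Finset ι) (u : ι → Phase N s) : 0 ≤ weight σ A u :=
  Finset.prod_nonneg fun b _ => by split_ifs; exacts [norm_nonneg _, wnorm_nonneg _ _]

theorem weight_mono_exp {σ' : ℝ} (h : σ ≤ σ') (h' : σ' ≤ s) (A : Finset ι) (u : ι → Phase N s) :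
    weight σ A u ≤ weight σ' A u := by
  refine Finset.prod_le_prod (fun b _ => ?_) fun b _ => ?_
  · split_ifs; exacts [norm_nonneg _, wnorm_nonneg _ _]
  · split_ifs
    · exact le_rfl
    · exact (wnorm_mono_exp h (wnorm_mono_exp h' (u b).seq_mem).1).2

theorem weight_diag_le (h : σ ≤ s) (A : Finset ι) (b : ι → Idx N → ℂ)
    (hb : ∀ i j, ‖b i j‖ ≤ 1) (u : ι → Phase N s) :
    weight σ A (fun i => diag s (b i) (hb i) (u i)) ≤ weight σ A u := by
  refine Finset.prod_le_prod (fun b _ => ?_) fun b _ => ?_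
  · split_ifs; exacts [norm_nonneg _, wnorm_nonneg _ _]
  · split_ifs
    · exact norm_diag_le _ _ _ _
    · exact wnorm_diag_le h _ _ _

theorem weight_le_prod_norm (h : σ ≤ s) (A : Finset ι) (u : ι → Phase N s) :
    weight σ A u ≤ ∏ i, ‖u i‖ := by
  refine Finset.prod_le_prod (fun b _ => ?_) fun b _ => ?_
  · split_ifs; exacts [norm_nonneg _, wnorm_nonneg _ _]
  · split_ifs
    · exact le_rfl
    · exact wnorm_le_norm h _

theorem weight_tau (A : Finset ι) (u : ι → Phase N s) :
    weight σ A (fun i => tau s (u i)) = weight σ A u := by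
  simp only [weight, norm_tau, wnorm_tau]

/-- Tame forms: at most two of the variables are measured in the strong norm of `𝒫_s`, the other
ones in the weak norm of `𝒫_σ`. -/
def Tame (σ : ℝ) (B : CForm N s ι) : Prop :=
  ∃ C : ℝ, 0 ≤ C ∧ ∀ u, ‖B u‖ ≤ C * ∑ A ∈ Finset.univ.powersetCard 2, weight σ A u

theorem sum_weight_nonneg (σ : ℝ) (k : ℕ) (u : ι → Phase N s) :
    0 ≤ ∑ A ∈ Finset.univ.powersetCard k, weight σ A u :=
  Finset.sum_nonneg fun _ _ => weight_nonneg _ _ _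

theorem Tame.zero : Tame σ (0 : CForm N s ι) :=
  ⟨0, le_rfl, fun u => by simp⟩

theorem Tame.add {B B' : CForm N s ι} (h : Tame σ B) (h' : Tame σ B') : Tame σ (B + B') := by
  obtain ⟨C, hC, h⟩ := h
  obtain ⟨C', hC', h'⟩ := h'
  refine ⟨C + C', add_nonneg hC hC', fun u => ?_⟩
  rw [add_mul]
  exact (norm_add_le _ _).trans (add_le_add (h u) (h' u))

theorem Tame.smul {B : CForm N s ι} (c : ℂ) (h : Tame σ B) : Tame σ (c • B) := by
  obtain ⟨C, hC, h⟩ := h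
  refine ⟨‖c‖ * C, mul_nonneg (norm_nonneg _) hC, fun u => ?_⟩
  rw [smul_apply, norm_smul, mul_assoc]
  exact mul_le_mul_of_nonneg_left (h u) (norm_nonneg _)

theorem Tame.sum {α : Type*} (t : Finset α) {B : α → CForm N s ι} (h : ∀ i ∈ t, Tame σ (B i)) :
    Tame σ (∑ i ∈ t, B i) :=
  Finset.sum_induction B (Tame σ) (fun _ _ => Tame.add) Tame.zero h

theorem Tame.mono {σ' : ℝ} (hσ : σ ≤ σ') (hσ' : σ' ≤ s) {B : CForm N s ι} (h : Tame σ B) :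
    Tame σ' B := by
  obtain ⟨C, hC, h⟩ := h
  exact ⟨C, hC, fun u => (h u).trans (mul_le_mul_of_nonneg_left
    (Finset.sum_le_sum fun A _ => weight_mono_exp hσ hσ' A u) hC)⟩

theorem Tame.domDomCongr (e : ι ≃ κ) {B : CForm N s ι} (h : Tame σ B) :
    Tame σ (B.domDomCongr e : CForm N s κ) := by
  obtain ⟨C, hC, h⟩ := h
  refine ⟨C, hC, fun u => (h fun i => u (e i)).trans (mul_le_mul_of_nonneg_left ?_ hC)⟩
  have hw : ∀ A : Finset ι, weight σ A (fun i => u (e i)) = weight σ (A.map e.toEmbedding) u := by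
    intro A
    rw [weight, weight, ← e.prod_comp]
    simp
  simp only [hw]
  refine (Finset.sum_map (Finset.univ.powersetCard 2)
    (Finset.mapEmbedding e.toEmbedding).toEmbedding (fun A => weight σ A u)).symm.trans_le ?_
  refine Finset.sum_le_sum_of_subset_of_nonneg (fun A hA => ?_) fun A _ _ => weight_nonneg _ _ _
  obtain ⟨A', hA', rfl⟩ := Finset.mem_map.1 hA
  simp only [Finset.mem_powersetCard_univ] at hA' ⊢
  simpa using hA'

end Tame

variable {s : ℝ}

/-- The space of homogeneous polynomials `f` of degree `p` on `𝒫_s` that come from a tame form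
and satisfy `f(τz) = ε f(z)` for the symmetry `τ` that exchanges `z_j` and `z_{j̄}`. -/
def Form (N : Set (Fin d → ℤ)) (s σ : ℝ) (p : ℕ) (ε : ℂ) : Submodule ℂ (Phase N s → ℂ) where
  carrier := {f | ∃ B : CForm N s (Fin p), Tame σ B ∧
    (∀ u, B (fun i => tau s (u i)) = ε * B u) ∧ ∀ z, f z = B fun _ => z}
  add_mem' := by
    rintro f g ⟨B, hB, hB', hf⟩ ⟨D, hD, hD', hg⟩
    refine ⟨B + D, hB.add hD, fun u => ?_, fun z => ?_⟩
    · simp only [add_apply, hB', hD', mul_add]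
    · simp [hf, hg]
  zero_mem' := ⟨0, Tame.zero, fun u => by simp, fun z => by simp⟩
  smul_mem' := by
    rintro c f ⟨B, hB, hB', hf⟩
    refine ⟨c • B, hB.smul c, fun u => ?_, fun z => ?_⟩
    · simp only [smul_apply, hB', smul_eq_mul, mul_left_comm]
    · simp [hf]

theorem Form.mono {σ σ' : ℝ} (h : σ ≤ σ') (h' : σ' ≤ s) (p : ℕ) (ε : ℂ) :
    Form N s σ p ε ≤ Form N s σ' p ε := by
  rintro f ⟨B, hB, hB', hf⟩
  exact ⟨B, hB.mono h h', hB', hf⟩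

theorem hasFDerivAt_diagonal {p : ℕ} (B : CForm N s (Fin p)) (z : Phase N s) :
    HasFDerivAt (fun z => B fun _ => z)
      ((B.linearDeriv fun _ => z).comp (ContinuousLinearMap.pi fun _ => .id ℂ (Phase N s))) z :=
  (B.hasFDerivAt fun _ => z).comp z
    (ContinuousLinearMap.pi fun _ : Fin p => ContinuousLinearMap.id ℂ (Phase N s)).hasFDerivAt

theorem fderiv_diagonal {p : ℕ} (B : CForm N s (Fin p)) (z v : Phase N s) :
    fderiv ℂ (fun z => B fun _ => z) z v = ∑ i, B (Function.update (fun _ => z) i v) := by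
  rw [(hasFDerivAt_diagonal B z).fderiv]
  simp [ContinuousMultilinearMap.linearDeriv_apply]

theorem Form.contDiff {σ : ℝ} {p : ℕ} {ε : ℂ} {f : Phase N s → ℂ} (hf : f ∈ Form N s σ p ε) :
    ContDiff ℂ 1 f := by
  obtain ⟨B, -, -, hf⟩ := hf
  obtain rfl : f = fun z => B fun _ => z := funext hf
  exact B.contDiff.comp
    (ContinuousLinearMap.pi fun _ : Fin p => ContinuousLinearMap.id ℂ (Phase N s)).contDiff

theorem Form.norm_le {σ : ℝ} {p : ℕ} {ε : ℂ} {f : Phase N s → ℂ} (hf : f ∈ Form N s σ p ε) :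
    ∃ C : ℝ, 0 ≤ C ∧ ∀ z, ‖f z‖ ≤ C * ‖z‖ ^ p := by
  obtain ⟨B, -, -, hf⟩ := hf
  refine ⟨‖B‖, norm_nonneg _, fun z => ?_⟩
  rw [hf]
  simpa using B.le_opNorm fun _ => z

theorem Form.norm_fderiv_le {σ : ℝ} {p : ℕ} {ε : ℂ} {f : Phase N s → ℂ}
    (hf : f ∈ Form N s σ p ε) :
    ∃ C : ℝ, 0 ≤ C ∧ ∀ z v, ‖fderiv ℂ f z v‖ ≤ C * (‖z‖ ^ (p - 1) * ‖v‖) := by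
  obtain ⟨B, -, -, hf⟩ := hf
  obtain rfl : f = fun z => B fun _ => z := funext hf
  refine ⟨p * ‖B‖, by positivity, fun z v => ?_⟩
  rw [fderiv_diagonal]
  refine (norm_sum_le _ _).trans ?_
  have h : ∀ i, ‖B (Function.update (fun _ => z) i v)‖ ≤ ‖B‖ * (‖z‖ ^ (p - 1) * ‖v‖) := by
    intro i
    refine (B.le_opNorm _).trans (mul_le_mul_of_nonneg_left (le_of_eq ?_) (norm_nonneg _))
    rw [← Finset.mul_prod_erase _ _ (Finset.mem_univ i), Function.update_self, mul_comm]
    congr 1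
    rw [Finset.prod_congr rfl fun k hk => by
      rw [Function.update_of_ne (Finset.ne_of_mem_erase hk)], Finset.prod_const,
      Finset.card_erase_of_mem (Finset.mem_univ i), Finset.card_univ, Fintype.card_fin]
  refine (Finset.sum_le_sum fun i _ => h i).trans (le_of_eq ?_)
  rw [Finset.sum_const, Finset.card_univ, Fintype.card_fin, nsmul_eq_mul, mul_assoc]

/-- Tame multilinear maps from `𝒫_s` to itself: one of the variables is measured in the strong norm
of `𝒫_s`, the other ones in the weak norm of `𝒫_σ`, and the map is bounded in the weak norm. -/
structure TameMap (σ : ℝ) {m : ℕ}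
    (T : ContinuousMultilinearMap ℂ (fun _ : Fin m => Phase N s) (Phase N s)) : Prop where
  strong : ∃ C : ℝ, 0 ≤ C ∧ ∀ u, ‖T u‖ ≤ C * ∑ i, weight σ {i} u
  weak : ∃ C : ℝ, 0 ≤ C ∧ ∀ u, wnorm σ (T u).seq ≤ C * weight σ ∅ u

/-- The form `(u, v) ↦ B (T u, v)`. -/
def insertFirst {m n : ℕ} (B : CForm N s (Fin (n + 1)))
    (T : ContinuousMultilinearMap ℂ (fun _ : Fin m => Phase N s) (Phase N s)) :
    CForm N s (Fin m ⊕ Fin n) :=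
  (B.curryLeft.compContinuousMultilinearMap T).uncurrySum

theorem insertFirst_apply {m n : ℕ} (B : CForm N s (Fin (n + 1)))
    (T : ContinuousMultilinearMap ℂ (fun _ : Fin m => Phase N s) (Phase N s))
    (w : Fin m ⊕ Fin n → Phase N s) :
    insertFirst B T w = B (Fin.cons (T (w ∘ Sum.inl)) (w ∘ Sum.inr)) := rfl

theorem weight_disjSum {ι κ : Type} [Fintype ι] [DecidableEq ι] [Fintype κ] [DecidableEq κ]
    (σ : ℝ) (A : Finset ι) (A' : Finset κ) (w : ι ⊕ κ → Phase N s) :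
    weight σ (A.disjSum A') w = weight σ A (w ∘ Sum.inl) * weight σ A' (w ∘ Sum.inr) := by
  simp [weight, Fintype.prod_sum_type]

/-- If the variable that is replaced by `T u` is one of the two that are measured in the strong
norm, the strong estimate of `T` passes the strong norm on to one of the `u_i`; otherwise the weak
estimate applies. -/
theorem Tame.insertFirst {σ : ℝ} {m n : ℕ} {B : CForm N s (Fin (n + 1))}
    {T : ContinuousMultilinearMap ℂ (fun _ : Fin m => Phase N s) (Phase N s)}
    (hB : Tame σ B) (hT : TameMap σ T) : Tame σ (insertFirst B T) := by
  obtain ⟨C, hC, hB⟩ := hB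
  obtain ⟨C₁, hC₁, h₁⟩ := hT.strong
  obtain ⟨C₂, hC₂, h₂⟩ := hT.weak
  refine ⟨C * ((Finset.univ.powersetCard 2 : Finset (Finset (Fin (n + 1)))).card *
    (C₁ * m + C₂)), by positivity, fun w => ?_⟩
  rw [insertFirst_apply, mul_assoc]
  refine (hB _).trans (mul_le_mul_of_nonneg_left ?_ hC)
  set W := ∑ A ∈ Finset.univ.powersetCard 2, weight σ A w
  have hW0 : 0 ≤ W := sum_weight_nonneg _ _ _
  rw [mul_assoc, ← nsmul_eq_mul]
  refine Finset.sum_le_card_nsmul _ _ _ fun A hA => ?_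
  rw [Finset.mem_powersetCard_univ] at hA
  have hcard : (if (0 : Fin (n + 1)) ∈ A then 1 else 0) +
      (Finset.univ.filter fun b : Fin n => b.succ ∈ A).card = 2 := by
    have := Fin.card_filter_univ_succ fun b => b ∈ A
    rw [Finset.filter_univ_mem, hA] at this
    split_ifs at this ⊢ <;> omega
  set A' := Finset.univ.filter fun b : Fin n => b.succ ∈ A with hA'
  have hle : ∀ S : Finset (Fin m), S.card + A'.card = 2 →
      weight σ S (w ∘ Sum.inl) * weight σ A' (w ∘ Sum.inr) ≤ W := by
    intro S hS
    rw [← weight_disjSum]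
    refine Finset.single_le_sum (f := fun A => weight σ A w) (fun A _ => weight_nonneg _ _ _) ?_
    rw [Finset.mem_powersetCard_univ, Finset.card_disjSum, hS]
  have hw : weight σ A (Fin.cons (T (w ∘ Sum.inl)) (w ∘ Sum.inr) : Fin (n + 1) → Phase N s) =
      (if (0 : Fin (n + 1)) ∈ A then ‖T (w ∘ Sum.inl)‖ else wnorm σ (T (w ∘ Sum.inl)).seq) *
        weight σ A' (w ∘ Sum.inr) := by
    rw [weight, Fin.prod_univ_succ, weight]
    simp [hA']
  rw [hw, add_mul]
  by_cases h0 : (0 : Fin (n + 1)) ∈ A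
  · rw [if_pos h0] at hcard ⊢
    refine le_trans ?_ (le_add_of_nonneg_right (mul_nonneg hC₂ hW0))
    refine (mul_le_mul_of_nonneg_right (h₁ _) (weight_nonneg _ _ _)).trans ?_
    rw [mul_assoc, mul_assoc]
    refine mul_le_mul_of_nonneg_left ?_ hC₁
    rw [Finset.sum_mul]
    refine (Finset.sum_le_card_nsmul _ _ _ fun i _ =>
      hle {i} (by rw [Finset.card_singleton]; exact hcard)).trans_eq ?_
    simp
  · rw [if_neg h0] at hcard ⊢
    refine le_trans ?_ (le_add_of_nonneg_left (by positivity))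
    refine (mul_le_mul_of_nonneg_right (h₂ _) (weight_nonneg _ _ _)).trans ?_
    rw [mul_assoc]
    exact mul_le_mul_of_nonneg_left (hle ∅ (by rw [Finset.card_empty]; exact hcard)) hC₂

/-- The position `i` of a vector can be moved to the front by a transposition. -/
theorem cons_swap_eq_update {n : ℕ} {E : Type*} (x y : E) (v : Fin n → E) (i : Fin (n + 1)) :
    (fun k => (Fin.cons y v : Fin (n + 1) → E) (Equiv.swap 0 i k)) =
      Function.update (fun k => (Fin.cons x v : Fin (n + 1) → E) (Equiv.swap 0 i k)) i y := by
  funext k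
  by_cases hk : k = i
  · rw [hk, Function.update_self, Equiv.swap_apply_right, Fin.cons_zero]
  · rw [Function.update_of_ne hk]
    have hne : Equiv.swap 0 i k ≠ 0 := fun h => hk <| by
      rw [Equiv.swap_apply_eq_iff] at h
      rw [h, Equiv.swap_apply_left]
    obtain ⟨l, hl⟩ := Fin.exists_succ_eq_of_ne_zero hne
    rw [← hl, Fin.cons_succ, Fin.cons_succ]

/-- The derivative of an even form along a reversible tame map is an odd form, and conversely. -/
theorem Form.bracket_mem {σ : ℝ} {m n : ℕ} {ε : ℂ} {f : Phase N s → ℂ}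
    (hf : f ∈ Form N s σ (n + 1) ε)
    {T : ContinuousMultilinearMap ℂ (fun _ : Fin m => Phase N s) (Phase N s)}
    (hT : TameMap σ T) (hT' : ∀ u, T (fun i => tau s (u i)) = -tau s (T u)) :
    (fun z => fderiv ℂ f z (T fun _ => z)) ∈ Form N s σ (m + n) (-ε) := by
  obtain ⟨B, hB, hB', hf⟩ := hf
  obtain rfl : f = fun z => B fun _ => z := funext hf
  have key : (fun z => fderiv ℂ (fun z => B fun _ => z) z (T fun _ => z)) =
      ∑ i : Fin (n + 1), fun z =>
        (insertFirst (B.domDomCongr (Equiv.swap 0 i)) T).domDomCongr finSumFinEquiv fun _ => z := by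
    funext z
    rw [fderiv_diagonal, Finset.sum_apply]
    refine Finset.sum_congr rfl fun i _ => congrArg B (funext fun k => ?_)
    change _ = (Fin.cons (T fun _ => z) (fun _ => z) : Fin (n + 1) → Phase N s)
      (Equiv.swap 0 i k)
    rw [congrFun (cons_swap_eq_update z (T fun _ => z) (fun _ => z) i) k]
    congr 2
    funext k
    cases Equiv.swap 0 i k using Fin.cases <;> rfl
  rw [key]
  refine Submodule.sum_mem _ fun i _ =>
    ⟨_, ((hB.domDomCongr _).insertFirst hT).domDomCongr _, fun u => ?_, fun z => rfl⟩
  change B (fun k => (Fin.cons (T fun l => tau s (u (finSumFinEquiv (Sum.inl l))))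
      (fun l => tau s (u (finSumFinEquiv (Sum.inr l)))) : Fin (n + 1) → Phase N s)
      (Equiv.swap 0 i k)) = -ε * B (fun k => (Fin.cons (T fun l => u (finSumFinEquiv (Sum.inl l)))
      (fun l => u (finSumFinEquiv (Sum.inr l))) : Fin (n + 1) → Phase N s) (Equiv.swap 0 i k))
  set x := T fun l => u (finSumFinEquiv (Sum.inl l)) with hx
  set v : Fin n → Phase N s := fun l => u (finSumFinEquiv (Sum.inr l)) with hv
  rw [hT' fun l => u (finSumFinEquiv (Sum.inl l)), ← hx, neg_mul, ← hB']
  change B (fun k => (Fin.cons (-tau s x) (fun l => tau s (v l)) : Fin (n + 1) → Phase N s)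
      (Equiv.swap 0 i k)) = _
  rw [cons_swap_eq_update (tau s x)]
  refine (B.toMultilinearMap.map_update_neg _ _ _).trans ?_
  rw [← cons_swap_eq_update (tau s x)]
  refine congrArg (fun w => -B w) ?_
  funext k
  refine Fin.cases ?_ (fun l => ?_) (Equiv.swap 0 i k) <;> simp

end

/-! ### Averages over the linear flow -/

section

open scoped FourierTransform SchwartzMap BoundedContinuousFunction

/-- A Schwartz function whose Fourier transform is `1` at `0` and vanishes for `|x| ≥ 1`. -/
theorem exists_band_limited_kernel : ∃ η : 𝓢(ℝ, ℂ), ∫ v, η v = 1 ∧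
    ∀ x : ℝ, 1 ≤ |x| → ∫ v, η v * Complex.exp (-(Complex.I * (v * x : ℝ))) = 0 := by
  have hpi := Real.pi_pos
  let b : ContDiffBump (0 : ℝ) := ⟨(4 * Real.pi)⁻¹, (2 * Real.pi)⁻¹, by positivity, by
    gcongr; norm_num⟩
  have hb : HasCompactSupport fun v : ℝ => (b v : ℂ) :=
    b.hasCompactSupport.comp_left (g := fun x : ℝ => (x : ℂ)) rfl
  have hb' : ContDiff ℝ (⊤ : ℕ∞) fun v : ℝ => (b v : ℂ) :=
    Complex.ofRealCLM.contDiff.comp b.contDiff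
  let χ : 𝓢(ℝ, ℂ) := hb.toSchwartzMap hb'
  refine ⟨𝓕⁻ χ, ?_⟩
  have h : ∀ ξ : ℝ, ∫ v, (𝓕⁻ χ) v * Complex.exp (-(Complex.I * (v * (2 * Real.pi * ξ) : ℝ))) =
      (b ξ : ℂ) := by
    intro ξ
    have h1 : 𝓕 (𝓕⁻ χ) ξ = χ ξ := by rw [FourierTransform.fourier_fourierInv_eq]
    rw [SchwartzMap.fourier_coe, Real.fourier_real_eq_integral_exp_smul] at h1
    refine Eq.trans ?_ h1
    refine MeasureTheory.integral_congr_ae (Eventually.of_forall fun v => ?_)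
    simp only [smul_eq_mul]
    rw [mul_comm]
    congr 2
    push_cast
    ring
  constructor
  · have := h 0
    have hb1 : b 0 = 1 := b.one_of_mem_closedBall (by simp [b.rIn_pos.le])
    simpa [hb1] using this
  · intro x hx
    have := h (x / (2 * Real.pi))
    rw [mul_div_cancel₀ _ (by positivity)] at this
    rw [this, Complex.ofReal_eq_zero]
    refine b.zero_of_le_dist ?_
    rw [Real.dist_eq, sub_zero, abs_div, abs_of_pos (by positivity : 0 < 2 * Real.pi),
      le_div_iff₀ (by positivity)]
    exact (inv_mul_cancel₀ (by positivity)).trans_le hx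

/-- A bounded functional on the bounded continuous functions whose value on `t ↦ e^{-itx}` is
`1/(ix)` whenever `|x| ≥ 1`. It is the mean, against a kernel `η` as in
`exists_band_limited_kernel`, of the primitive `∫₀^v φ`: on `e^{-itx}` this primitive is
`(1 - e^{-ivx})/(ix)`, and the mean of its oscillating part vanishes. -/
theorem exists_averaging_functional : ∃ Φ : (ℝ →ᵇ ℂ) →L[ℂ] ℂ, ∀ (x : ℝ) (φ : ℝ →ᵇ ℂ), 1 ≤ |x| →
    (∀ t : ℝ, φ t = Complex.exp (-(Complex.I * (t * x : ℝ)))) → Φ φ = (Complex.I * x)⁻¹ := by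
  obtain ⟨η, h1, h0⟩ := exists_band_limited_kernel
  have hint : ∀ φ : ℝ →ᵇ ℂ, ∀ a b : ℝ, IntervalIntegrable φ MeasureTheory.volume a b :=
    fun φ a b => φ.continuous.intervalIntegrable a b
  have hprim : ∀ φ : ℝ →ᵇ ℂ, ∀ v : ℝ, ‖∫ t in (0 : ℝ)..v, φ t‖ ≤ ‖φ‖ * |v| := by
    intro φ v
    simpa using intervalIntegral.norm_integral_le_of_norm_le_const
      (a := 0) (b := v) fun t _ => φ.norm_coe_le_norm t
  have hη : MeasureTheory.Integrable fun v : ℝ => |v| * ‖η v‖ := by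
    simpa using η.integrable_pow_mul MeasureTheory.volume 1
  have hI : ∀ φ : ℝ →ᵇ ℂ, MeasureTheory.Integrable fun v => η v * ∫ t in (0 : ℝ)..v, φ t := by
    intro φ
    refine (hη.const_mul ‖φ‖).mono' ?_ (Eventually.of_forall fun v => ?_)
    · exact (η.continuous.mul
        (intervalIntegral.continuous_primitive (hint φ) 0)).aestronglyMeasurable
    · rw [norm_mul, mul_comm, ← mul_assoc]
      exact mul_le_mul_of_nonneg_right (hprim φ v) (norm_nonneg _)
  refine ⟨LinearMap.mkContinuous
    { toFun := fun φ => ∫ v, η v * ∫ t in (0 : ℝ)..v, φ t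
      map_add' := fun φ ψ => ?_
      map_smul' := fun c φ => ?_ } (∫ v : ℝ, |v| * ‖η v‖) fun φ => ?_, fun x φ hx hφ => ?_⟩
  · rw [← MeasureTheory.integral_add (hI φ) (hI ψ)]
    refine MeasureTheory.integral_congr_ae (Eventually.of_forall fun v => ?_)
    simp only [BoundedContinuousFunction.coe_add, Pi.add_apply]
    rw [intervalIntegral.integral_add (hint φ _ _) (hint ψ _ _), mul_add]
  · simp only [BoundedContinuousFunction.coe_smul, smul_eq_mul, RingHom.id_apply]
    rw [← MeasureTheory.integral_const_mul]
    refine MeasureTheory.integral_congr_ae (Eventually.of_forall fun v => ?_)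
    simp only
    rw [intervalIntegral.integral_const_mul, mul_left_comm]
  · refine (MeasureTheory.norm_integral_le_of_norm_le (hη.const_mul ‖φ‖)
      (Eventually.of_forall fun v => ?_)).trans_eq ?_
    · rw [norm_mul, mul_comm, ← mul_assoc]
      exact mul_le_mul_of_nonneg_right (hprim φ v) (norm_nonneg _)
    · rw [MeasureTheory.integral_const_mul, mul_comm]
  · change ∫ v, η v * ∫ t in (0 : ℝ)..v, φ t = _
    have hx0 : x ≠ 0 := by rintro rfl; norm_num at hx
    have hc : -(Complex.I * x) ≠ 0 := by simp [hx0]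
    have hp : ∀ v : ℝ, ∫ t in (0 : ℝ)..v, φ t =
        (Complex.exp (-(Complex.I * (v * x : ℝ))) - 1) / (-(Complex.I * x)) := by
      intro v
      have := integral_exp_mul_complex (a := 0) (b := v) hc
      simp only [Complex.ofReal_zero, mul_zero, Complex.exp_zero] at this
      rw [show -(Complex.I * (v * x : ℝ)) = -(Complex.I * x) * v by push_cast; ring, ← this]
      refine intervalIntegral.integral_congr fun t _ => ?_
      simp only [hφ]
      congr 1
      push_cast
      ring
    simp only [hp]
    have hi : MeasureTheory.Integrable fun v : ℝ =>
        η v * Complex.exp (-(Complex.I * (v * x : ℝ))) := by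
      refine η.integrable.norm.mono' ?_ (Eventually.of_forall fun v => ?_)
      · exact (η.continuous.mul (by fun_prop)).aestronglyMeasurable
      · rw [norm_mul, show -(Complex.I * (v * x : ℝ)) = ((-(v * x) : ℝ) : ℂ) * Complex.I by
          push_cast; ring, Complex.norm_exp_ofReal_mul_I, mul_one]
    calc ∫ v : ℝ, η v * ((Complex.exp (-(Complex.I * (v * x : ℝ))) - 1) / (-(Complex.I * x)))
        = ∫ v : ℝ, (η v * Complex.exp (-(Complex.I * (v * x : ℝ))) - η v) *
            (-(Complex.I * x))⁻¹ := by
          refine MeasureTheory.integral_congr_ae (Eventually.of_forall fun v => ?_)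
          simp only
          ring
      _ = (Complex.I * x)⁻¹ := by
          rw [MeasureTheory.integral_mul_const, MeasureTheory.integral_sub hi η.integrable, h1,
            h0 x hx]
          rw [zero_sub, inv_neg, neg_mul_neg, one_mul]

variable {s : ℝ}

/-- The flow at time `t` of the linear system `i ż_j = ω_j z_j`. -/
def rot (s : ℝ) (ω : Idx N → ℝ) (t : ℝ) : Phase N s →L[ℂ] Phase N s :=
  diag s (fun j => Complex.exp (-(Complex.I * (t * ω j : ℝ)))) fun j => by
    rw [show -(Complex.I * (t * ω j : ℝ)) = ((-(t * ω j) : ℝ) : ℂ) * Complex.I by push_cast; ring,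
      Complex.norm_exp_ofReal_mul_I]

theorem norm_rot_le (ω : Idx N → ℝ) (t : ℝ) (z : Phase N s) : ‖rot s ω t z‖ ≤ ‖z‖ :=
  norm_diag_le _ _ _ _

theorem continuous_rot (ω : Idx N → ℝ) (z : Phase N s) : Continuous fun t => rot s ω t z := by
  refine continuous_of_uniform_approx_of_continuous fun V hV => ?_
  obtain ⟨ε, hε, hV⟩ := Metric.mem_uniformity_dist.1 hV
  obtain ⟨Λ, hΛ⟩ := ((Metric.tendsto_nhds.1 (tendsto_cut s z) ε hε)).exists
  refine ⟨fun t => rot s ω t (cut s ↑Λ z), ?_, fun t => hV ?_⟩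
  · simp only [cut_finset_eq, map_sum, map_smul, rot, diag_unit]
    fun_prop
  · rw [dist_comm, dist_eq_norm, ← map_sub]
    rw [dist_eq_norm] at hΛ
    exact (norm_rot_le ω t _).trans_lt hΛ

theorem rot_unit (ω : Idx N → ℝ) (t : ℝ) (j : Idx N) :
    rot s ω t (unit s j) = Complex.exp (-(Complex.I * (t * ω j : ℝ))) • unit s j :=
  diag_unit _ _ _ _

/-- Division of the coefficients of a form by `i (ω_{l₁} + ⋯ + ω_{l_p})`, on the set where this
divisor is at least `δ`, costs a factor `δ⁻¹` only. The quotient is an average of the form over the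
linear flow, which preserves all weighted norms, so the bounds on the form survive whatever the
frequencies are. -/
theorem exists_averaged_form (ω : Idx N → ℝ) : ∃ K : ℝ, 0 ≤ K ∧
    ∀ (ι : Type) [Fintype ι] (B : CForm N s ι) (δ : ℝ), 0 < δ → ∃ D : CForm N s ι,
      (∀ u M, (∀ t, ‖B fun i => rot s ω t (u i)‖ ≤ M) → ‖D u‖ ≤ K / δ * M) ∧
      ∀ l : ι → Idx N, (B (fun i => unit s (l i)) ≠ 0 → δ ≤ |∑ i, ω (l i)|) →
        Complex.I * (∑ i, ω (l i) : ℝ) * D (fun i => unit s (l i)) = B fun i => unit s (l i) := by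
  obtain ⟨Φ, hΦ⟩ := exists_averaging_functional
  refine ⟨‖Φ‖, norm_nonneg _, fun ι _ B δ hδ => ?_⟩
  have hcont : ∀ u : ι → Phase N s, Continuous fun t : ℝ => B fun i => rot s ω (t / δ) (u i) :=
    fun u => B.cont.comp (continuous_pi fun i =>
      (continuous_rot ω (u i)).comp (continuous_id.div_const δ))
  have hbd : ∀ (u : ι → Phase N s) (t : ℝ),
      ‖B fun i => rot s ω (t / δ) (u i)‖ ≤ ‖B‖ * ∏ i, ‖u i‖ := fun u t =>
    (B.le_opNorm _).trans (mul_le_mul_of_nonneg_left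
      (Finset.prod_le_prod (fun _ _ => norm_nonneg _) fun i _ => norm_rot_le _ _ _) (norm_nonneg _))
  let G : MultilinearMap ℂ (fun _ : ι => Phase N s) (ℝ →ᵇ ℂ) :=
    { toFun := fun u => BoundedContinuousFunction.ofNormedAddCommGroup _ (hcont u) _ (hbd u)
      map_update_add' := fun u i x y => by
        ext t
        exact (B.compContinuousLinearMap fun _ => rot s ω (t / δ)).map_update_add u i x y
      map_update_smul' := fun u i c x => by
        ext t
        exact (B.compContinuousLinearMap fun _ => rot s ω (t / δ)).map_update_smul u i c x }
  have hG : ∀ u t, G u t = B fun i => rot s ω (t / δ) (u i) := fun u t => rfl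
  have hGn : ∀ u M, (∀ t, ‖B fun i => rot s ω t (u i)‖ ≤ M) →
      ‖(δ : ℂ)⁻¹ * Φ (G u)‖ ≤ ‖Φ‖ / δ * M := by
    intro u M hM
    rw [norm_mul, norm_inv, Complex.norm_real, Real.norm_of_nonneg hδ.le, div_mul_eq_mul_div,
      inv_mul_eq_div]
    refine div_le_div_of_nonneg_right ((Φ.le_opNorm _).trans ?_) hδ.le
    refine mul_le_mul_of_nonneg_left ?_ (norm_nonneg _)
    exact (BoundedContinuousFunction.norm_le ((norm_nonneg _).trans (hM 0))).2 fun t => hM _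
  refine ⟨MultilinearMap.mkContinuous (((δ : ℂ)⁻¹ • Φ.toLinearMap).compMultilinearMap G)
    (‖Φ‖ / δ * ‖B‖) fun u => ?_, fun u M hM => hGn u M hM, fun l hl => ?_⟩
  · rw [mul_assoc]
    refine hGn u _ fun t => ?_
    have := hbd u (t * δ)
    rwa [mul_div_cancel_right₀ _ hδ.ne'] at this
  · change _ * ((δ : ℂ)⁻¹ * Φ (G fun i => unit s (l i))) = _
    set Ω := ∑ i, ω (l i) with hΩ
    set β := B fun i => unit s (l i) with hβ
    have hGl : ∀ t : ℝ, G (fun i => unit s (l i)) t =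
        Complex.exp (-(Complex.I * (t * (Ω / δ) : ℝ))) * β := by
      intro t
      rw [hG]
      simp only [rot_unit]
      refine (B.map_smul_univ _ _).trans ?_
      rw [smul_eq_mul, ← Complex.exp_sum]
      congr 2
      rw [Finset.sum_neg_distrib, ← Finset.mul_sum, ← Complex.ofReal_sum, ← Finset.mul_sum, ← hΩ]
      congr 3
      ring
    by_cases hβ0 : β = 0
    · have : G (fun i => unit s (l i)) = 0 := by
        ext t
        rw [hGl, hβ0, mul_zero]
        rfl
      rw [this, map_zero, mul_zero, mul_zero, hβ0]
    · have hΩ0 := hl hβ0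
      have hx : 1 ≤ |Ω / δ| := by
        rw [abs_div, abs_of_pos hδ, one_le_div hδ]
        exact hΩ0
      have h1 := hΦ (Ω / δ) (β⁻¹ • G fun i => unit s (l i)) hx fun t => by
        change β⁻¹ * G (fun i => unit s (l i)) t = _
        rw [hGl, mul_left_comm, inv_mul_cancel₀ hβ0, mul_one]
      rw [map_smul, smul_eq_mul] at h1
      have h2 : Φ (G fun i => unit s (l i)) = β * (Complex.I * (Ω / δ : ℝ))⁻¹ := by
        rw [← h1, mul_inv_cancel_left₀ hβ0]
      have hΩ1 : (Ω : ℂ) ≠ 0 := by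
        rw [Complex.ofReal_ne_zero]
        rintro h
        rw [h, abs_zero] at hΩ0
        linarith
      have hδ1 : (δ : ℂ) ≠ 0 := Complex.ofReal_ne_zero.2 hδ.ne'
      rw [h2]
      push_cast
      field_simp

end

/-! ### Division by small divisors -/

section

theorem sortedSizes_perm {r : ℕ} (j : Fin r → Idx N) :
    (sortedSizes j).Perm (List.ofFn fun i => size (j i)) := List.mergeSort_perm _ _

theorem sortedSizes_pairwise {r : ℕ} (j : Fin r → Idx N) :
    (sortedSizes j).Pairwise fun x y => y ≤ x := by
  have := List.pairwise_mergeSort (le := fun x y : ℝ => decide (y ≤ x))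
    (fun a b c h h' => by simp only [decide_eq_true_eq] at *; exact h'.trans h)
    (fun a b => by simpa using le_total b a) (List.ofFn fun i => size (j i))
  simpa [sortedSizes] using this

theorem countP_sortedSizes {r : ℕ} (j : Fin r → Idx N) (R : ℝ) :
    (sortedSizes j).countP (fun x => decide (R < x)) =
      (Finset.univ.filter fun i => R < size (j i)).card := by
  rw [(sortedSizes_perm j).countP_eq, ← Multiset.coe_countP, ← Fin.univ_val_map,
    Multiset.countP_map]
  rfl

/-- The entry of index `p` (counted from `0`) of the sorted list is at most `R` if at most `p` of
the sizes exceed `R`. -/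
theorem sortedSizes_getD_le {r : ℕ} (j : Fin r → Idx N) (p : ℕ) {R : ℝ} (hR : 1 ≤ R)
    (h : (Finset.univ.filter fun i => R < size (j i)).card ≤ p) :
    (sortedSizes j).getD p 1 ≤ R := by
  by_cases hp : p < (sortedSizes j).length
  · rw [List.getD_eq_getElem _ _ hp]
    by_contra! hlt
    rw [← countP_sortedSizes] at h
    have h1 : ((sortedSizes j).take (p + 1)).countP (fun x => decide (R < x)) = p + 1 := by
      rw [List.countP_eq_length.2, List.length_take, min_eq_left hp]
      intro a ha
      obtain ⟨q, hq, rfl⟩ := List.getElem_of_mem ha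
      rw [List.length_take] at hq
      rw [List.getElem_take, decide_eq_true_eq]
      rcases Nat.lt_or_ge q p with hqp | hqp
      · exact hlt.trans_le (List.pairwise_iff_getElem.1 (sortedSizes_pairwise j) q p _ hp hqp)
      · obtain rfl : q = p := by omega
        exact hlt
    have h2 := (List.take_sublist (p + 1) (sortedSizes j)).countP_le
      (p := fun x => decide (R < x))
    omega
  · rw [List.getD_eq_default _ _ (not_lt.1 hp)]
    exact hR

theorem one_le_sortedSizes_getD {r : ℕ} (j : Fin r → Idx N) (p : ℕ) :
    1 ≤ (sortedSizes j).getD p 1 := by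
  by_cases hp : p < (sortedSizes j).length
  · rw [List.getD_eq_getElem _ _ hp]
    have := (sortedSizes_perm j).subset (List.getElem_mem hp)
    obtain ⟨i, hi⟩ := List.mem_ofFn.1 this
    rw [← hi]
    exact one_le_size _
  · rw [List.getD_eq_default _ _ (not_lt.1 hp)]

theorem size_le_sortedSizes_getD_zero {r : ℕ} (j : Fin r → Idx N) (i : Fin r) :
    size (j i) ≤ (sortedSizes j).getD 0 1 := by
  have hmem : size (j i) ∈ sortedSizes j :=
    (sortedSizes_perm j).symm.subset (List.mem_ofFn.2 ⟨i, rfl⟩)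
  obtain ⟨q, hq, hq'⟩ := List.getElem_of_mem hmem
  rw [List.getD_eq_getElem _ _ (by omega), ← hq']
  rcases Nat.eq_zero_or_pos q with rfl | h
  · exact le_rfl
  · exact List.pairwise_iff_getElem.1 (sortedSizes_pairwise j) 0 q _ hq h

theorem one_le_mu {r : ℕ} (j : Fin r → Idx N) : 1 ≤ mu j := one_le_sortedSizes_getD j 2

theorem mu_le {r : ℕ} (j : Fin r → Idx N) {R : ℝ} (hR : 1 ≤ R)
    (h : (Finset.univ.filter fun i => R < size (j i)).card ≤ 2) : mu j ≤ R :=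
  sortedSizes_getD_le j 2 hR h

/-- In a finite family of distinct elements of a linear order, exactly one element has exactly `m`
elements above it. -/
theorem existsUnique_card_above {p m : ℕ} (hm : m < p) {L : Type*} [LinearOrder L] (k : Fin p → L)
    (hk : Function.Injective k) :
    ∃! c, (Finset.univ.filter fun b => k c < k b).card = m := by
  have hlt : ∀ c, (Finset.univ.filter fun b => k c < k b).card < p := by
    intro c
    have : (Finset.univ.filter fun b => k c < k b) ⊂ Finset.univ :=
      (Finset.ssubset_univ_iff).2 fun h => by
        have := h ▸ Finset.mem_univ c
        simp at this
    simpa using Finset.card_lt_card this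
  have hmono : ∀ c c', k c < k c' → (Finset.univ.filter fun b => k c' < k b).card <
      (Finset.univ.filter fun b => k c < k b).card := by
    intro c c' h
    refine Finset.card_lt_card ⟨fun b hb => ?_, fun hs => ?_⟩
    · simp only [Finset.mem_filter, Finset.mem_univ, true_and] at hb ⊢
      exact h.trans hb
    · have := hs (by simpa using h : c' ∈ _)
      simp at this
  have hinj : Function.Injective fun c => (⟨_, hlt c⟩ : Fin p) := by
    intro c c' h
    simp only [Fin.mk.injEq] at h
    rcases lt_trichotomy (k c) (k c') with h1 | h1 | h1
    · exact absurd h (hmono _ _ h1).ne'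
    · exact hk h1
    · exact absurd h (hmono _ _ h1).ne
  obtain ⟨c, hc⟩ := (Finite.injective_iff_surjective.1 hinj) ⟨m, hm⟩
  refine ⟨c, congrArg Fin.val hc, fun c' hc' => hinj ?_⟩
  exact (Fin.ext hc').trans hc.symm

/-- The sets of indices allowed in the variable `b` for the tuples whose third largest index is
`j`, at the position `c`, and whose two larger indices are at the positions in `A`. Ties between
indices of equal size are resolved by comparing the positions. -/
def cell {p : ℕ} (A : Finset (Fin p)) (c : Fin p) (j : Idx N) (b : Fin p) : Set (Idx N) :=
  if b = c then {j} else {x | b ∈ A ↔ toLex (size j, c) < toLex (size x, b)}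

theorem le_size_of_mem_cell {p : ℕ} {A : Finset (Fin p)} {c : Fin p} {j : Idx N} {b : Fin p}
    (hc : c ∉ A) (hb : b ∈ A) {x : Idx N} (hx : x ∈ cell A c j b) : size j ≤ size x := by
  have hbc : b ≠ c := fun h => hc (h ▸ hb)
  rw [cell, if_neg hbc] at hx
  have := Prod.Lex.toLex_lt_toLex.1 (hx.1 hb)
  rcases this with h | h
  · exact h.le
  · exact h.1.le

theorem size_le_of_mem_cell {p : ℕ} {A : Finset (Fin p)} {c : Fin p} {j : Idx N} {b : Fin p}
    (hb : b ∉ A) {x : Idx N} (hx : x ∈ cell A c j b) : size x ≤ size j := by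
  rw [cell] at hx
  split_ifs at hx with hbc
  · rw [Set.mem_singleton_iff.1 hx]
  · have := not_lt.1 fun h => hb (hx.2 h)
    rcases Prod.Lex.toLex_le_toLex.1 this with h | h
    · exact h.le
    · exact h.1.le

theorem mu_le_of_mem_cell {p : ℕ} {A : Finset (Fin p)} {c : Fin p} (hA : A.card = 2)
    {l : Fin p → Idx N} (h : ∀ b, l b ∈ cell A c (l c) b) : mu l ≤ size (l c) := by
  refine mu_le l (one_le_size _) ((Finset.card_le_card fun b hb => ?_).trans_eq hA)
  have hlt := (Finset.mem_filter.1 hb).2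
  have hbc : b ≠ c := by rintro rfl; exact lt_irrefl _ hlt
  have := h b
  rw [cell, if_neg hbc] at this
  exact this.2 (Prod.Lex.toLex_lt_toLex.2 (Or.inl hlt))

/-- For `p ≥ 3` each tuple belongs to exactly one cell. -/
theorem sum_cell {p : ℕ} (hp : 3 ≤ p) (l : Fin p → Idx N) (x : ℂ) :
    ∑ A ∈ (Finset.univ : Finset (Fin p)).powersetCard 2, ∑ c ∈ Finset.univ.filter fun c => c ∉ A,
      (open Classical in if ∀ b, l b ∈ cell A c (l c) b then x else 0) = x := by
  classical
  let k : Fin p → ℝ ×ₗ Fin p := fun b => toLex (size (l b), b)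
  have hk : Function.Injective k := fun b b' h => congrArg Prod.snd (toLex.injective h)
  obtain ⟨c, hc, hu⟩ := existsUnique_card_above (show 2 < p by omega) k hk
  have hiff : ∀ A : Finset (Fin p), ∀ c ∉ A, (∀ b, l b ∈ cell A c (l c) b) ↔
      A = Finset.univ.filter fun b => k c < k b := by
    intro A c hcA
    constructor
    · intro h
      ext b
      rw [Finset.mem_filter]
      by_cases hbc : b = c
      · subst hbc
        simp [hcA]
      · have := h b
        rw [cell, if_neg hbc] at this
        exact this.trans ⟨fun h => ⟨Finset.mem_univ _, h⟩, fun h => h.2⟩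
    · rintro h b
      by_cases hbc : b = c
      · subst hbc
        rw [cell, if_pos rfl]
        rfl
      · rw [cell, if_neg hbc]
        change b ∈ A ↔ k c < k b
        rw [h]
        simp
  rw [Finset.sum_eq_single (Finset.univ.filter fun b => k c < k b)]
  · rw [Finset.sum_eq_single c]
    · rw [if_pos ((hiff _ c (by simp)).2 rfl)]
    · intro c' hc' hne
      rw [if_neg fun h => hne (hu c' ?_)]
      change (Finset.univ.filter fun b => k c' < k b).card = 2
      rw [← (hiff _ c' (Finset.mem_filter.1 hc').2).1 h]
      exact hc
    · intro h
      simp at h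
  · intro A hA hne
    refine Finset.sum_eq_zero fun c' hc' => if_neg fun h => hne ?_
    have h1 := (hiff _ c' (Finset.mem_filter.1 hc').2).1 h
    have h2 := hu c' (by
      change (Finset.univ.filter fun b => k c' < k b).card = 2
      rw [← h1]
      exact Finset.mem_powersetCard_univ.1 hA)
    rw [h1, h2]
  · intro h
    exact absurd (Finset.mem_powersetCard_univ.2 hc) h

variable {s : ℝ}

/-- On a cell, the weights in which two variables are measured in the strong norm are dominated by
the one where these are the two variables with the largest indices. -/
theorem weight_le_of_cell {σ : ℝ} (h : σ ≤ s) {p : ℕ} {A A' : Finset (Fin p)}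
    (hA : A.card = A'.card) {R : ℝ} (hR : 0 < R) (v : Fin p → Phase N s)
    (h1 : ∀ b ∈ A, ∀ x, (v b).seq x ≠ 0 → R ≤ size x)
    (h2 : ∀ b ∉ A, ∀ x, (v b).seq x ≠ 0 → size x ≤ R) :
    weight σ A' v ≤ weight σ A v := by
  let e : Finset (Fin p) → Fin p → ℝ := fun A b => if b ∈ A then s - σ else 0
  have he : ∀ A : Finset (Fin p), ∑ b, e A b = A.card * (s - σ) := fun A => by
    simp only [e, Finset.sum_ite_mem, Finset.univ_inter, Finset.sum_const, nsmul_eq_mul]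
  have key : ∀ b, (if b ∈ A' then ‖v b‖ else wnorm σ (v b).seq) ≤
      R ^ (e A' b - e A b) * (if b ∈ A then ‖v b‖ else wnorm σ (v b).seq) := by
    intro b
    have hm := (wnorm_mono_exp h (v b).seq_mem).1
    by_cases hb : b ∈ A <;> by_cases hb' : b ∈ A' <;> simp only [hb, hb', e, if_true, if_false,
      sub_self, Real.rpow_zero, one_mul, le_refl, zero_sub, sub_zero, neg_sub]
    · rw [Phase.norm_eq]
      exact wnorm_le_of_le_support h hR (v b).seq_mem (h1 b hb)
    · rw [Phase.norm_eq]
      exact wnorm_le_of_support_le h hR.le hm (h2 b hb)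
  calc weight σ A' v ≤ ∏ b, R ^ (e A' b - e A b) *
        (if b ∈ A then ‖v b‖ else wnorm σ (v b).seq) :=
        Finset.prod_le_prod (fun b _ => by
          split_ifs; exacts [norm_nonneg _, wnorm_nonneg _ _]) fun b _ => key b
    _ = R ^ (∑ b, (e A' b - e A b)) * weight σ A v := by
        rw [Finset.prod_mul_distrib, ← Real.rpow_sum_of_pos hR, weight]
    _ = weight σ A v := by
        rw [Finset.sum_sub_distrib, he, he, hA, sub_self, Real.rpow_zero, one_mul]

open Classical in
theorem cut_unit (S : Set (Idx N)) (j : Idx N) :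
    cut s S (unit s j) = (if j ∈ S then (1 : ℂ) else 0) • unit s j := diag_unit _ _ _ _

/-- Division of a tame form by the small divisors: the form stays tame, with a larger exponent
for the weak norm. The form is cut into the cells with a given third largest index `j`. There the
divisor is at least `γ |j|^{-α}`, and the division costs `|j|^α`, which is absorbed by the weak norm
of the variable that carries `j`. The loss of `2d` derivatives makes the sum over `j` converge. -/
theorem Tame.exists_div {σ α γ : ℝ} (hα : 0 ≤ α) (hγ : 0 < γ) (hσ : σ + α + 2 * d ≤ s) {p : ℕ}
    (hp : 3 ≤ p) (ω : Idx N → ℝ) {B : CForm N s (Fin p)} (hB : Tame σ B)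
    (hω : ∀ l : Fin p → Idx N, B (fun i => unit s (l i)) ≠ 0 →
      γ / mu l ^ α ≤ |∑ i, ω (l i)|) :
    ∃ E : CForm N s (Fin p), Tame (σ + α + 2 * d) E ∧ ∀ l : Fin p → Idx N,
      Complex.I * (∑ i, ω (l i) : ℝ) * E (fun i => unit s (l i)) = B fun i => unit s (l i) := by
  classical
  obtain ⟨C, hC, hB⟩ := hB
  obtain ⟨K, hK, hav⟩ := exists_averaged_form (s := s) ω
  have hd0 : (0 : ℝ) ≤ 2 * d := by positivity
  have hσs : σ ≤ s := by linarith
  set σ' := σ + α + 2 * d with hσ'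
  have hσσ' : σ ≤ σ' := by linarith
  have hδ : ∀ j : Idx N, 0 < γ / size j ^ α := fun j =>
    div_pos hγ (Real.rpow_pos_of_pos (size_pos j) _)
  choose D hD hDl using fun (A : Finset (Fin p)) (c : Fin p) (j : Idx N) =>
    hav (Fin p) (B.compContinuousLinearMap fun b => cut s (cell A c j b)) _ (hδ j)
  set n : ℝ := ((Finset.univ.powersetCard 2 : Finset (Finset (Fin p))).card : ℝ) with hn
  have hn0 : 0 ≤ n := Nat.cast_nonneg _
  have hbound : ∀ A : Finset (Fin p), A.card = 2 → ∀ c ∉ A, ∀ j u,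
      ‖D A c j u‖ ≤ K / γ * (C * n) * (size j ^ (-(2 * d : ℝ)) * weight σ' A u) := by
    intro A hA c hc j u
    have hj := size_pos j
    have hB' : ∀ t, ‖(B.compContinuousLinearMap fun b => cut s (cell A c j b))
        fun i => rot s ω t (u i)‖ ≤ C * n * (size j ^ (-(α + 2 * d)) * weight σ' A u) := by
      intro t
      set v : Fin p → Phase N s := fun b => cut s (cell A c j b) (rot s ω t (u b)) with hv
      have hsupp : ∀ b x, (v b).seq x ≠ 0 → x ∈ cell A c j b := by
        intro b x hx
        by_contra hn
        simp [hv, cut_seq, hn] at hx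
      have hw : weight σ A v ≤ size j ^ (-(α + 2 * d)) * weight σ' A u := by
        rw [weight, weight, ← Finset.mul_prod_erase _ _ (Finset.mem_univ c),
          ← Finset.mul_prod_erase _ _ (Finset.mem_univ c), if_neg hc, if_neg hc, ← mul_assoc]
        refine mul_le_mul ?_ ?_ (Finset.prod_nonneg fun b _ => ?_)
          (mul_nonneg (Real.rpow_nonneg hj.le _) (wnorm_nonneg _ _))
        · have h1 := wnorm_le_of_le_support hσσ' hj (wnorm_mono_exp hσ (v c).seq_mem).1
            fun x hx => by
              have := hsupp c x hx
              rw [cell, if_pos rfl] at this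
              rw [Set.mem_singleton_iff.1 this]
          rw [show -(α + 2 * d) = σ - σ' by rw [hσ']; ring]
          refine h1.trans (mul_le_mul_of_nonneg_left ?_ (Real.rpow_nonneg hj.le _))
          exact (wnorm_cut_le hσ _ _).trans (wnorm_diag_le hσ _ _ _)
        · refine Finset.prod_le_prod (fun b _ => ?_) fun b _ => ?_
          · split_ifs; exacts [norm_nonneg _, wnorm_nonneg _ _]
          · split_ifs
            · exact (norm_cut_le _ _ _).trans (norm_rot_le _ _ _)
            · refine (wnorm_mono_exp hσσ' (wnorm_mono_exp hσ (v b).seq_mem).1).2.trans ?_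
              exact (wnorm_cut_le hσ _ _).trans (wnorm_diag_le hσ _ _ _)
        · split_ifs; exacts [norm_nonneg _, wnorm_nonneg _ _]
      change ‖B v‖ ≤ _
      refine (hB v).trans ?_
      rw [mul_assoc]
      refine mul_le_mul_of_nonneg_left ?_ hC
      rw [hn, ← nsmul_eq_mul]
      refine Finset.sum_le_card_nsmul _ _ _ fun A' hA' => le_trans ?_ hw
      refine weight_le_of_cell hσs (hA.trans (Finset.mem_powersetCard_univ.1 hA').symm) hj v
        (fun b hb x hx => le_size_of_mem_cell hc hb (hsupp b x hx))
        fun b hb x hx => size_le_of_mem_cell hb (hsupp b x hx)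
    refine (hD A c j u _ hB').trans_eq ?_
    rw [neg_add, Real.rpow_add hj, Real.rpow_neg hj.le α]
    have : size j ^ α ≠ 0 := (Real.rpow_pos_of_pos hj _).ne'
    field_simp
  have hsum : ∀ A : Finset (Fin p), A.card = 2 → ∀ c ∉ A, Summable fun j => D A c j := by
    intro A hA c hc
    refine Summable.of_norm_bounded ((summable_size_rpow N).mul_left (K / γ * (C * n))) fun j => ?_
    refine ContinuousMultilinearMap.opNorm_le_bound
      (mul_nonneg (by positivity) (Real.rpow_nonneg (size_pos j).le _)) fun u => ?_
    rw [mul_assoc]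
    refine (hbound A hA c hc j u).trans (mul_le_mul_of_nonneg_left ?_ (by positivity))
    exact mul_le_mul_of_nonneg_left (weight_le_prod_norm hσ _ _)
      (Real.rpow_nonneg (size_pos j).le _)
  set Z := ∑' j : Idx N, size j ^ (-(2 * d : ℝ)) with hZ
  refine ⟨∑ A ∈ Finset.univ.powersetCard 2, ∑ c ∈ Finset.univ.filter fun c => c ∉ A,
    ∑' j, D A c j, Tame.sum _ fun A hA => Tame.sum _ fun c hc => ?_, fun l => ?_⟩
  · have hA := Finset.mem_powersetCard_univ.1 hA
    have hc := (Finset.mem_filter.1 hc).2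
    have hZ0 : 0 ≤ Z := tsum_nonneg fun j => Real.rpow_nonneg (size_pos j).le _
    refine ⟨K / γ * (C * n) * Z, by positivity, fun u => ?_⟩
    rw [ContinuousMultilinearMap.tsum_eval (hsum A hA c hc)]
    refine (tsum_of_norm_bounded (((summable_size_rpow N).hasSum.mul_right _).mul_left _)
      (hbound A hA c hc · u)).trans ?_
    rw [mul_assoc _ Z]
    refine mul_le_mul_of_nonneg_left (mul_le_mul_of_nonneg_left ?_ hZ0) (by positivity)
    exact Finset.single_le_sum (f := fun A => weight σ' A u) (fun A _ => weight_nonneg _ _ _)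
      (Finset.mem_powersetCard_univ.2 hA)
  · set Ω : ℝ := ∑ i, ω (l i) with hΩ
    have hcut : ∀ A c j, (B.compContinuousLinearMap fun b => cut s (cell A c j b))
        (fun i => unit s (l i)) =
          if ∀ b, l b ∈ cell A c j b then B (fun i => unit s (l i)) else 0 := by
      intro A c j
      change B (fun b => cut s (cell A c j b) (unit s (l b))) = _
      simp only [cut_unit]
      refine (B.map_smul_univ _ _).trans ?_
      rw [Finset.prod_ite_zero]
      simp
    rw [← sum_cell hp l (B fun i => unit s (l i)), _root_.sum_apply, Finset.mul_sum]
    refine Finset.sum_congr rfl fun A hA => ?_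
    rw [_root_.sum_apply, Finset.mul_sum]
    refine Finset.sum_congr rfl fun c hc => ?_
    have hA := Finset.mem_powersetCard_univ.1 hA
    have hc := (Finset.mem_filter.1 hc).2
    rw [ContinuousMultilinearMap.tsum_eval (hsum A hA c hc)]
    have hDl' : ∀ j, Complex.I * (Ω : ℂ) * D A c j (fun i => unit s (l i)) =
        if ∀ b, l b ∈ cell A c j b then B (fun i => unit s (l i)) else 0 := by
      intro j
      rw [← hcut]
      refine hDl A c j l fun hne => ?_
      rw [hcut, ite_ne_right_iff] at hne
      obtain ⟨hcell, hne⟩ := hne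
      have hj : l c = j := by
        have := hcell c
        rwa [cell, if_pos rfl] at this
      subst hj
      refine le_trans ?_ (hω l hne)
      have hmu := one_le_mu l
      exact div_le_div_of_nonneg_left hγ.le (Real.rpow_pos_of_pos (by linarith) _)
        (Real.rpow_le_rpow (by linarith) (mu_le_of_mem_cell hA hcell) hα)
    rw [← tsum_mul_left]
    simp only [hDl']
    refine tsum_eq_single (l c) fun j hj => if_neg fun h => hj ?_
    have := h c
    rw [cell, if_pos rfl] at this
    exact (Set.mem_singleton_iff.1 this).symm

end

/-! ### The homological equation -/

section

theorem freq_eq {ω : Idx N → ℝ} (hsym : ∀ j, ω (bar j) = -ω j) (j : Idx N) :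
    ((j.2 : ℤ) : ℝ) * ω (j.1, 1) = ω j := by
  obtain ⟨a, δ⟩ := j
  rcases Int.units_eq_one_or δ with rfl | rfl
  · simp
  · have := hsym (a, 1)
    simp only [bar] at this
    simp [this]

theorem Omega_eq {ω : Idx N → ℝ} (hsym : ∀ j, ω (bar j) = -ω j) {r : ℕ} (l : Fin r → Idx N) :
    Omega ω l = ∑ i, ω (l i) :=
  Finset.sum_congr rfl fun i _ => freq_eq hsym (l i)

variable {s : ℝ}

theorem CForm.apply_finset_sum {p : ℕ} (E : CForm N s (Fin p)) (Λ : Finset (Idx N))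
    (a : Fin p → Idx N → ℂ) :
    (E fun k => ∑ j ∈ Λ, a k j • unit s j) =
      ∑ l ∈ Fintype.piFinset fun _ => Λ, (∏ k, a k (l k)) * E fun k => unit s (l k) := by
  classical
  refine (E.map_sum_finset (fun k j => a k j • unit s j) fun _ => Λ).trans ?_
  exact Finset.sum_congr rfl fun l _ => E.map_smul_univ (fun k => a k (l k)) _

/-- The velocity of the linear system `i ż_j = ω_j z_j`, truncated to finitely many indices. -/
def linearVelocity (s : ℝ) (ω : Idx N → ℝ) (Λ : Finset (Idx N)) (z : Phase N s) : Phase N s :=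
  ∑ j ∈ Λ, (-(Complex.I * ω j) * z.seq j) • unit s j

theorem fderiv_linearVelocity {p : ℕ} (E : CForm N s (Fin p)) (ω : Idx N → ℝ)
    (Λ : Finset (Idx N)) (z : Phase N s) :
    fderiv ℂ (fun z => E fun _ => z) (cut s ↑Λ z) (linearVelocity s ω Λ z) =
      -∑ l ∈ Fintype.piFinset fun _ => Λ, (∏ k, z.seq (l k)) *
        (Complex.I * (∑ k, ω (l k) : ℝ) * E fun k => unit s (l k)) := by
  classical
  rw [fderiv_diagonal]
  have h : ∀ i : Fin p, E (Function.update (fun _ => cut s ↑Λ z) i (linearVelocity s ω Λ z)) =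
      ∑ l ∈ Fintype.piFinset fun _ => Λ, (-(Complex.I * ω (l i)) * ∏ k, z.seq (l k)) *
        E fun k => unit s (l k) := by
    intro i
    have h1 : Function.update (fun _ => cut s ↑Λ z) i (linearVelocity s ω Λ z) =
        fun k => ∑ j ∈ Λ, ((if k = i then -(Complex.I * ω j) else 1) * z.seq j) • unit s j := by
      funext k
      by_cases hk : k = i
      · subst hk
        simp [linearVelocity]
      · simp [hk, cut_finset_eq]
    rw [h1, CForm.apply_finset_sum]
    refine Finset.sum_congr rfl fun l _ => ?_
    rw [Finset.prod_mul_distrib, Finset.prod_ite_eq' Finset.univ i, if_pos (Finset.mem_univ i)]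
  simp only [h]
  rw [Finset.sum_comm, ← Finset.sum_neg_distrib]
  refine Finset.sum_congr rfl fun l _ => ?_
  rw [← Finset.sum_mul, ← Finset.sum_mul, Finset.sum_neg_distrib, ← Finset.mul_sum]
  push_cast
  ring

/-- The homological equation. An odd form is the derivative, along the linear flow, of an even
form. By oddness the coefficients of resonant monomials vanish, so that only
divisors controlled by the non resonance condition occur. -/
theorem Form.exists_homological {σ α γ : ℝ} (hα : 0 ≤ α) (hγ : 0 < γ) (hσ : σ + α + 2 * d ≤ s)
    {p : ℕ} (hp : 3 ≤ p) {ω : Idx N → ℝ} (hsym : ∀ j, ω (bar j) = -ω j)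
    (hω : ∀ l : Fin p → Idx N, ¬ IsActionTuple l → γ / mu l ^ α ≤ |Omega ω l|)
    {g : Phase N s → ℂ} (hg : g ∈ Form N s σ p (-1)) :
    ∃ f ∈ Form N s (σ + α + 2 * d) p 1, ∀ (Λ : Finset (Idx N)) z,
      fderiv ℂ f (cut s ↑Λ z) (linearVelocity s ω Λ z) = -g (cut s ↑Λ z) := by
  classical
  obtain ⟨B₀, hB₀, hodd₀, hg⟩ := hg
  let B : CForm N s (Fin p) := ((p.factorial : ℂ)⁻¹) • ∑ π : Equiv.Perm (Fin p), B₀.domDomCongr π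
  have hBapp : ∀ u, B u = (p.factorial : ℂ)⁻¹ * ∑ π : Equiv.Perm (Fin p), B₀ fun i => u (π i) := by
    intro u
    simp [B]
  have hB : Tame σ B := (Tame.sum _ fun π _ => hB₀.domDomCongr π).smul _
  have hodd : ∀ u, B (fun i => tau s (u i)) = -B u := by
    intro u
    rw [hBapp, hBapp, ← mul_neg, ← Finset.sum_neg_distrib]
    refine congrArg _ (Finset.sum_congr rfl fun π _ => ?_)
    rw [hodd₀ fun i => u (π i), neg_one_mul]
  have hperm : ∀ u (π : Equiv.Perm (Fin p)), B (fun i => u (π i)) = B u := by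
    intro u π
    rw [hBapp, hBapp]
    exact congrArg _ (Fintype.sum_equiv (Equiv.mulLeft π) _ _ fun π' => rfl)
  have hdiag : ∀ z, B (fun _ => z) = g z := by
    intro z
    have : (p.factorial : ℂ) ≠ 0 := Nat.cast_ne_zero.2 p.factorial_ne_zero
    rw [hBapp, hg, Finset.sum_const, Finset.card_univ, Fintype.card_perm, Fintype.card_fin,
      nsmul_eq_mul, inv_mul_cancel_left₀ this]
  have hbar : ∀ l : Fin p → Idx N, (B fun i => unit s (bar (l i))) = -B fun i => unit s (l i) := by
    intro l
    rw [← hodd]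
    simp only [tau_unit]
  obtain ⟨E₀, hE₀, hE₀l⟩ := hB.exists_div hα hγ hσ hp ω fun l hl => by
    rw [← Omega_eq hsym]
    refine hω l fun ⟨π, hπ⟩ => hl ?_
    have h1 := hbar l
    simp only [← hπ] at h1
    rw [hperm fun i => unit s (l i)] at h1
    exact self_eq_neg.1 h1
  let E : CForm N s (Fin p) :=
    (2⁻¹ : ℂ) • (E₀ + E₀.compContinuousLinearMap fun _ => tau s)
  have hEapp : ∀ u, E u = 2⁻¹ * (E₀ u + E₀ fun i => tau s (u i)) := fun u => rfl
  have htt : ∀ z : Phase N s, tau s (tau s z) = z := fun z => Phase.ext fun j => by simp [bar_bar]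
  refine ⟨fun z => E fun _ => z, ⟨E, (hE₀.add ?_).smul _, fun u => ?_, fun z => rfl⟩,
    fun Λ z => ?_⟩
  · obtain ⟨C, hC, h⟩ := hE₀
    refine ⟨C, hC, fun u => (h fun i => tau s (u i)).trans_eq ?_⟩
    simp only [weight_tau]
  · simp only [hEapp, htt, one_mul]
    rw [add_comm]
  · rw [fderiv_linearVelocity, ← hdiag, cut_finset_eq, CForm.apply_finset_sum]
    refine congrArg Neg.neg (Finset.sum_congr rfl fun l _ => congrArg _ ?_)
    rw [hEapp]
    simp only [tau_unit]
    have h1 := hE₀l l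
    have h2 := hE₀l fun i => bar (l i)
    simp only [hsym, Finset.sum_neg_distrib, hbar] at h2
    push_cast at h1 h2 ⊢
    linear_combination (2⁻¹ : ℂ) * h1 - 2⁻¹ * h2

end

/-! ### Layer-cake estimate and polarization -/

section

theorem two_pow_log_le {x : ℝ} (hx : 1 ≤ x) : (2 : ℝ) ^ Nat.log 2 ⌊x⌋₊ ≤ x := by
  have h : ⌊x⌋₊ ≠ 0 := (Nat.floor_pos.2 hx).ne'
  calc (2 : ℝ) ^ Nat.log 2 ⌊x⌋₊ ≤ (⌊x⌋₊ : ℝ) := by exact_mod_cast Nat.pow_log_le_self 2 h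
    _ ≤ x := Nat.floor_le (by linarith)

theorem le_log_of_two_pow_le {x : ℝ} {q : ℕ} (hq : (2 : ℝ) ^ q ≤ x) : q ≤ Nat.log 2 ⌊x⌋₊ := by
  have h1 : 2 ^ q ≤ ⌊x⌋₊ := Nat.le_floor (by exact_mod_cast hq)
  exact Nat.le_log_of_pow_le (by norm_num) h1

theorem lt_two_pow_log {x : ℝ} : x < (2 : ℝ) ^ (Nat.log 2 ⌊x⌋₊ + 1) := by
  by_contra! h
  have := le_log_of_two_pow_le h
  omega

theorem rpow_two_pow (θ : ℝ) (q : ℕ) : ((2 : ℝ) ^ q) ^ θ = ((2 : ℝ) ^ θ) ^ q := by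
  rw [← Real.rpow_natCast, ← Real.rpow_natCast, ← Real.rpow_mul zero_le_two,
    ← Real.rpow_mul zero_le_two, mul_comm]

theorem sum_dyadic_le {θ : ℝ} (hθ : 0 < θ) {y : ℝ} (hy : 1 ≤ y) (Q : ℕ) :
    ∑ q ∈ Finset.range Q, (if (2 : ℝ) ^ q ≤ y then ((2 : ℝ) ^ θ) ^ q else 0) ≤
      (2 : ℝ) ^ θ / ((2 : ℝ) ^ θ - 1) * y ^ θ := by
  have hc : 1 < (2 : ℝ) ^ θ := Real.one_lt_rpow (by norm_num) hθ
  set c := (2 : ℝ) ^ θ with hc_def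
  set n := Nat.log 2 ⌊y⌋₊ with hn
  calc ∑ q ∈ Finset.range Q, (if (2 : ℝ) ^ q ≤ y then c ^ q else 0)
      = ∑ q ∈ (Finset.range Q).filter fun q => (2 : ℝ) ^ q ≤ y, c ^ q :=
        (Finset.sum_filter _ _).symm
    _ ≤ ∑ q ∈ Finset.range (n + 1), c ^ q := by
        refine Finset.sum_le_sum_of_subset_of_nonneg (fun q hq => ?_) fun q _ _ => by positivity
        rw [Finset.mem_range, Nat.lt_succ_iff]
        exact le_log_of_two_pow_le (Finset.mem_filter.1 hq).2
    _ = (c ^ (n + 1) - 1) / (c - 1) := geom_sum_eq hc.ne' _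
    _ ≤ c / (c - 1) * c ^ n := by
        rw [div_mul_eq_mul_div, ← pow_succ']
        exact div_le_div_of_nonneg_right (by linarith) (by linarith)
    _ ≤ c / (c - 1) * y ^ θ := by
        refine mul_le_mul_of_nonneg_left ?_ (div_nonneg (by linarith) (by linarith))
        rw [hc_def, ← rpow_two_pow]
        exact Real.rpow_le_rpow (by positivity) (two_pow_log_le hy) hθ.le

variable {s : ℝ}

theorem wnorm_cut_sq (σ : ℝ) (S : Set (Idx N)) (z : Phase N s) :
    wnorm σ (cut s S z).seq ^ 2 =
      ∑' j, open Classical in if j ∈ S then size j ^ (2 * σ) * ‖z.seq j‖ ^ 2 else 0 := by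
  classical
  rw [wnorm_sq]
  refine tsum_congr fun j => ?_
  rw [cut_seq]
  split_ifs <;> simp

/-- A dyadic layer-cake estimate: the strong norm is determined by the weak norms of the
high-frequency parts `{|j| ≥ 2^q}`. -/
theorem norm_le_of_layers {σ : ℝ} (h : σ < s) : ∃ K : ℝ, 0 ≤ K ∧ ∀ v g : Phase N s,
    (∀ q : ℕ, wnorm σ (cut s {x | 2 ^ q ≤ size x} v).seq ≤
      wnorm σ (cut s {x | 2 ^ q ≤ 2 * size x} g).seq) → ‖v‖ ≤ K * ‖g‖ := by
  classical
  set θ := 2 * (s - σ) with hθ_def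
  have hθ : 0 < θ := by rw [hθ_def]; linarith
  set c := (2 : ℝ) ^ θ with hc_def
  have hc : 1 < c := Real.one_lt_rpow (by norm_num) hθ
  have hc1 : 0 < c - 1 := by linarith
  have hc0 : 0 < c := by linarith
  have hexp : ∀ j : Idx N, size j ^ θ * size j ^ (2 * σ) = size j ^ (2 * s) := fun j => by
    rw [← Real.rpow_add (size_pos j), hθ_def]
    ring_nf
  have hw0 : ∀ (τ : ℝ) (z : Phase N s) j, 0 ≤ size j ^ (2 * τ) * ‖z.seq j‖ ^ 2 := fun τ z j =>
    mul_nonneg (Real.rpow_nonneg (size_pos j).le _) (sq_nonneg _)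
  refine ⟨Real.sqrt (c * (c / (c - 1) * c)), Real.sqrt_nonneg _, fun v g hvg => ?_⟩
  refine abs_le_of_sq_le_sq' ?_ (mul_nonneg (Real.sqrt_nonneg _) (norm_nonneg _)) |>.2
  rw [mul_pow, Real.sq_sqrt (by positivity), Phase.norm_sq_eq]
  have hsum : ∀ (z : Phase N s) (S : Set (Idx N)),
      Summable fun j => if j ∈ S then size j ^ (2 * σ) * ‖z.seq j‖ ^ 2 else 0 := fun z S =>
    Summable.of_nonneg_of_le (fun j => by split_ifs; exacts [hw0 _ _ _, le_rfl])
      (fun j => by split_ifs; exacts [le_rfl, hw0 _ _ _]) (wnorm_mono_exp h.le z.seq_mem).1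
  have hvs : Summable fun j => size j ^ (2 * s) * ‖v.seq j‖ ^ 2 := v.seq_mem
  refine hvs.tsum_le_of_sum_le fun Λ => ?_
  obtain ⟨Q, hQ⟩ := (Λ.image fun j => Nat.log 2 ⌊size j⌋₊).exists_nat_subset_range
  have hlow : ∀ j ∈ Λ, size j ^ (2 * s) * ‖v.seq j‖ ^ 2 ≤ c * ∑ q ∈ Finset.range Q,
      c ^ q * (if j ∈ {x | 2 ^ q ≤ size x} then size j ^ (2 * σ) * ‖v.seq j‖ ^ 2 else 0) := by
    intro j hj
    have hn := hQ (Finset.mem_image_of_mem _ hj)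
    set n := Nat.log 2 ⌊size j⌋₊
    have h1 := Finset.single_le_sum (f := fun q => c ^ q *
      (if j ∈ {x | 2 ^ q ≤ size x} then size j ^ (2 * σ) * ‖v.seq j‖ ^ 2 else 0))
      (fun q _ => mul_nonneg (by positivity) (by split_ifs; exacts [hw0 _ _ _, le_rfl])) hn
    refine le_trans ?_ (mul_le_mul_of_nonneg_left h1 hc0.le)
    rw [if_pos (show j ∈ {x | 2 ^ n ≤ size x} from two_pow_log_le (one_le_size j)), ← mul_assoc,
      ← pow_succ', ← hexp, mul_assoc]
    refine mul_le_mul_of_nonneg_right ?_ (hw0 _ _ _)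
    rw [hc_def, ← rpow_two_pow]
    exact Real.rpow_le_rpow (size_pos j).le lt_two_pow_log.le hθ.le
  calc ∑ j ∈ Λ, size j ^ (2 * s) * ‖v.seq j‖ ^ 2
      ≤ ∑ j ∈ Λ, c * ∑ q ∈ Finset.range Q, c ^ q *
          (if j ∈ {x | 2 ^ q ≤ size x} then size j ^ (2 * σ) * ‖v.seq j‖ ^ 2 else 0) :=
        Finset.sum_le_sum hlow
    _ = c * ∑ q ∈ Finset.range Q, c ^ q * ∑ j ∈ Λ,
          (if j ∈ {x | 2 ^ q ≤ size x} then size j ^ (2 * σ) * ‖v.seq j‖ ^ 2 else 0) := by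
        rw [← Finset.mul_sum, Finset.sum_comm]
        simp only [Finset.mul_sum]
    _ ≤ c * ∑ q ∈ Finset.range Q, c ^ q * ∑' j,
          (if j ∈ {x | 2 ^ q ≤ 2 * size x} then size j ^ (2 * σ) * ‖g.seq j‖ ^ 2 else 0) := by
        refine mul_le_mul_of_nonneg_left (Finset.sum_le_sum fun q _ =>
          mul_le_mul_of_nonneg_left ?_ (by positivity)) hc0.le
        refine ((hsum v _).sum_le_tsum Λ fun j _ => by
          split_ifs; exacts [hw0 _ _ _, le_rfl]).trans ?_
        rw [← wnorm_cut_sq, ← wnorm_cut_sq]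
        exact pow_le_pow_left₀ (wnorm_nonneg _ _) (hvg q) 2
    _ = c * ∑' j, ∑ q ∈ Finset.range Q, c ^ q *
          (if j ∈ {x | 2 ^ q ≤ 2 * size x} then size j ^ (2 * σ) * ‖g.seq j‖ ^ 2 else 0) := by
        rw [Summable.tsum_finsetSum fun q _ => (hsum g _).mul_left _]
        simp only [tsum_mul_left]
    _ ≤ c * ∑' j, c / (c - 1) * c * (size j ^ (2 * s) * ‖g.seq j‖ ^ 2) := by
        refine mul_le_mul_of_nonneg_left (Summable.tsum_le_tsum (fun j => ?_)
          (summable_sum fun q _ => (hsum g _).mul_left _)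
          (Summable.mul_left _ g.seq_mem)) hc0.le
        calc ∑ q ∈ Finset.range Q, c ^ q *
              (if j ∈ {x | 2 ^ q ≤ 2 * size x} then size j ^ (2 * σ) * ‖g.seq j‖ ^ 2 else 0)
            = (∑ q ∈ Finset.range Q, if (2 : ℝ) ^ q ≤ 2 * size j then c ^ q else 0) *
                (size j ^ (2 * σ) * ‖g.seq j‖ ^ 2) := by
              rw [Finset.sum_mul]
              refine Finset.sum_congr rfl fun q _ => ?_
              simp only [Set.mem_ofPred_eq]
              split_ifs <;> simp
          _ ≤ c / (c - 1) * (2 * size j) ^ θ * (size j ^ (2 * σ) * ‖g.seq j‖ ^ 2) := by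
              refine mul_le_mul_of_nonneg_right (sum_dyadic_le hθ ?_ Q) (hw0 _ _ _)
              linarith [one_le_size j]
          _ = c / (c - 1) * c * (size j ^ (2 * s) * ‖g.seq j‖ ^ 2) := by
              rw [Real.mul_rpow zero_le_two (size_pos j).le, ← hexp]
              ring
    _ = c * (c / (c - 1) * c) * ‖g‖ ^ 2 := by
        rw [tsum_mul_left, ← Phase.norm_sq_eq, ← mul_assoc]

/-- Extraction of the part of degree one in each variable of a polynomial of degree at most `k`,
by averaging over the roots of unity of order `k + 1`. -/
theorem polarization {E : Type*} [AddCommGroup E] [Module ℂ E] {k m : ℕ} (hk : 2 ≤ k)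
    (hm : 2 ≤ m) (hmk : m ≤ k) {ζ : ℂ} (hζ : IsPrimitiveRoot ζ (k + 1))
    (q : (n : ℕ) → MultilinearMap ℂ (fun _ : Fin n => E) ℂ) (u : Fin m → E) :
    ∑ t : Fin m → Fin (k + 1), (∏ i, (ζ ^ (t i : ℕ))⁻¹) *
        ∑ n ∈ Finset.Icc 2 k, q n (fun _ => ∑ i, ζ ^ (t i : ℕ) • u i) =
      (k + 1 : ℂ) ^ m * ∑ π : Equiv.Perm (Fin m), q m fun i => u (π i) := by
  classical
  have hζ0 : ζ ≠ 0 := hζ.ne_zero (by omega)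
  have hroot : ∀ n ≤ k, ∑ t : Fin (k + 1), (ζ ^ (t : ℕ))⁻¹ * (ζ ^ (t : ℕ)) ^ n =
      if n = 1 then (k + 1 : ℂ) else 0 := by
    intro n hn
    have h1 : ∀ t : Fin (k + 1), (ζ ^ (t : ℕ))⁻¹ * (ζ ^ (t : ℕ)) ^ n =
        (ζ⁻¹ * ζ ^ n) ^ (t : ℕ) := fun t => by
      rw [mul_pow, inv_pow, pow_right_comm]
    simp only [h1]
    rw [Fin.sum_univ_eq_sum_range fun t => (ζ⁻¹ * ζ ^ n) ^ t]
    split_ifs with h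
    · simp [h, hζ0]
    · have hne : ζ⁻¹ * ζ ^ n ≠ 1 := fun h2 => h <| by
        rw [inv_mul_eq_one₀ hζ0] at h2
        exact (hζ.pow_inj (i := 1) (by omega) (by omega) ((pow_one ζ).trans h2)).symm
      rw [geom_sum_eq hne, mul_pow, pow_right_comm, inv_pow, hζ.pow_eq_one]
      simp
  have hexpand : ∀ n (t : Fin m → Fin (k + 1)), q n (fun _ => ∑ i, ζ ^ (t i : ℕ) • u i) =
      ∑ φ : Fin n → Fin m, (∏ i, (ζ ^ (t i : ℕ)) ^
        (Finset.univ.filter fun x => φ x = i).card) * q n fun x => u (φ x) := by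
    intro n t
    refine ((q n).map_sum fun _ i => ζ ^ (t i : ℕ) • u i).trans (Finset.sum_congr rfl fun φ _ => ?_)
    refine ((q n).map_smul_univ (fun x => ζ ^ (t (φ x) : ℕ)) fun x => u (φ x)).trans ?_
    rw [smul_eq_mul, ← Finset.prod_fiberwise Finset.univ φ]
    congr 1
    refine Finset.prod_congr rfl fun i _ => ?_
    rw [← Finset.prod_const]
    exact Finset.prod_congr rfl fun x hx => by rw [(Finset.mem_filter.1 hx).2]
  have hφ : ∀ n ≤ k, ∀ φ : Fin n → Fin m,
      ∑ t : Fin m → Fin (k + 1), (∏ i, (ζ ^ (t i : ℕ))⁻¹) *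
        (∏ i, (ζ ^ (t i : ℕ)) ^ (Finset.univ.filter fun x => φ x = i).card) =
      if Function.Bijective φ then (k + 1 : ℂ) ^ m else 0 := by
    intro n hn φ
    simp only [← Finset.prod_mul_distrib]
    have h1 := Finset.prod_univ_sum (fun _ : Fin m => (Finset.univ : Finset (Fin (k + 1))))
      fun i t => (ζ ^ (t : ℕ))⁻¹ * (ζ ^ (t : ℕ)) ^ (Finset.univ.filter fun x => φ x = i).card
    rw [Fintype.piFinset_univ] at h1
    rw [← h1]
    have hcard : ∀ i, (Finset.univ.filter fun x => φ x = i).card ≤ k := fun i =>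
      (Finset.card_le_univ _).trans (by simpa using hn)
    simp only [hroot _ (hcard _), Finset.prod_ite_zero]
    have hiff : (∀ i ∈ Finset.univ, (Finset.univ.filter fun x => φ x = i).card = 1) ↔
        Function.Bijective φ := by
      rw [Function.bijective_iff_existsUnique]
      refine forall_congr' fun i => ?_
      simp only [Finset.mem_univ, true_imp_iff]
      rw [Finset.card_eq_one, Finset.singleton_iff_unique_mem]
      simp
    by_cases hb : Function.Bijective φ
    · rw [if_pos (hiff.2 hb), if_pos hb]
      simp
    · rw [if_neg (mt hiff.1 hb), if_neg hb]
  simp only [hexpand, Finset.mul_sum]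
  rw [Finset.sum_comm]
  have hn : ∀ n ∈ Finset.Icc 2 k, ∑ t : Fin m → Fin (k + 1), ∑ φ : Fin n → Fin m,
      (∏ i, (ζ ^ (t i : ℕ))⁻¹) * ((∏ i, (ζ ^ (t i : ℕ)) ^
        (Finset.univ.filter fun x => φ x = i).card) * q n fun x => u (φ x)) =
      ∑ φ : Fin n → Fin m, (if Function.Bijective φ then (k + 1 : ℂ) ^ m else 0) *
        q n fun x => u (φ x) := by
    intro n hn
    rw [Finset.sum_comm]
    refine Finset.sum_congr rfl fun φ _ => ?_
    rw [← hφ n (Finset.mem_Icc.1 hn).2 φ, Finset.sum_mul]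
    simp only [mul_assoc]
  rw [Finset.sum_congr rfl hn, Finset.sum_eq_single m]
  · symm
    refine Fintype.sum_of_injective (fun π : Equiv.Perm (Fin m) => (π : Fin m → Fin m))
      DFunLike.coe_injective _ _ (fun φ hφ => ?_) fun π => ?_
    · rw [if_neg fun hb => hφ ⟨Equiv.ofBijective φ hb, rfl⟩, zero_mul]
    · rw [if_pos π.bijective]
  · intro n hn hne
    refine Finset.sum_eq_zero fun φ _ => ?_
    rw [if_neg, zero_mul]
    intro hb
    have := Fintype.card_of_bijective hb
    simp only [Fintype.card_fin] at this
    exact hne this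
  · intro h
    exact absurd (Finset.mem_Icc.2 ⟨hm, hmk⟩) h

end

/-! ### Homogeneous components of polynomial fields -/

section

/-- The value `∑_l b_l u_{1,l₁} ⋯ u_{m,l_m}` of the multilinear form with coefficients `b`. -/
def coeffSum {m : ℕ} (b : (Fin m → Idx N) → ℂ) (u : Fin m → Idx N → ℂ) : ℂ :=
  ∑' l, b l * ∏ i, u i (l i)

/-- The symmetrization of `coeffSum`. -/
def symSum {m : ℕ} (b : (Fin m → Idx N) → ℂ) (u : Fin m → Idx N → ℂ) : ℂ :=
  (m.factorial : ℂ)⁻¹ * ∑ π : Equiv.Perm (Fin m), coeffSum b fun i => u (π i)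

theorem symSum_const {m : ℕ} (b : (Fin m → Idx N) → ℂ) (z : Idx N → ℂ) :
    symSum b (fun _ => z) = coeffSum b fun _ => z := by
  have : (m.factorial : ℂ) ≠ 0 := Nat.cast_ne_zero.2 m.factorial_ne_zero
  rw [symSum, Finset.sum_const, Finset.card_univ, Fintype.card_perm, Fintype.card_fin,
    nsmul_eq_mul, inv_mul_cancel_left₀ this]

theorem symSum_smul {m : ℕ} (b : (Fin m → Idx N) → ℂ) (c : Fin m → ℂ) (u : Fin m → Idx N → ℂ) :
    symSum b (fun i => c i • u i) = (∏ i, c i) * symSum b u := by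
  rw [symSum, symSum, mul_left_comm, Finset.mul_sum Finset.univ _ (∏ i, c i)]
  refine congrArg _ (Finset.sum_congr rfl fun π _ => ?_)
  rw [coeffSum, coeffSum, ← tsum_mul_left]
  refine tsum_congr fun l => ?_
  simp only [Pi.smul_apply, smul_eq_mul, Finset.prod_mul_distrib]
  have h := Equiv.prod_comp π c
  rw [h]
  ring

/-- The coefficient family is bounded by `C |l₁|^ν ⋯ |l_m|^ν`. -/
def CoeffBound (ν : ℝ) {m : ℕ} (b : (Fin m → Idx N) → ℂ) : Prop :=
  ∃ C : ℝ, 0 ≤ C ∧ ∀ l, ‖b l‖ ≤ C * ∏ i, size (l i) ^ ν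

/-- The monomial `u ↦ u_{1,l₁} ⋯ u_{m,l_m}`. -/
def monomialForm (s : ℝ) {m : ℕ} (l : Fin m → Idx N) : CForm N s (Fin m) :=
  (ContinuousMultilinearMap.mkPiAlgebra ℂ (Fin m) ℂ).compContinuousLinearMap fun i => coord s (l i)

theorem monomialForm_apply (s : ℝ) {m : ℕ} (l : Fin m → Idx N) (u : Fin m → Phase N s) :
    monomialForm s l u = ∏ i, (u i).seq (l i) := by
  simp [monomialForm]

theorem norm_monomialForm_le (s : ℝ) {m : ℕ} (l : Fin m → Idx N) :
    ‖monomialForm (N := N) s l‖ ≤ ∏ i, size (l i) ^ (-s) := by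
  refine ContinuousMultilinearMap.opNorm_le_bound
    (Finset.prod_nonneg fun i _ => Real.rpow_nonneg (size_pos _).le _) fun u => ?_
  rw [monomialForm_apply, norm_prod, ← Finset.prod_mul_distrib]
  refine Finset.prod_le_prod (fun _ _ => norm_nonneg _) fun i _ => ?_
  rw [Phase.norm_eq]
  exact norm_apply_le (u i).seq_mem _

theorem summable_monomialForm {s ν : ℝ} (h : ν + 2 * d ≤ s) {m : ℕ} {b : (Fin m → Idx N) → ℂ}
    (hb : CoeffBound ν b) : Summable fun l => b l • monomialForm s l := by
  obtain ⟨C, hC, hb⟩ := hb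
  refine Summable.of_norm_bounded ((summable_prod_pi (f := fun (_ : Fin m) (j : Idx N) =>
    size j ^ (-(2 * d : ℝ))) (fun _ j => Real.rpow_nonneg (size_pos j).le _)
    fun _ => summable_size_rpow N).mul_left C) fun l => ?_
  rw [norm_smul]
  refine (mul_le_mul (hb l) (norm_monomialForm_le s l) (norm_nonneg _) (mul_nonneg hC
    (Finset.prod_nonneg fun i _ => Real.rpow_nonneg (size_pos _).le _))).trans ?_
  rw [mul_assoc, ← Finset.prod_mul_distrib]
  refine mul_le_mul_of_nonneg_left (Finset.prod_le_prod (fun i _ => mul_nonneg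
    (Real.rpow_nonneg (size_pos _).le _) (Real.rpow_nonneg (size_pos _).le _)) fun i _ => ?_) hC
  rw [← Real.rpow_add (size_pos _)]
  exact Real.rpow_le_rpow_of_exponent_le (one_le_size _) (by linarith)

/-- The continuous multilinear form with coefficients `b`. -/
def coeffForm (s : ℝ) {m : ℕ} (b : (Fin m → Idx N) → ℂ) : CForm N s (Fin m) :=
  ∑' l, b l • monomialForm s l

theorem coeffForm_apply {s ν : ℝ} (h : ν + 2 * d ≤ s) {m : ℕ} {b : (Fin m → Idx N) → ℂ}
    (hb : CoeffBound ν b) (u : Fin m → Phase N s) :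
    coeffForm s b u = coeffSum b fun i => (u i).seq := by
  rw [coeffForm, ContinuousMultilinearMap.tsum_eval (summable_monomialForm h hb), coeffSum]
  exact tsum_congr fun l => by rw [smul_apply, monomialForm_apply, smul_eq_mul]

/-- The symmetrization of `coeffForm`. -/
def symForm (s : ℝ) {m : ℕ} (b : (Fin m → Idx N) → ℂ) : CForm N s (Fin m) :=
  (m.factorial : ℂ)⁻¹ • ∑ π : Equiv.Perm (Fin m), (coeffForm s b).domDomCongr π

theorem symForm_apply {s ν : ℝ} (h : ν + 2 * d ≤ s) {m : ℕ} {b : (Fin m → Idx N) → ℂ}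
    (hb : CoeffBound ν b) (u : Fin m → Phase N s) :
    symForm s b u = symSum b fun i => (u i).seq := by
  simp only [symForm, smul_apply, _root_.sum_apply, smul_eq_mul, symSum]
  congr 1
  exact Finset.sum_congr rfl fun π _ => coeffForm_apply h hb fun i => u (π i)

theorem polyField_eq_sum_coeffSum (a : Coeffs N) (k : ℕ) (z : Idx N → ℂ) (j : Idx N) :
    polyField a k z j = ∑ m ∈ Finset.Icc 2 k, coeffSum (a m j) fun _ => z := rfl

/-- The polynomial field is bounded on some ball of `𝒫_s`. -/
def BoundedNearZero (a : Coeffs N) (k : ℕ) (s : ℝ) : Prop :=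
  ∃ ρ C : ℝ, 0 < ρ ∧ 0 ≤ C ∧ ∀ z : Phase N s, ‖z‖ ≤ ρ →
    ∃ v : Phase N s, (∀ j, v.seq j = polyField a k z.seq j) ∧ ‖v‖ ≤ C

/-- The symmetric multilinear maps attached to the homogeneous components of a polynomial field
that is bounded near the origin are bounded. -/
theorem exists_symSum_bound {s ν : ℝ} (h : ν + 2 * d ≤ s) {a : Coeffs N} {k m : ℕ}
    (hm : 2 ≤ m) (hmk : m ≤ k) (ha : ∀ m, 2 ≤ m → m ≤ k → ∀ j, CoeffBound ν (a m j))
    (hbd : BoundedNearZero a k s) :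
    ∃ C : ℝ, 0 ≤ C ∧ ∀ u : Fin m → Phase N s, ∃ v : Phase N s,
      (∀ j, v.seq j = symSum (a m j) fun i => (u i).seq) ∧ ‖v‖ ≤ C * ∏ i, ‖u i‖ := by
  obtain ⟨ρ, C, hρ, hC, hbd⟩ := hbd
  have hm0 : (0 : ℝ) < m := by exact_mod_cast (by omega : 0 < m)
  set ζ := Complex.exp (2 * Real.pi * Complex.I / (k + 1 : ℕ)) with hζ_def
  have hζ : IsPrimitiveRoot ζ (k + 1) := Complex.isPrimitiveRoot_exp (k + 1) (by omega)
  have hζn : ‖ζ‖ = 1 := hζ.norm'_eq_one (by omega)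
  set A : ℂ := ((k + 1 : ℂ) ^ m * m.factorial)⁻¹ with hA
  have hA0 : ((k + 1 : ℂ) ^ m * m.factorial) ≠ 0 :=
    mul_ne_zero (pow_ne_zero _ (by exact_mod_cast (by omega : k + 1 ≠ 0)))
      (Nat.cast_ne_zero.2 m.factorial_ne_zero)
  set C₁ : ℝ := ‖A‖ * (Fintype.card (Fin m → Fin (k + 1)) * C) with hC₁
  have hC₁0 : 0 ≤ C₁ := by positivity
  have hsmall : ∀ u : Fin m → Phase N s, (∀ i, ‖u i‖ ≤ ρ / m) → ∃ v : Phase N s,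
      (∀ j, v.seq j = symSum (a m j) fun i => (u i).seq) ∧ ‖v‖ ≤ C₁ := by
    intro u hu
    have hz : ∀ t : Fin m → Fin (k + 1), ‖∑ i, ζ ^ (t i : ℕ) • u i‖ ≤ ρ := by
      intro t
      refine (norm_sum_le_of_le _ (fun i _ => ?_)).trans_eq
        (by simp [mul_div_cancel₀ ρ hm0.ne'] : ∑ _i : Fin m, ρ / m = ρ)
      rw [norm_smul, norm_pow, hζn, one_pow, one_mul]
      exact hu i
    choose V hV hVC using fun t => hbd _ (hz t)
    refine ⟨A • ∑ t, (∏ i, (ζ ^ (t i : ℕ))⁻¹) • V t, fun j => ?_, ?_⟩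
    · have hpol := polarization (by omega) hm hmk hζ
        (fun n => (coeffForm s (a n j)).toMultilinearMap) u
      have h1 : ∀ t : Fin m → Fin (k + 1), (V t).seq j = ∑ n ∈ Finset.Icc 2 k,
          (coeffForm s (a n j)).toMultilinearMap (fun _ => ∑ i, ζ ^ (t i : ℕ) • u i) := by
        intro t
        rw [hV, polyField_eq_sum_coeffSum]
        refine Finset.sum_congr rfl fun n hn => ?_
        exact (coeffForm_apply h (ha n (Finset.mem_Icc.1 hn).1 (Finset.mem_Icc.1 hn).2 j) _).symm
      simp only [Phase.seq_smul, Phase.seq_sum, Pi.smul_apply, Finset.sum_apply, smul_eq_mul, h1]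
      rw [hpol, hA, symSum]
      have h2 : ∀ π : Equiv.Perm (Fin m), (coeffForm s (a m j)).toMultilinearMap
          (fun i => u (π i)) = coeffSum (a m j) fun i => (u (π i)).seq := fun π =>
        coeffForm_apply h (ha m hm hmk j) fun i => u (π i)
      simp only [h2]
      have h3 : (k + 1 : ℂ) ≠ 0 := by exact_mod_cast (by omega : k + 1 ≠ 0)
      field_simp
    · rw [norm_smul]
      refine mul_le_mul_of_nonneg_left ?_ (norm_nonneg _)
      refine (norm_sum_le_of_le _ fun t _ => ?_).trans_eq
        (by rw [Finset.sum_const, Finset.card_univ, nsmul_eq_mul] :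
          ∑ _t : Fin m → Fin (k + 1), C = _)
      rw [norm_smul, norm_prod]
      simpa [hζn] using hVC t
  refine ⟨C₁ / (ρ / m) ^ m, by positivity, fun u => ?_⟩
  have hρm : 0 < ρ / m := by positivity
  by_cases hu : ∃ i, u i = 0
  · obtain ⟨i, hi⟩ := hu
    refine ⟨0, fun j => ?_, ?_⟩
    · have h1 := symSum_smul (a m j) (Function.update 1 i 0) fun i => (u i).seq
      rw [Finset.prod_eq_zero (Finset.mem_univ i) (Function.update_self _ _ _), zero_mul] at h1
      rw [Phase.seq_zero, Pi.zero_apply, ← h1]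
      congr 1
      funext k
      by_cases hk : k = i
      · subst hk
        simp [hi]
      · simp [hk]
    · rw [norm_zero]
      positivity
  · push Not at hu
    obtain ⟨v, hv, hvn⟩ := hsmall (fun i => ((ρ / m / ‖u i‖ : ℝ) : ℂ) • u i) fun i => by
      rw [norm_smul, Complex.norm_real, Real.norm_of_nonneg (by positivity),
        div_mul_cancel₀ _ (norm_ne_zero_iff.2 (hu i))]
    set c : Fin m → ℂ := fun i => ((ρ / m / ‖u i‖ : ℝ) : ℂ) with hc
    have hc0 : ∀ i, c i ≠ 0 := fun i => Complex.ofReal_ne_zero.2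
      (div_ne_zero hρm.ne' (norm_ne_zero_iff.2 (hu i)))
    have hP : ∏ i, c i ≠ 0 := Finset.prod_ne_zero_iff.2 fun i _ => hc0 i
    refine ⟨(∏ i, c i)⁻¹ • v, fun j => ?_, ?_⟩
    · rw [Phase.seq_smul, Pi.smul_apply, hv, smul_eq_mul, inv_mul_eq_iff_eq_mul₀ hP]
      exact symSum_smul (a m j) c fun i => (u i).seq
    · rw [norm_smul, norm_inv, norm_prod]
      have h1 : ∏ i, ‖c i‖ = (ρ / m) ^ m / ∏ i, ‖u i‖ := by
        rw [← Fin.prod_const, ← Finset.prod_div_distrib]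
        exact Finset.prod_congr rfl fun i _ => by
          rw [hc, Complex.norm_real, Real.norm_of_nonneg (by positivity)]
      rw [h1, inv_div, div_mul_eq_mul_div, div_mul_eq_mul_div, mul_comm]
      exact div_le_div_of_nonneg_right (mul_le_mul_of_nonneg_right hvn
        (Finset.prod_nonneg fun _ _ => norm_nonneg _)) (by positivity)

/-- All sizes but that of the position `i` bound the third largest size of `(j, l₁, …, l_m)`. -/
theorem mu_cons_le {m : ℕ} (j : Idx N) (l : Fin m → Idx N) (i : Fin m) {R : ℝ} (hR : 1 ≤ R)
    (h : ∀ k, k ≠ i → size (l k) ≤ R) : mu (Fin.cons j l : Fin (m + 1) → Idx N) ≤ R := by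
  refine mu_le _ hR ((Finset.card_le_card (t := {0, i.succ}) fun b hb => ?_).trans
    Finset.card_le_two)
  have hb := (Finset.mem_filter.1 hb).2
  refine Fin.cases (fun _ => by simp) (fun k hk => ?_) b hb
  rw [Fin.cons_succ] at hk
  by_contra hne
  simp only [Finset.mem_insert, Fin.succ_ne_zero, Finset.mem_singleton, Fin.succ_inj,
    false_or] at hne
  exact absurd (h k hne) (not_le.2 hk)

theorem InT.coeffBound {a : Coeffs N} {k : ℕ} {ν : ℝ} (hν : 0 ≤ ν) (ha : InT a k 0 ν) (m : ℕ)
    (hm : 2 ≤ m) (hmk : m ≤ k) (j : Idx N) : CoeffBound ν (a m j) := by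
  obtain ⟨C, ha⟩ := ha
  refine ⟨|C|, abs_nonneg _, fun l => (ha m hm hmk l j).trans ?_⟩
  rw [pow_zero, div_one, Nat.cast_zero, zero_add, Real.finsetProd_rpow _ _ fun i _ =>
    (size_pos (l i)).le]
  have hmu := one_le_mu (Fin.cons j l : Fin (m + 1) → Idx N)
  refine mul_le_mul (le_abs_self C) (Real.rpow_le_rpow (by linarith) ?_ hν)
    (Real.rpow_nonneg (by linarith) _) (abs_nonneg _)
  refine mu_cons_le j l ⟨0, by omega⟩ ?_ fun k _ => ?_
  · exact Finset.one_le_prod fun i _ => one_le_size (l i)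
  · rw [← Finset.mul_prod_erase _ _ (Finset.mem_univ k)]
    exact le_mul_of_one_le_right (size_pos _).le (Finset.one_le_prod fun i _ => one_le_size (l i))

end

/-! ### Tameness of the homogeneous components -/

section

/-- If `|j|` is at least twice as large as all the `|l_i|`, then the gap is at least `|j| / 2`. -/
theorem half_size_le_gap {m : ℕ} (hm : 0 < m) (j : Idx N) (l : Fin m → Idx N)
    (h : ∀ i, 2 * size (l i) ≤ size j) :
    size j / 2 ≤ gap (Fin.cons j l : Fin (m + 1) → Idx N) := by
  have h0 : size j ≤ (sortedSizes (Fin.cons j l : Fin (m + 1) → Idx N)).getD 0 1 :=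
    size_le_sortedSizes_getD_zero (Fin.cons j l : Fin (m + 1) → Idx N) 0
  have h1 : (sortedSizes (Fin.cons j l : Fin (m + 1) → Idx N)).getD 1 1 ≤ size j / 2 := by
    refine sortedSizes_getD_le _ 1 ?_ ((Finset.card_le_card (t := {0}) fun b hb => ?_).trans
      (Finset.card_singleton _).le)
    · linarith [h ⟨0, hm⟩, one_le_size (l ⟨0, hm⟩)]
    · have hb := (Finset.mem_filter.1 hb).2
      refine Fin.cases (fun _ => by simp) (fun k hk => ?_) b hb
      rw [Fin.cons_succ] at hk
      linarith [h k]
  rw [gap]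
  linarith

/-- The decay of the coefficients for `|j| ≥ 2 max |l_i|`, where `|l_i|` is the largest of the
`|l_k|`. -/
theorem coeff_far_le {a : Coeffs N} {k : ℕ} {ν s σ : ℝ} (hν : 0 ≤ ν) (ha : InTInf a k ν)
    (hσ : ν + 3 * (2 * d) ≤ σ) (hs : σ ≤ s) :
    ∃ C : ℝ, 0 ≤ C ∧ ∀ m, 2 ≤ m → m ≤ k → ∀ (j : Idx N) (l : Fin m → Idx N) (i : Fin m),
      (∀ k, 2 * size (l k) ≤ size j) → (∀ k, size (l k) ≤ size (l i)) →
      ‖a m j l‖ ≤ C * (size j ^ (-(s + 2 * d)) *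
        ∏ b, size (l b) ^ ((if b ∈ ({i} : Finset (Fin m)) then s else σ) - 2 * d)) := by
  have hd0 : (0 : ℝ) ≤ 2 * d := by positivity
  set κ : ℝ := 2 * d with hκ
  set M : ℕ := ⌈s + κ⌉₊ with hM_def
  have hM : s + κ ≤ M := Nat.le_ceil _
  obtain ⟨C, hC⟩ := ha M
  refine ⟨|C| * 2 ^ M, by positivity, fun m hm hmk j l i hfar hmax => ?_⟩
  refine (hC m hm hmk l j).trans ?_
  have hgap := half_size_le_gap (by omega) j l hfar
  set μ := mu (Fin.cons j l : Fin (m + 1) → Idx N) with hμ_def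
  set G := gap (Fin.cons j l : Fin (m + 1) → Idx N)
  have hμ1 : 1 ≤ μ := one_le_mu _
  have hμ0 : 0 < μ := by linarith
  have hj := size_pos j
  have hx := size_pos (l i)
  have hμx : μ ≤ size (l i) := mu_cons_le j l i (one_le_size _) fun k _ => hmax k
  have hμj : μ ≤ size j := by linarith [hfar i]
  have hμprod : μ ≤ ∏ b ∈ Finset.univ.erase i, size (l b) := by
    refine mu_cons_le j l i (Finset.one_le_prod fun b _ => one_le_size _) fun b hb => ?_
    rw [← Finset.mul_prod_erase _ _ (Finset.mem_erase.2 ⟨hb, Finset.mem_univ b⟩)]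
    exact le_mul_of_one_le_right (size_pos _).le (Finset.one_le_prod fun i _ => one_le_size (l i))
  have h1 : μ ^ ((M : ℝ) + ν) / (μ + G) ^ M ≤
      2 ^ M * (size j ^ (-(M : ℝ)) * μ ^ ((M : ℝ) + ν)) := by
    have h2 : (size j / 2) ^ M ≤ (μ + G) ^ M := pow_le_pow_left₀ (by positivity) (by linarith) _
    calc μ ^ ((M : ℝ) + ν) / (μ + G) ^ M ≤ μ ^ ((M : ℝ) + ν) / (size j / 2) ^ M :=
          div_le_div_of_nonneg_left (Real.rpow_nonneg hμ0.le _) (by positivity) h2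
      _ = _ := by
          rw [Real.rpow_neg hj.le, Real.rpow_natCast, div_pow]
          field_simp
  -- The exponent `M` is split as `(s + κ) + (M - s - κ)`, and the second part is used to reduce
  -- the power of `μ`.
  have h3 : size j ^ (-(M : ℝ)) * μ ^ ((M : ℝ) + ν) ≤
      size j ^ (-(s + κ)) * (size (l i) ^ (s - κ) * μ ^ (σ - κ)) := by
    calc size j ^ (-(M : ℝ)) * μ ^ ((M : ℝ) + ν)
        = size j ^ (-(s + κ)) * (size j ^ (-(M - (s + κ))) * μ ^ ((M : ℝ) + ν)) := by
          rw [← mul_assoc, ← Real.rpow_add hj]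
          ring_nf
      _ ≤ size j ^ (-(s + κ)) * (μ ^ (-(M - (s + κ))) * μ ^ ((M : ℝ) + ν)) := by
          refine mul_le_mul_of_nonneg_left (mul_le_mul_of_nonneg_right ?_
            (Real.rpow_nonneg hμ0.le _)) (Real.rpow_nonneg hj.le _)
          exact Real.rpow_le_rpow_of_nonpos hμ0 hμj (by linarith)
      _ = size j ^ (-(s + κ)) * (μ ^ (s - κ) * μ ^ (2 * κ + ν)) := by
          rw [← Real.rpow_add hμ0, ← Real.rpow_add hμ0]
          ring_nf
      _ ≤ _ := by
          refine mul_le_mul_of_nonneg_left (mul_le_mul ?_ ?_ (Real.rpow_nonneg hμ0.le _)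
            (Real.rpow_nonneg hx.le _)) (Real.rpow_nonneg hj.le _)
          · exact Real.rpow_le_rpow hμ0.le hμx (by linarith)
          · exact Real.rpow_le_rpow_of_exponent_le hμ1 (by linarith)
  have h4 : μ ^ (σ - κ) ≤ ∏ b ∈ Finset.univ.erase i, size (l b) ^ (σ - κ) := by
    rw [Real.finsetProd_rpow _ _ fun b _ => (size_pos (l b)).le]
    exact Real.rpow_le_rpow hμ0.le hμprod (by linarith)
  have h5 : ∏ b, size (l b) ^ ((if b ∈ ({i} : Finset (Fin m)) then s else σ) - κ) =
      size (l i) ^ (s - κ) * ∏ b ∈ Finset.univ.erase i, size (l b) ^ (σ - κ) := by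
    rw [← Finset.mul_prod_erase _ _ (Finset.mem_univ i), if_pos (Finset.mem_singleton_self i)]
    congr 1
    refine Finset.prod_congr rfl fun b hb => ?_
    rw [if_neg (by simpa using Finset.ne_of_mem_erase hb)]
  rw [h5]
  refine (mul_le_mul_of_nonneg_right (le_abs_self C) (div_nonneg (Real.rpow_nonneg hμ0.le _)
    (pow_nonneg (by linarith) _))).trans ?_
  rw [mul_assoc]
  refine mul_le_mul_of_nonneg_left (h1.trans (mul_le_mul_of_nonneg_left (h3.trans ?_)
    (by positivity))) (abs_nonneg _)
  exact mul_le_mul_of_nonneg_left (mul_le_mul_of_nonneg_left h4 (Real.rpow_nonneg hx.le _))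
    (Real.rpow_nonneg hj.le _)

variable {s : ℝ}

theorem weight_comp_perm (σ : ℝ) {m : ℕ} (u : Fin m → Phase N s) (π : Equiv.Perm (Fin m))
    (i : Fin m) : weight σ {i} (fun b => u (π b)) = weight σ {π i} u := by
  rw [weight, weight,
    ← Equiv.prod_comp π fun b => if b ∈ ({π i} : Finset (Fin m)) then ‖u b‖ else wnorm σ (u b).seq]
  simp

/-- The part of a field in which the output index is far larger than all input indices is
smoothing. -/
theorem symSum_far_le {a : Coeffs N} {k : ℕ} {ν σ : ℝ} (hν : 0 ≤ ν) (ha : InTInf a k ν)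
    (hσ : ν + 3 * (2 * d) ≤ σ) (hs : σ ≤ s) {m : ℕ} (hm : 2 ≤ m) (hmk : m ≤ k) :
    ∃ C : ℝ, 0 ≤ C ∧ ∀ (u : Fin m → Phase N s) (j : Idx N),
      (∀ i x, (u i).seq x ≠ 0 → 2 * size x ≤ size j) →
      ‖symSum (a m j) fun i => (u i).seq‖ ≤
        C * (∑ i, weight σ {i} u) * size j ^ (-(s + 2 * d)) := by
  obtain ⟨C, hC, hfar⟩ := coeff_far_le hν ha hσ hs
  set Z := ∑' j : Idx N, size j ^ (-(2 * d : ℝ)) with hZ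
  have hZ0 : 0 ≤ Z := tsum_nonneg fun j => Real.rpow_nonneg (size_pos j).le _
  have hd0 : (0 : ℝ) ≤ 2 * d := by positivity
  have hsn := summable_prod_pi (f := fun (_ : Fin m) (j : Idx N) => size j ^ (-(2 * d : ℝ)))
    (fun _ j => Real.rpow_nonneg (size_pos j).le _) fun _ => summable_size_rpow N
  have key : ∀ (u : Fin m → Phase N s) (j : Idx N),
      (∀ i x, (u i).seq x ≠ 0 → 2 * size x ≤ size j) →
      ‖coeffSum (a m j) fun i => (u i).seq‖ ≤
        C * (∑ i, weight σ {i} u) * size j ^ (-(s + 2 * d)) * Z ^ m := by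
    intro u j hu
    have hW : 0 ≤ C * (∑ i, weight σ {i} u) * size j ^ (-(s + 2 * d)) :=
      mul_nonneg (mul_nonneg hC (Finset.sum_nonneg fun i _ => weight_nonneg _ _ _))
        (Real.rpow_nonneg (size_pos j).le _)
    have hterm : ∀ l : Fin m → Idx N, ‖a m j l * ∏ i, (u i).seq (l i)‖ ≤
        C * (∑ i, weight σ {i} u) * size j ^ (-(s + 2 * d)) *
          ∏ i, size (l i) ^ (-(2 * d : ℝ)) := by
      intro l
      by_cases h0 : ∃ i, (u i).seq (l i) = 0
      · obtain ⟨i, hi⟩ := h0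
        rw [Finset.prod_eq_zero (Finset.mem_univ i) hi, mul_zero, norm_zero]
        exact mul_nonneg hW (Finset.prod_nonneg fun i _ => Real.rpow_nonneg (size_pos _).le _)
      · push Not at h0
        have : Nonempty (Fin m) := ⟨⟨0, by omega⟩⟩
        obtain ⟨i, hi⟩ := Finite.exists_max fun i => size (l i)
        rw [norm_mul, norm_prod]
        refine (mul_le_mul_of_nonneg_right (hfar m hm hmk j l i (fun b => hu b _ (h0 b)) hi)
          (Finset.prod_nonneg fun _ _ => norm_nonneg _)).trans ?_
        have hprod : (∏ b, size (l b) ^ ((if b ∈ ({i} : Finset (Fin m)) then s else σ) - 2 * d)) *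
            ∏ b, ‖(u b).seq (l b)‖ ≤ weight σ {i} u * ∏ b, size (l b) ^ (-(2 * d : ℝ)) := by
          rw [← Finset.prod_mul_distrib, weight, ← Finset.prod_mul_distrib]
          refine Finset.prod_le_prod (fun b _ => mul_nonneg (Real.rpow_nonneg (size_pos _).le _)
            (norm_nonneg _)) fun b _ => ?_
          rw [sub_eq_add_neg, Real.rpow_add (size_pos _), mul_right_comm]
          refine mul_le_mul_of_nonneg_right ?_ (Real.rpow_nonneg (size_pos _).le _)
          split_ifs
          · rw [Phase.norm_eq]
            exact size_rpow_mul_norm_le (u b).seq_mem _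
          · exact size_rpow_mul_norm_le (wnorm_mono_exp hs (u b).seq_mem).1 _
        have hsingle : weight σ {i} u ≤ ∑ i, weight σ {i} u :=
          Finset.single_le_sum (f := fun i => weight σ {i} u) (fun i _ => weight_nonneg _ _ _)
            (Finset.mem_univ i)
        calc C * (size j ^ (-(s + 2 * d)) * ∏ b, size (l b) ^
                ((if b ∈ ({i} : Finset (Fin m)) then s else σ) - 2 * d)) *
              ∏ b, ‖(u b).seq (l b)‖
            = C * size j ^ (-(s + 2 * d)) * ((∏ b, size (l b) ^
                ((if b ∈ ({i} : Finset (Fin m)) then s else σ) - 2 * d)) *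
              ∏ b, ‖(u b).seq (l b)‖) := by ring
          _ ≤ C * size j ^ (-(s + 2 * d)) * ((∑ i, weight σ {i} u) *
                ∏ b, size (l b) ^ (-(2 * d : ℝ))) := by
              refine mul_le_mul_of_nonneg_left (hprod.trans (mul_le_mul_of_nonneg_right hsingle
                (Finset.prod_nonneg fun i _ => Real.rpow_nonneg (size_pos _).le _)))
                (mul_nonneg hC (Real.rpow_nonneg (size_pos j).le _))
          _ = _ := by ring
    refine (tsum_of_norm_bounded (hsn.mul_left _).hasSum hterm).trans ?_
    rw [tsum_mul_left]
    refine mul_le_mul_of_nonneg_left ((tsum_prod_pi_le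
      (f := fun (_ : Fin m) (j : Idx N) => size j ^ (-(2 * d : ℝ)))
      (fun _ j => Real.rpow_nonneg (size_pos j).le _) fun _ => summable_size_rpow N).trans_eq ?_) hW
    simp [hZ]
  refine ⟨C * Z ^ m, by positivity, fun u j hu => ?_⟩
  rw [symSum, norm_mul, norm_inv, Complex.norm_natCast,
    inv_mul_le_iff₀ (by exact_mod_cast m.factorial_pos)]
  refine (norm_sum_le_of_le _ fun π _ => key (fun i => u (π i)) j fun i => hu (π i)).trans_eq ?_
  have hperm : ∀ π : Equiv.Perm (Fin m),
      ∑ i, weight σ {i} (fun b => u (π b)) = ∑ i, weight σ {i} u := fun π => by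
    simp only [weight_comp_perm]
    exact Equiv.sum_comp π fun i => weight σ {i} u
  simp only [hperm]
  rw [Finset.sum_const, Finset.card_univ, Fintype.card_perm, Fintype.card_fin, nsmul_eq_mul]
  ring

theorem weight_singleton (σ : ℝ) {m : ℕ} (u : Fin m → Phase N s) (i : Fin m) :
    weight σ {i} u = ‖u i‖ * ∏ b ∈ Finset.univ.erase i, wnorm σ (u b).seq := by
  rw [weight, ← Finset.mul_prod_erase _ _ (Finset.mem_univ i),
    if_pos (Finset.mem_singleton_self i)]
  congr 1
  exact Finset.prod_congr rfl fun b hb => if_neg (by simpa using Finset.ne_of_mem_erase hb)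

theorem weight_empty (σ : ℝ) {m : ℕ} (u : Fin m → Phase N s) :
    weight σ ∅ u = ∏ b, wnorm σ (u b).seq := by
  simp [weight]

/-- The sequence of absolute values. -/
def Phase.abs (u : Phase N s) : Phase N s :=
  Phase.ofSeq (fun j => (‖u.seq j‖ : ℂ)) (wnorm_mono u.seq_mem fun j => by simp).1

theorem Phase.norm_abs (u : Phase N s) : ‖u.abs‖ ≤ ‖u‖ := by
  rw [Phase.norm_eq, Phase.norm_eq]
  exact (wnorm_mono u.seq_mem fun j => by simp [Phase.abs]).2

/-- The sequence `|j|^{-(s+2d)}`, an element of `𝒫_s` that dominates the smoothing part of a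
field. -/
def decaying (N : Set (Fin d → ℤ)) (s : ℝ) : Phase N s :=
  Phase.ofSeq (fun j => ((size j ^ (-(s + 2 * d)) : ℝ) : ℂ)) <| by
    refine (summable_size_rpow N).of_nonneg_of_le (fun j => mul_nonneg
      (Real.rpow_nonneg (size_pos j).le _) (sq_nonneg _)) fun j => ?_
    rw [Complex.norm_real, Real.norm_of_nonneg (Real.rpow_nonneg (size_pos j).le _),
      size_rpow_two_mul, ← Real.rpow_add (size_pos j), ← Real.rpow_natCast,
      ← Real.rpow_mul (size_pos j).le]
    refine Real.rpow_le_rpow_of_exponent_le (one_le_size j) ?_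
    have : (0 : ℝ) ≤ d := Nat.cast_nonneg d
    push_cast
    linarith

/-- A homogeneous component of a polynomial field is a tame map, if the field is bounded near the
origin in the strong and in the weak norm and its coefficients decay off the diagonal.

The strong estimate follows from the weak one through `norm_le_of_layers`. For the output indices
with `|j| ≥ 2^q`, each input is split at `|x| = 2^{q-1}`. If some input is of high frequency, the weak
estimate applies with this input cut off; otherwise the output is far away from all the inputs. -/
theorem exists_tameMap {a : Coeffs N} {k : ℕ} {ν : ℝ} (hν : 0 ≤ ν) (ha : InTInf a k ν)
    (hνs : ν + 2 * d ≤ s) (hbd : BoundedNearZero a k s) {m : ℕ} (hm : 2 ≤ m) (hmk : m ≤ k) :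
    ∃ T : ContinuousMultilinearMap ℂ (fun _ : Fin m => Phase N s) (Phase N s),
      (∀ u j, (T u).seq j = symSum (a m j) fun i => (u i).seq) ∧
      ∀ σ, ν + 3 * (2 * d) ≤ σ → σ < s → BoundedNearZero a k σ → TameMap σ T := by
  classical
  have hcb := InT.coeffBound hν (ha 0)
  obtain ⟨C, hC, hbound⟩ := exists_symSum_bound hνs hm hmk hcb hbd
  choose v hv hvn using hbound
  have hv' : ∀ u j, (v u).seq j = symForm s (a m j) u := fun u j => by
    rw [hv, symForm_apply hνs (hcb m hm hmk j)]
  let T : ContinuousMultilinearMap ℂ (fun _ : Fin m => Phase N s) (Phase N s) :=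
    MultilinearMap.mkContinuous
      { toFun := v
        map_update_add' := fun u i x y => Phase.ext fun j => by
          -- The decidability instance of the structure field is an arbitrary one.
          rename_i inst
          obtain rfl : inst = instDecidableEqFin m := Subsingleton.elim _ _
          rw [hv', Phase.seq_add, Pi.add_apply, hv', hv']
          exact (symForm s (a m j)).map_update_add u i x y
        map_update_smul' := fun u i c x => Phase.ext fun j => by
          rename_i inst
          obtain rfl : inst = instDecidableEqFin m := Subsingleton.elim _ _
          rw [hv', Phase.seq_smul, Pi.smul_apply, hv']
          exact (symForm s (a m j)).map_update_smul u i c x } C hvn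
  have hT : ∀ u j, (T u).seq j = symSum (a m j) fun i => (u i).seq := hv
  refine ⟨T, hT, fun σ hσ hσs hbdσ => ?_⟩
  have hd0 : (0 : ℝ) ≤ 2 * d := by positivity
  obtain ⟨C₁, hC₁, hweak⟩ := exists_symSum_bound (by linarith) hm hmk hcb hbdσ
  have hweak' : ∀ u : Fin m → Phase N s, wnorm σ (T u).seq ≤ C₁ * ∏ i, wnorm σ (u i).seq := by
    intro u
    obtain ⟨w, hw, hwn⟩ := hweak fun i => (u i).lower hσs.le
    simp only [Phase.norm_lower, Phase.seq_lower] at hwn hw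
    rw [Phase.norm_eq] at hwn
    rwa [show (T u).seq = w.seq from funext fun j => by rw [hT, hw]]
  refine ⟨?_, C₁, hC₁, fun u => by rw [weight_empty]; exact hweak' u⟩
  obtain ⟨C₂, hC₂, hfar⟩ := symSum_far_le hν ha hσ hσs.le hm hmk
  obtain ⟨K, hK, hlayer⟩ := norm_le_of_layers hσs (N := N)
  refine ⟨K * (2 * (2 ^ m * C₁ + C₂ * ‖decaying N s‖)), by positivity, fun u => ?_⟩
  set Y := ∑ i, weight σ {i} u with hY
  have hY0 : 0 ≤ Y := Finset.sum_nonneg fun i _ => weight_nonneg _ _ _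
  set ρ : Fin m → ℝ := fun i => ∏ b ∈ Finset.univ.erase i, wnorm σ (u b).seq with hρ
  have hρ0 : ∀ i, 0 ≤ ρ i := fun i => Finset.prod_nonneg fun _ _ => wnorm_nonneg _ _
  -- The majorant of `T u` to which the layer-cake estimate is applied.
  set g₀ : Phase N s := ∑ i, (ρ i : ℂ) • (u i).abs with hg₀
  have hg₀n : ‖g₀‖ ≤ Y := by
    refine norm_sum_le_of_le _ fun i _ => ?_
    rw [norm_smul, Complex.norm_real, Real.norm_of_nonneg (hρ0 i), weight_singleton, mul_comm]
    exact mul_le_mul_of_nonneg_right (Phase.norm_abs _) (hρ0 i)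
  set h : ℝ → ℝ → Phase N s := fun x y => (x : ℂ) • g₀ + (y : ℂ) • decaying N s with hh
  have hg₀seq : ∀ j, g₀.seq j = ((∑ i, ρ i * ‖(u i).seq j‖ : ℝ) : ℂ) := fun j => by
    rw [hg₀, Phase.seq_sum, Finset.sum_apply]
    push_cast
    exact Finset.sum_congr rfl fun i _ => rfl
  have hg₀pos : ∀ j, 0 ≤ ∑ i, ρ i * ‖(u i).seq j‖ := fun j =>
    Finset.sum_nonneg fun i _ => mul_nonneg (hρ0 i) (norm_nonneg _)
  have hdec : ∀ j, (decaying N s).seq j = ((size j ^ (-(s + 2 * d)) : ℝ) : ℂ) := fun j => rfl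
  have hdecpos : ∀ j : Idx N, 0 ≤ size j ^ (-(s + 2 * d)) := fun j =>
    Real.rpow_nonneg (size_pos j).le _
  have hhn : ∀ x y, 0 ≤ x → 0 ≤ y → ∀ j, ‖(h x y).seq j‖ =
      x * (∑ i, ρ i * ‖(u i).seq j‖) + y * size j ^ (-(s + 2 * d)) := by
    intro x y hx hy j
    simp only [hh, Phase.seq_add, Phase.seq_smul, Pi.add_apply, Pi.smul_apply, smul_eq_mul,
      hg₀seq, hdec]
    rw [← Complex.ofReal_mul, ← Complex.ofReal_mul, ← Complex.ofReal_add, Complex.norm_real,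
      Real.norm_of_nonneg (add_nonneg (mul_nonneg hx (hg₀pos j)) (mul_nonneg hy (hdecpos j)))]
  set X := 2 ^ m * C₁ with hX
  have hX0 : 0 ≤ X := by positivity
  have hgn : ‖(2 : ℂ) • h X (C₂ * Y)‖ ≤ 2 * (X + C₂ * ‖decaying N s‖) * Y := by
    rw [norm_smul, Complex.norm_ofNat, mul_assoc]
    refine mul_le_mul_of_nonneg_left ((norm_add_le _ _).trans ?_) zero_le_two
    rw [norm_smul, norm_smul, Complex.norm_real, Complex.norm_real, Real.norm_of_nonneg hX0,
      Real.norm_of_nonneg (mul_nonneg hC₂ hY0), add_mul]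
    refine add_le_add (mul_le_mul_of_nonneg_left hg₀n hX0) (le_of_eq ?_)
    ring
  rw [mul_assoc]
  refine (hlayer (T u) ((2 : ℂ) • h X (C₂ * Y)) fun q => ?_).trans
    (mul_le_mul_of_nonneg_left hgn hK)
  set S : Set (Idx N) := {x | 2 ^ q ≤ 2 * size x} with hS
  have hmem : ∀ z : Phase N s, z.seq ∈ phaseSubmodule N σ := fun z =>
    (wnorm_mono_exp hσs.le z.seq_mem).1
  -- Monotonicity of the cut majorants.
  have hcutmono : ∀ (S' : Set (Idx N)) (z : Phase N s) (x y : ℝ), 0 ≤ x → 0 ≤ y →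
      (∀ j ∈ S', j ∈ S) → (∀ j ∈ S', ‖z.seq j‖ ≤ ‖(h x y).seq j‖) →
      wnorm σ (cut s S' z).seq ≤ wnorm σ (cut s S (h x y)).seq := by
    intro S' z x y hx hy hSS hz
    refine (wnorm_mono (hmem _) fun j => ?_).2
    rw [cut_seq, cut_seq]
    by_cases hj : j ∈ S'
    · rw [if_pos hj, if_pos (hSS j hj)]
      exact hz j hj
    · rw [if_neg hj, norm_zero]
      exact norm_nonneg _
  set hi : Fin m → Phase N s := fun i => cut s S (u i) with hhi
  set lo : Fin m → Phase N s := fun i => cut s Sᶜ (u i) with hlo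
  have hsplit : T u = ∑ A : Finset (Fin m), T (A.piecewise hi lo) := by
    rw [← T.map_add_univ]
    exact congrArg T (funext fun i => (cut_add_cut_compl s S (u i)).symm)
  set W := wnorm σ (cut s S (h X (C₂ * Y))).seq with hW
  have hnear : ∀ A : Finset (Fin m), A.Nonempty →
      wnorm σ (T (A.piecewise hi lo)).seq ≤ C₁ * wnorm σ (cut s S (h 1 0)).seq := by
    rintro A ⟨i, hiA⟩
    refine (hweak' _).trans (mul_le_mul_of_nonneg_left ?_ hC₁)
    rw [← Finset.mul_prod_erase _ _ (Finset.mem_univ i), Finset.piecewise_eq_of_mem _ _ _ hiA]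
    calc wnorm σ (hi i).seq * ∏ b ∈ Finset.univ.erase i, wnorm σ (A.piecewise hi lo b).seq
        ≤ wnorm σ (hi i).seq * ρ i := by
          refine mul_le_mul_of_nonneg_left (Finset.prod_le_prod
            (fun _ _ => wnorm_nonneg _ _) fun b _ => ?_) (wnorm_nonneg _ _)
          by_cases hb : b ∈ A
          · rw [Finset.piecewise_eq_of_mem _ _ _ hb]
            exact wnorm_cut_le hσs.le _ _
          · rw [Finset.piecewise_eq_of_notMem _ _ _ hb]
            exact wnorm_cut_le hσs.le _ _
      _ = wnorm σ (cut s S ((ρ i : ℂ) • u i)).seq := by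
          rw [map_smul, Phase.seq_smul, wnorm_smul, Complex.norm_real,
            Real.norm_of_nonneg (hρ0 i), mul_comm]
      _ ≤ _ := by
          refine hcutmono S _ 1 0 zero_le_one le_rfl (fun j hj => hj) fun j _ => ?_
          rw [hhn 1 0 zero_le_one le_rfl, one_mul, zero_mul, add_zero, Phase.seq_smul,
            Pi.smul_apply, norm_smul, Complex.norm_real, Real.norm_of_nonneg (hρ0 i)]
          exact Finset.single_le_sum (f := fun i => ρ i * ‖(u i).seq j‖)
            (fun i _ => mul_nonneg (hρ0 i) (norm_nonneg _)) (Finset.mem_univ i)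
  have hX1 : X * wnorm σ (cut s S (h 1 0)).seq ≤ W := by
    have h1 := wnorm_smul σ (X : ℂ) (cut s S (h 1 0)).seq
    rw [Complex.norm_real, Real.norm_of_nonneg hX0, ← Phase.seq_smul, ← map_smul] at h1
    rw [← h1]
    refine hcutmono S _ _ _ hX0 (mul_nonneg hC₂ hY0) (fun j hj => hj) fun j _ => ?_
    rw [Phase.seq_smul, Pi.smul_apply, norm_smul, hhn 1 0 zero_le_one le_rfl,
      hhn _ _ hX0 (mul_nonneg hC₂ hY0), Complex.norm_real, Real.norm_of_nonneg hX0, one_mul,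
      zero_mul, add_zero]
    exact le_add_of_nonneg_right (mul_nonneg (mul_nonneg hC₂ hY0) (hdecpos j))
  have hfar' : wnorm σ (cut s {x | 2 ^ q ≤ size x} (T lo)).seq ≤ W := by
    refine hcutmono _ _ _ _ hX0 (mul_nonneg hC₂ hY0) (fun j hj => ?_) fun j hj => ?_
    · have hj : 2 ^ q ≤ size j := hj
      change 2 ^ q ≤ 2 * size j
      linarith [size_pos j]
    · have hj : 2 ^ q ≤ size j := hj
      rw [hhn _ _ hX0 (mul_nonneg hC₂ hY0), hT]
      refine (hfar lo j fun i x hx => ?_).trans ?_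
      · by_contra hlt
        have hxS : x ∈ S := by
          change 2 ^ q ≤ 2 * size x
          linarith
        simp [hlo, cut_seq, hxS] at hx
      · refine le_add_of_nonneg_of_le (mul_nonneg hX0 (hg₀pos j)) ?_
        refine mul_le_mul_of_nonneg_right (mul_le_mul_of_nonneg_left
          (Finset.sum_le_sum fun i _ => ?_) hC₂) (hdecpos j)
        exact weight_diag_le hσs.le {i} (fun _ => _) (fun _ => _) u
  have hlow : wnorm σ (cut s {x | 2 ^ q ≤ size x} (T u)).seq ≤
      X * wnorm σ (cut s S (h 1 0)).seq + W := by
    rw [hsplit, map_sum, Phase.seq_sum]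
    refine (wnorm_sum_le _ _ fun A => hmem _).trans ?_
    rw [← Finset.sum_erase_add _ _ (Finset.mem_univ (∅ : Finset (Fin m)))]
    refine add_le_add ?_ (by rw [Finset.piecewise_empty]; exact hfar')
    refine (Finset.sum_le_card_nsmul _ _ (C₁ * wnorm σ (cut s S (h 1 0)).seq) fun A hA => ?_).trans
      ?_
    · exact (wnorm_cut_le hσs.le _ _).trans
        (hnear A (Finset.nonempty_iff_ne_empty.2 (Finset.ne_of_mem_erase hA)))
    · rw [nsmul_eq_mul, hX, mul_assoc]
      refine mul_le_mul_of_nonneg_right ?_ (mul_nonneg hC₁ (wnorm_nonneg _ _))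
      have : (Finset.univ.erase (∅ : Finset (Fin m))).card ≤ 2 ^ m :=
        (Finset.card_le_univ _).trans (by simp)
      exact_mod_cast this
  refine hlow.trans ?_
  rw [map_smul, Phase.seq_smul, wnorm_smul, Complex.norm_ofNat]
  linarith

end

/-! ### The quadratic form and the construction of its correction -/

section

theorem coeffSum_bar {m : ℕ} {b b' : (Fin m → Idx N) → ℂ}
    (h : ∀ l, b (fun i => bar (l i)) = -b' l) (u : Fin m → Idx N → ℂ) :
    (coeffSum b fun i j => u i (bar j)) = -coeffSum b' u := by
  rw [coeffSum, coeffSum, ← tsum_neg, ← (Equiv.piCongrRight fun _ : Fin m => barEquiv N).tsum_eq]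
  refine tsum_congr fun l => ?_
  change b (fun i => bar (l i)) * ∏ i, u i (bar (bar (l i))) = _
  simp only [h, bar_bar, neg_mul]

theorem symSum_bar {m : ℕ} {b b' : (Fin m → Idx N) → ℂ}
    (h : ∀ l, b (fun i => bar (l i)) = -b' l) (u : Fin m → Idx N → ℂ) :
    (symSum b fun i j => u i (bar j)) = -symSum b' u := by
  rw [symSum, symSum, ← mul_neg, ← Finset.sum_neg_distrib]
  exact congrArg _ (Finset.sum_congr rfl fun π _ => coeffSum_bar h fun i => u (π i))

/-- The Taylor polynomial is bounded near the origin, as the difference of the field and of the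
remainder. -/
theorem IsTaylorAt.boundedNearZero {F : (Idx N → ℂ) → (Idx N → ℂ)} {a : Coeffs N} {k : ℕ}
    {s C : ℝ} (ht : IsTaylorAt F a k s) {U : Set (Phase N s)} {G : Phase N s → Phase N s}
    (hU : IsOpen U) (h0 : 0 ∈ U) (hG : ∀ z ∈ U, (G z).seq = F z.seq)
    (hC : ∀ᶠ z in 𝓝 0, ‖G z‖ ≤ C * ‖z‖ ^ 2) : BoundedNearZero a k s := by
  obtain ⟨C', ht⟩ := ht
  obtain ⟨ρ, hρ, hball⟩ := Metric.eventually_nhds_iff.1 ((hU.eventually_mem h0).and (hC.and ht))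
  refine ⟨min (ρ / 2) 1, |C| + |C'|, lt_min (by linarith) one_pos, by positivity, fun z hz => ?_⟩
  have h1 : ‖z‖ ≤ 1 := hz.trans (min_le_right _ _)
  obtain ⟨hzU, hzC, w, hw, hwC⟩ := hball (y := z) (by
    rw [dist_zero_right]
    linarith [hz.trans (min_le_left (ρ / 2) 1)])
  refine ⟨G z - w, fun j => ?_, (norm_sub_le _ _).trans (add_le_add ?_ ?_)⟩
  · rw [Phase.seq_sub, Pi.sub_apply, hG z hzU, hw, add_sub_cancel_right]
  · refine hzC.trans ((mul_le_mul_of_nonneg_right (le_abs_self C) (by positivity)).trans ?_)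
    exact mul_le_of_le_one_right (abs_nonneg _) (pow_le_one₀ (norm_nonneg _) h1)
  · refine hwC.trans ((mul_le_mul_of_nonneg_right (le_abs_self C') (by positivity)).trans ?_)
    exact mul_le_of_le_one_right (abs_nonneg _) (pow_le_one₀ (norm_nonneg _) h1)

variable {s : ℝ}

theorem Phase.inner_star_toL2 (u v : Phase N s) :
    HasSum (fun j => ((size j ^ (2 * s) : ℝ) : ℂ) * (u.seq (bar j) * v.seq j))
      (inner ℂ (star (Phase.toL2 N s (tau s u))) (Phase.toL2 N s v)) := by
  refine (lp.hasSum_inner (𝕜 := ℂ) (star (Phase.toL2 N s (tau s u))) (Phase.toL2 N s v)).congr_fun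
    fun j => ?_
  have h : size j ^ (2 * s) = size j ^ s * size j ^ s := by
    rw [two_mul, Real.rpow_add (size_pos j)]
  change _ = ((size j ^ s : ℝ) : ℂ) * v.seq j *
    starRingEnd ℂ (starRingEnd ℂ (((size j ^ s : ℝ) : ℂ) * u.seq (bar j)))
  rw [Complex.conj_conj, h]
  push_cast
  ring

/-- The bilinear form `∑_j |j|^{2s} u_{j̄} v_j`. On the diagonal it is a holomorphic quadratic form,
which on real sequences equals the square of the norm of `𝒫_s`. -/
def energy (N : Set (Fin d → ℤ)) (s : ℝ) : CForm N s (Fin 2) :=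
  MultilinearMap.mkContinuous
    { toFun := fun u => inner ℂ (star (Phase.toL2 N s (tau s (u 0)))) (Phase.toL2 N s (u 1))
      map_update_add' := fun u i x y => by
        fin_cases i
        · simp
        · simp
      map_update_smul' := fun u i c x => by
        fin_cases i
        · simp [mul_comm c]
        · simp } 1 fun u => by
    rw [one_mul, Fin.prod_univ_two, ← norm_tau s (u 0)]
    refine (norm_inner_le_norm (𝕜 := ℂ) (star (Phase.toL2 N s (tau s (u 0))))
      (Phase.toL2 N s (u 1))).trans_eq ?_
    rw [norm_star]
    rfl

theorem energy_apply (u : Fin 2 → Phase N s) :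
    energy N s u = ∑' j, ((size j ^ (2 * s) : ℝ) : ℂ) * ((u 0).seq (bar j) * (u 1).seq j) :=
  (Phase.inner_star_toL2 (u 0) (u 1)).tsum_eq.symm

theorem energy_real {z : Phase N s} (hz : IsRealSeq z.seq) :
    (energy N s fun _ => z) = ((‖z‖ ^ 2 : ℝ) : ℂ) := by
  rw [energy_apply, Phase.norm_sq_eq, Complex.ofReal_tsum]
  refine tsum_congr fun j => ?_
  rw [hz j, Complex.conj_mul']
  push_cast
  rfl

theorem energy_mem (σ : ℝ) : (fun z => energy N s fun _ => z) ∈ Form N s σ 2 1 := by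
  refine ⟨energy N s, ⟨‖energy N s‖, norm_nonneg _, fun u => ?_⟩, fun u => ?_, fun z => rfl⟩
  · refine ((energy N s).le_opNorm u).trans_eq ?_
    have h : (Finset.univ : Finset (Fin 2)).powersetCard 2 = {Finset.univ} := by
      rw [← Finset.powersetCard_self]
      simp
    rw [h, Finset.sum_singleton, weight]
    simp
  · rw [one_mul, energy_apply, energy_apply]
    rw [← (barEquiv N).tsum_eq]
    refine tsum_congr fun j => ?_
    change _ * ((u 0).seq (bar (bar (bar j))) * (u 1).seq (bar (bar j))) = _
    rw [bar_bar, bar_bar]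
    rfl

/-- The quadratic form is conserved by the linear flow, as it is a combination of the actions
`z_j z_{j̄}`. -/
theorem fderiv_energy_linearVelocity {ω : Idx N → ℝ} (hsym : ∀ j, ω (bar j) = -ω j)
    (Λ : Finset (Idx N)) (z : Phase N s) :
    fderiv ℂ (fun z => energy N s fun _ => z) (cut s ↑Λ z) (linearVelocity s ω Λ z) = 0 := by
  rw [fderiv_linearVelocity, Finset.sum_eq_zero, neg_zero]
  intro l _
  by_cases h : l 0 = bar (l 1)
  · simp [Fin.sum_univ_two, h, hsym]
  · suffices h1 : (energy N s fun k => unit s (l k)) = 0 by rw [h1]; ring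
    rw [energy_apply]
    refine (tsum_congr fun j => ?_).trans tsum_zero
    rw [unit_seq, unit_seq]
    by_cases h2 : j = l 1
    · rw [h2, if_neg (Ne.symm h)]
      simp
    · simp [h2]

/-- Finite sums of tame homogeneous polynomials of degree at least `n` and of parity `ε` under the
symmetry `τ`. -/
def Tail (N : Set (Fin d → ℤ)) (s σ : ℝ) (n : ℕ) (ε : ℂ) : Submodule ℂ (Phase N s → ℂ) :=
  ⨆ i : ℕ, Form N s σ (n + i) ε

theorem Form.le_tail (σ : ℝ) {n p : ℕ} (h : n ≤ p) (ε : ℂ) : Form N s σ p ε ≤ Tail N s σ n ε := by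
  obtain ⟨i, rfl⟩ := Nat.exists_eq_add_of_le h
  exact le_iSup (fun i => Form N s σ (n + i) ε) i

theorem Tail.eq_sup (σ : ℝ) (n : ℕ) (ε : ℂ) :
    Tail N s σ n ε = Form N s σ n ε ⊔ Tail N s σ (n + 1) ε := by
  rw [Tail, ← sup_iSup_nat_succ, Tail]
  simp only [add_zero, add_assoc, add_comm 1]

theorem Tail.mono {σ σ' : ℝ} (h : σ ≤ σ') (h' : σ' ≤ s) (n : ℕ) (ε : ℂ) :
    Tail N s σ n ε ≤ Tail N s σ' n ε :=
  iSup_mono fun i => Form.mono h h' (n + i) ε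

theorem Tail.anti (σ : ℝ) (n : ℕ) (ε : ℂ) : Tail N s σ (n + 1) ε ≤ Tail N s σ n ε := by
  rw [Tail.eq_sup σ n]
  exact le_sup_right

theorem Tail.contDiff {σ : ℝ} {n : ℕ} {ε : ℂ} {f : Phase N s → ℂ} (hf : f ∈ Tail N s σ n ε) :
    ContDiff ℂ 1 f :=
  Submodule.iSup_induction _ (motive := fun f => ContDiff ℂ 1 f) hf
    (fun _ _ h => Form.contDiff h) contDiff_const fun _ _ h h' => h.add h'

theorem Tail.norm_le {σ : ℝ} {n : ℕ} {ε : ℂ} {f : Phase N s → ℂ} (hf : f ∈ Tail N s σ n ε) :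
    ∃ C : ℝ, 0 ≤ C ∧ ∀ z, ‖z‖ ≤ 1 → ‖f z‖ ≤ C * ‖z‖ ^ n := by
  refine Submodule.iSup_induction _ (motive := fun f => ∃ C : ℝ, 0 ≤ C ∧
    ∀ z, ‖z‖ ≤ 1 → ‖f z‖ ≤ C * ‖z‖ ^ n) hf (fun i f h => ?_) ⟨0, le_rfl, fun z _ => by simp⟩ ?_
  · obtain ⟨C, hC, h⟩ := Form.norm_le h
    exact ⟨C, hC, fun z hz => (h z).trans (mul_le_mul_of_nonneg_left
      (pow_le_pow_of_le_one (norm_nonneg z) hz (by omega)) hC)⟩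
  · rintro f g ⟨C, hC, hf⟩ ⟨D, hD, hg⟩
    refine ⟨C + D, by positivity, fun z hz => (norm_add_le _ _).trans ?_⟩
    rw [add_mul]
    exact add_le_add (hf z hz) (hg z hz)

theorem Tail.norm_fderiv_le {σ : ℝ} {n : ℕ} {ε : ℂ} {f : Phase N s → ℂ}
    (hf : f ∈ Tail N s σ n ε) :
    ∃ C : ℝ, 0 ≤ C ∧ ∀ z, ‖z‖ ≤ 1 → ∀ v, ‖fderiv ℂ f z v‖ ≤ C * ‖v‖ := by
  refine (Submodule.iSup_induction _ (motive := fun f => Differentiable ℂ f ∧ ∃ C : ℝ, 0 ≤ C ∧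
    ∀ z, ‖z‖ ≤ 1 → ∀ v, ‖fderiv ℂ f z v‖ ≤ C * ‖v‖) hf (fun i f h =>
      ⟨(Form.contDiff h).differentiable one_ne_zero, ?_⟩) ⟨differentiable_const 0, 0, le_rfl, fun z _ v => ?_⟩ ?_).2
  · obtain ⟨C, hC, h⟩ := Form.norm_fderiv_le h
    refine ⟨C, hC, fun z hz v => (h z v).trans (mul_le_mul_of_nonneg_left ?_ hC)⟩
    exact mul_le_of_le_one_left (norm_nonneg _) (pow_le_one₀ (norm_nonneg _) hz)
  · rw [show (0 : Phase N s → ℂ) = fun _ => 0 from rfl, fderiv_const_apply]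
    simp
  · rintro f g ⟨hdf, C, hC, hf⟩ ⟨hdg, D, hD, hg⟩
    refine ⟨hdf.add hdg, C + D, by positivity, fun z hz v => ?_⟩
    rw [fderiv_add (hdf z) (hdg z), add_mul]
    exact (norm_add_le _ _).trans (add_le_add (hf z hz v) (hg z hz v))

/-- The polynomial vector field `-i ∑_{m=2}^r T_m(z, …, z)`. -/
def polyVelocity (r : ℕ)
    (T : (m : ℕ) → ContinuousMultilinearMap ℂ (fun _ : Fin m => Phase N s) (Phase N s))
    (z : Phase N s) : Phase N s :=
  -Complex.I • ∑ m ∈ Finset.Icc 2 r, T m fun _ => z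

theorem continuous_polyVelocity (r : ℕ)
    (T : (m : ℕ) → ContinuousMultilinearMap ℂ (fun _ : Fin m => Phase N s) (Phase N s)) :
    Continuous (polyVelocity r T) :=
  (continuous_finsetSum (Finset.Icc 2 r) (f := fun m z => T m fun _ => z) fun m _ =>
    (T m).cont.comp (continuous_pi fun _ => continuous_id)).const_smul (-Complex.I)

theorem Form.fderiv_polyVelocity_mem {σ : ℝ} {p r : ℕ} (hp : 1 ≤ p)
    {T : (m : ℕ) → ContinuousMultilinearMap ℂ (fun _ : Fin m => Phase N s) (Phase N s)}
    (hT : ∀ m ∈ Finset.Icc 2 r, TameMap σ (T m))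
    (hT' : ∀ m ∈ Finset.Icc 2 r, ∀ u, T m (fun i => tau s (u i)) = -tau s (T m u))
    {f : Phase N s → ℂ} (hf : f ∈ Form N s σ p 1) :
    (fun z => fderiv ℂ f z (polyVelocity r T z)) ∈ Tail N s σ (p + 1) (-1) := by
  obtain ⟨n, rfl⟩ := Nat.exists_eq_add_of_le' hp
  have h : (fun z => fderiv ℂ f z (polyVelocity r T z)) =
      -Complex.I • ∑ m ∈ Finset.Icc 2 r, fun z => fderiv ℂ f z (T m fun _ => z) := by
    funext z
    rw [polyVelocity, map_smul, map_sum, Pi.smul_apply, Finset.sum_apply]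
  rw [h]
  refine Submodule.smul_mem _ _ (Submodule.sum_mem _ fun m hm => ?_)
  exact Form.le_tail σ (p := m + n) (by have := (Finset.mem_Icc.1 hm).1; omega) _
    (Form.bracket_mem hf (hT m hm) (hT' m hm))

/-- The recursive construction of the correction. Along the flow, the derivative of the even form
reached so far is odd. Its part of lowest degree is removed by a solution of the homological
equation, and this generates terms of higher degree only. Each step raises the exponent of the
weak norm by `α + 2d`, and this exponent has to stay below `s`. -/
theorem exists_correction {σ α γ : ℝ} (hα : 0 ≤ α) (hγ : 0 < γ)
    {r : ℕ} {ω : Idx N → ℝ} (hsym : ∀ j, ω (bar j) = -ω j)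
    (hω : ∀ p, 3 ≤ p → p ≤ r → ∀ l : Fin p → Idx N, ¬ IsActionTuple l →
      γ / mu l ^ α ≤ |Omega ω l|)
    {T : (m : ℕ) → ContinuousMultilinearMap ℂ (fun _ : Fin m => Phase N s) (Phase N s)}
    (hT : ∀ m ∈ Finset.Icc 2 r, ∀ σ', σ ≤ σ' → σ' < s → TameMap σ' (T m))
    (hT' : ∀ m ∈ Finset.Icc 2 r, ∀ u, T m (fun i => tau s (u i)) = -tau s (T m u))
    {n : ℕ} (hnr : n + 2 ≤ r) (hs : σ + n * (α + 2 * d) < s) :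
    ∃ h ∈ Tail N s (σ + n * (α + 2 * d)) 3 1,
      ∃ R ∈ Tail N s (σ + n * (α + 2 * d)) (n + 3) (-1), ∀ (Λ : Finset (Idx N)) z,
        fderiv ℂ ((fun z => energy N s fun _ => z) + h) (cut s ↑Λ z)
          (linearVelocity s ω Λ z + polyVelocity r T (cut s ↑Λ z)) = R (cut s ↑Λ z) := by
  have hE : Differentiable ℂ fun z => energy N s fun _ => z :=
    (Form.contDiff (energy_mem σ)).differentiable one_ne_zero
  have hκ : 0 ≤ α + 2 * d := by positivity
  induction n with
  | zero =>
    simp only [Nat.cast_zero, zero_mul, add_zero] at hs ⊢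
    refine ⟨0, Submodule.zero_mem _, _, Form.fderiv_polyVelocity_mem one_le_two
      (fun m hm => hT m hm σ le_rfl hs) hT' (energy_mem σ), fun Λ z => ?_⟩
    rw [add_zero, map_add, fderiv_energy_linearVelocity hsym, zero_add]
  | succ n ih =>
    have hstep : σ + (n : ℝ) * (α + 2 * d) + α + 2 * d = σ + (n + 1 : ℕ) * (α + 2 * d) := by
      push_cast
      ring
    have hle : σ + (n : ℝ) * (α + 2 * d) ≤ σ + (n + 1 : ℕ) * (α + 2 * d) := by
      rw [← hstep]
      linarith
    have hσ : σ ≤ σ + (n + 1 : ℕ) * (α + 2 * d) := by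
      have : 0 ≤ ((n + 1 : ℕ) : ℝ) * (α + 2 * d) := by positivity
      linarith
    obtain ⟨h, hh, R, hR, heq⟩ := ih (by omega) (hle.trans_lt hs)
    rw [Tail.eq_sup] at hR
    obtain ⟨g, hg, R', hR', rfl⟩ := Submodule.mem_sup.1 hR
    obtain ⟨f, hf, hfeq⟩ := Form.exists_homological hα hγ (hstep.trans_le hs.le) (by omega) hsym
      (hω (n + 3) (by omega) (by omega)) hg
    rw [hstep] at hf
    refine ⟨h + f, Submodule.add_mem _ (Tail.mono hle hs.le _ _ hh)
        (Form.le_tail _ (by omega) _ hf),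
      R' + fun z => fderiv ℂ f z (polyVelocity r T z), Submodule.add_mem _
        (Tail.mono hle hs.le _ _ hR')
        (Form.fderiv_polyVelocity_mem (by omega) (fun m hm => hT m hm _ hσ hs) hT' hf),
      fun Λ z => ?_⟩
    rw [← add_assoc, fderiv_add ((hE.add ((Tail.contDiff hh).differentiable one_ne_zero)) _)
      ((Form.contDiff hf).differentiable one_ne_zero _), add_apply, heq, map_add, hfeq]
    simp only [Pi.add_apply]
    ring

end

/-! ### Derivatives along solutions -/

section

variable {s : ℝ}

/-- Finite truncations converge locally uniformly, since they are contractions. -/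
theorem tendsto_cut_prod (z : Phase N s) :
    Tendsto (fun p : Finset (Idx N) × Phase N s => cut s ↑p.1 p.2) (atTop ×ˢ 𝓝 z) (𝓝 z) := by
  have h1 : Tendsto (fun p : Finset (Idx N) × Phase N s => cut s ↑p.1 z) (atTop ×ˢ 𝓝 z) (𝓝 z) :=
    (tendsto_cut s z).comp tendsto_fst
  have h2 : Tendsto (fun p : Finset (Idx N) × Phase N s => cut s ↑p.1 (p.2 - z))
      (atTop ×ˢ 𝓝 z) (𝓝 0) := by
    refine squeeze_zero_norm (fun p => norm_cut_le s _ _) ?_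
    have := (tendsto_snd (f := (atTop : Filter (Finset (Idx N)))) (g := 𝓝 z)).sub_const z
    simpa using this.norm
  simpa using h2.add h1

theorem tendsto_cut_comp {β : Type*} {l : Filter β} {g : β → Phase N s} {z : Phase N s}
    (hg : Tendsto g l (𝓝 z)) :
    Tendsto (fun p : Finset (Idx N) × β => cut s ↑p.1 (g p.2)) (atTop ×ˢ l) (𝓝 z) := by
  have h := (tendsto_fst (f := (atTop : Filter (Finset (Idx N)))) (g := l)).prodMk
    (hg.comp tendsto_snd)
  have h' := (tendsto_cut_prod z).comp h
  exact h'

/-- A function of class `C¹` is differentiable along solutions, provided that its derivative in the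
direction of the unbounded vector field, which makes sense on finite sequences, has a
continuous extension `g`. The finite truncations of the solution are differentiable curves, and
their derivatives converge locally uniformly. -/
theorem hasDerivAt_along_solution {ω : Idx N → ℝ} {F : (Idx N → ℂ) → (Idx N → ℂ)}
    {I : Set ℝ} {z : ℝ → Phase N s} (hz : IsSolution ω F s I z)
    {U : Set (Phase N s)} {G : Phase N s → Phase N s} (hU : IsOpen U) (hGc : ContinuousOn G U)
    (hG : ∀ z ∈ U, (G z).seq = F z.seq) {f g : Phase N s → ℂ} (hf : ContDiff ℂ 1 f)
    (hg : Continuous g)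
    (hfg : ∀ (Λ : Finset (Idx N)) z,
      fderiv ℂ f (cut s ↑Λ z) (linearVelocity s ω Λ z) = g (cut s ↑Λ z))
    {t : ℝ} (ht : t ∈ I) (htU : z t ∈ U) :
    HasDerivAt (fun τ => f (z τ)) (g (z t) + fderiv ℂ f (z t) (-Complex.I • G (z t))) t := by
  classical
  obtain ⟨V, hVo, hV⟩ : ∃ V : Set ℝ, IsOpen V ∧ V = I ∩ z ⁻¹' U :=
    ⟨_, hz.continuousOn.isOpen_inter_preimage hz.isOpen hU, rfl⟩
  have hzc : ∀ τ ∈ V, Tendsto z (𝓝[V] τ) (𝓝 (z τ)) := fun τ hτ =>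
    (hz.continuousOn τ (hV ▸ hτ).1).mono_left (nhdsWithin_mono _ (hV ▸ Set.inter_subset_left))
  have hGz : ∀ τ ∈ V, Tendsto (fun τ => G (z τ)) (𝓝[V] τ) (𝓝 (G (z τ))) := fun τ hτ =>
    (hGc.continuousAt (hU.mem_nhds (hV ▸ hτ).2)).tendsto.comp (hzc τ hτ)
  set Ψ : Phase N s × Phase N s → ℂ := fun p => g p.1 + fderiv ℂ f p.1 (-Complex.I • p.2) with hΨ
  have hΨc : Continuous Ψ :=
    (hg.comp continuous_fst).add (((hf.continuous_fderiv one_ne_zero).comp continuous_fst).clm_apply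
      (continuous_snd.const_smul (-Complex.I)))
  have hunif : TendstoLocallyUniformlyOn
      (fun (Λ : Finset (Idx N)) τ => Ψ (cut s ↑Λ (z τ), cut s ↑Λ (G (z τ))))
      (fun τ => Ψ (z τ, G (z τ))) atTop V := by
    rw [tendstoLocallyUniformlyOn_iff_forall_tendsto]
    intro τ hτ
    have h1 : Tendsto (fun p : Finset (Idx N) × ℝ => Ψ (z p.2, G (z p.2))) (atTop ×ˢ 𝓝[V] τ)
        (𝓝 (Ψ (z τ, G (z τ)))) := by
      have h := ((hzc τ hτ).prodMk_nhds (hGz τ hτ)).comp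
        (tendsto_snd (f := (atTop : Filter (Finset (Idx N)))))
      have h' := (hΨc.tendsto _).comp h
      exact h'
    have h2 : Tendsto (fun p : Finset (Idx N) × ℝ => Ψ (cut s ↑p.1 (z p.2), cut s ↑p.1 (G (z p.2))))
        (atTop ×ˢ 𝓝[V] τ) (𝓝 (Ψ (z τ, G (z τ)))) := by
      have h := (tendsto_cut_comp (hzc τ hτ)).prodMk_nhds (tendsto_cut_comp (hGz τ hτ))
      have h' := (hΨc.tendsto _).comp h
      exact h'
    exact (h1.prodMk_nhds h2).mono_right (nhds_le_uniformity _)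
  have hlim : ∀ τ, Tendsto (fun Λ : Finset (Idx N) => f (cut s ↑Λ (z τ))) atTop (𝓝 (f (z τ))) := by
    intro τ
    have h := (hf.continuous.tendsto _).comp (tendsto_cut s (z τ))
    exact h
  have hder : ∀ (Λ : Finset (Idx N)), ∀ τ ∈ V, HasDerivAt (fun τ => f (cut s ↑Λ (z τ)))
      (Ψ (cut s ↑Λ (z τ), cut s ↑Λ (G (z τ)))) τ := by
    intro Λ τ hτ
    have hτ' : τ ∈ I ∩ z ⁻¹' U := hV ▸ hτ
    have hcut : HasDerivAt (fun τ => cut s ↑Λ (z τ))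
        (linearVelocity s ω Λ (z τ) + -Complex.I • cut s ↑Λ (G (z τ))) τ := by
      choose v hv hv' using hz.ode τ hτ'.1
      have h1 : HasDerivAt (fun τ => ∑ j ∈ Λ, (z τ).seq j • unit s j) (∑ j ∈ Λ, v j • unit s j) τ :=
        HasDerivAt.fun_sum fun j _ => (hv j).smul_const (unit s j)
      simp only [← cut_finset_eq] at h1
      convert h1 using 1
      rw [cut_finset_eq, linearVelocity, Finset.smul_sum, ← Finset.sum_add_distrib]
      refine Finset.sum_congr rfl fun j _ => ?_
      rw [smul_smul, ← add_smul, hG _ hτ'.2]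
      congr 1
      linear_combination Complex.I * hv' j - v j * Complex.I_mul_I
    have h2 := ((hf.differentiable one_ne_zero (cut s ↑Λ (z τ))).hasFDerivAt.restrictScalars
      ℝ).comp_hasDerivAt τ hcut
    refine h2.congr_deriv ?_
    rw [ContinuousLinearMap.coe_restrictScalars', map_add, hfg]
  have htV : t ∈ V := hV ▸ ⟨ht, htU⟩
  have h := hasDerivAt_of_tendstoLocallyUniformlyOn hVo hunif (Eventually.of_forall hder)
    (fun τ _ => hlim τ) htV
  exact h

end

/-! ### The modified energy -/

section

/-- The multilinear maps of a reversible polynomial field anticommute with the symmetry `τ`. -/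
theorem apply_tau_of_reversible {s : ℝ} {a : Coeffs N} {k : ℕ} (ha : ReversibleCoeffs a k) {m : ℕ}
    (hm : 2 ≤ m) (hmk : m ≤ k)
    {T : ContinuousMultilinearMap ℂ (fun _ : Fin m => Phase N s) (Phase N s)}
    (hT : ∀ u j, (T u).seq j = symSum (a m j) fun i => (u i).seq) (u : Fin m → Phase N s) :
    T (fun i => tau s (u i)) = -tau s (T u) := by
  refine Phase.ext fun j => ?_
  rw [hT, Phase.seq_neg, Pi.neg_apply, tau_seq, hT]
  refine symSum_bar (fun l => ?_) fun i => (u i).seq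
  have h := ha m hm hmk l (bar j)
  rwa [bar_bar] at h

/-- The modified energy, as a function differentiable over `ℂ`: there is a correction `h` of order
three such that the quadratic form plus `h` has a derivative of order `r + 1` along solutions. -/
theorem exists_modified_energy {ω : Idx N → ℝ} (hsym : ∀ j, ω (bar j) = -ω j)
    (hω : NonResonant ω) {F : (Idx N → ℂ) → (Idx N → ℂ)} (hF : ClassT F) {r : ℕ} (hr : 3 ≤ r) :
    ∃ s₀ : ℝ, 0 < s₀ ∧ ∀ s, s₀ < s → ∃ (σ : ℝ) (ε C : ℝ) (h : Phase N s → ℂ), 0 < ε ∧ ε ≤ 1 ∧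
      0 ≤ C ∧ h ∈ Tail N s σ 3 1 ∧
      ∀ (I : Set ℝ) (z : ℝ → Phase N s), IsSolution ω F s I z → ∀ t ∈ I, ‖z t‖ < ε →
        ∃ D : ℂ, HasDerivAt (fun τ => (energy N s fun _ => z τ) + h (z τ)) D t ∧
          ‖D‖ ≤ C * ‖z t‖ ^ (r + 1) := by
  obtain ⟨γ, α, hγ, hα, hω⟩ := hω r hr
  obtain ⟨ν, a, hν, hinf, -, hrev, s₁, htaylor⟩ := hF.taylor r (by omega)
  obtain ⟨s₂, hs₂, hreg⟩ := hF.regular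
  set σ := max (ν + 3 * (2 * d)) (max s₁ s₂) with hσ
  have hκ : 0 ≤ α + 2 * (d : ℝ) := by positivity
  have hσ0 : 0 ≤ σ := hs₂.trans ((le_max_right _ _).trans (le_max_right _ _))
  obtain ⟨n, rfl⟩ := Nat.exists_eq_add_of_le' (show 2 ≤ r by omega)
  refine ⟨σ + n * (α + 2 * d) + 1, by positivity, fun s hs => ?_⟩
  have hs' : σ + n * (α + 2 * d) < s := by linarith
  have hσs : σ < s := by
    have : 0 ≤ (n : ℝ) * (α + 2 * d) := by positivity
    linarith
  have hbd : ∀ σ', σ ≤ σ' → BoundedNearZero a (n + 2) σ' := fun σ' h => by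
    obtain ⟨U, G, hU, h0, -, hG, C, hC⟩ :=
      hreg σ' (((le_max_right _ _).trans (le_max_right _ _)).trans h)
    exact (htaylor σ' (((le_max_left _ _).trans (le_max_right _ _)).trans h)).boundedNearZero
      hU h0 hG hC
  have hνσ : ν + 3 * (2 * d) ≤ σ := le_max_left _ _
  have hd : (0 : ℝ) ≤ d := Nat.cast_nonneg d
  have hex : ∀ m, ∃ T : ContinuousMultilinearMap ℂ (fun _ : Fin m => Phase N s) (Phase N s),
      m ∈ Finset.Icc 2 (n + 2) → (∀ u j, (T u).seq j = symSum (a m j) fun i => (u i).seq) ∧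
        ∀ σ', σ ≤ σ' → σ' < s → TameMap σ' T := by
    intro m
    by_cases hm : m ∈ Finset.Icc 2 (n + 2)
    · obtain ⟨T, hT, hT'⟩ := exists_tameMap hν hinf (by linarith) (hbd s hσs.le)
        (Finset.mem_Icc.1 hm).1 (Finset.mem_Icc.1 hm).2
      exact ⟨T, fun _ => ⟨hT, fun σ' h h' => hT' σ' (hνσ.trans h) h' (hbd σ' h)⟩⟩
    · exact ⟨0, fun h => absurd h hm⟩
  choose T hT using hex
  obtain ⟨h, hh, R, hR, heq⟩ := exists_correction (T := T) hα.le hγ hsym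
    (fun p h3 hp => hω p (by omega) hp) (fun m hm => (hT m hm).2)
    (fun m hm => apply_tau_of_reversible hrev (Finset.mem_Icc.1 hm).1 (Finset.mem_Icc.1 hm).2
      (hT m hm).1) le_rfl hs'
  set f : Phase N s → ℂ := (fun z => energy N s fun _ => z) + h with hf
  have hfT : f ∈ Tail N s (σ + n * (α + 2 * d)) 2 1 :=
    Submodule.add_mem _ (Form.le_tail _ le_rfl _ (energy_mem _)) (Tail.anti _ _ _ hh)
  have hX : ∀ z j, (polyVelocity (n + 2) T z).seq j =
      -Complex.I * polyField a (n + 2) z.seq j := by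
    intro z j
    rw [polyVelocity, Phase.seq_smul, Phase.seq_sum, Pi.smul_apply, Finset.sum_apply, smul_eq_mul,
      polyField_eq_sum_coeffSum]
    refine congrArg _ (Finset.sum_congr rfl fun m hm => ?_)
    rw [(hT m hm).1, symSum_const]
  obtain ⟨U, G, hU, h0, hGc, hG, -⟩ :=
    hreg s (((le_max_right _ _).trans (le_max_right _ _)).trans hσs.le)
  obtain ⟨C₀, hC₀⟩ := htaylor s (((le_max_left _ _).trans (le_max_right _ _)).trans hσs.le)
  obtain ⟨ρ, hρ, hball⟩ := Metric.eventually_nhds_iff.1 ((hU.eventually_mem h0).and hC₀)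
  obtain ⟨C₁, hC₁, hRn⟩ := Tail.norm_le hR
  obtain ⟨C₂, hC₂, hfn⟩ := Tail.norm_fderiv_le hfT
  refine ⟨_, min ρ 1, C₁ + C₂ * |C₀|, h, lt_min hρ one_pos, min_le_right _ _, by positivity, hh,
    fun I z hz t ht hzt => ?_⟩
  obtain ⟨hzU, w, hw, hwn⟩ := hball (y := z t) (by
    rw [dist_zero_right]
    exact hzt.trans_le (min_le_left _ _))
  have hz1 : ‖z t‖ ≤ 1 := (hzt.trans_le (min_le_right _ _)).le
  have hfc : ContDiff ℂ 1 f := Tail.contDiff hfT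
  have hXc := continuous_polyVelocity (n + 2) T
  have hgc : Continuous fun y => R y - fderiv ℂ f y (polyVelocity (n + 2) T y) :=
    (Tail.contDiff hR).continuous.sub ((hfc.continuous_fderiv one_ne_zero).clm_apply hXc)
  have hder := hasDerivAt_along_solution hz hU hGc hG hfc hgc (fun Λ y => by
    rw [← heq Λ y, map_add, add_sub_cancel_right]) ht hzU
  refine ⟨_, hder, ?_⟩
  have hGw : -Complex.I • G (z t) = polyVelocity (n + 2) T (z t) + -Complex.I • w := by
    refine Phase.ext fun j => ?_
    rw [Phase.seq_add, Pi.add_apply, hX, Phase.seq_smul, Phase.seq_smul, Pi.smul_apply,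
      Pi.smul_apply, hG _ hzU, hw, smul_eq_mul, smul_eq_mul, mul_add]
  rw [hGw, map_add, ← add_assoc, sub_add_cancel, add_mul]
  refine (norm_add_le _ _).trans (add_le_add (hRn _ hz1) ((hfn _ hz1 _).trans ?_))
  rw [mul_assoc, norm_smul, norm_neg, Complex.norm_I, one_mul]
  exact mul_le_mul_of_nonneg_left (hwn.trans (mul_le_mul_of_nonneg_right (le_abs_self C₀)
    (by positivity))) hC₂

end

end ReversibleSystem

end

theorem theorem1 (d : ℕ) (hd : 1 ≤ d) (N : Set (Fin d → ℤ))
    (hN : N = Set.univ ∨ N = {a : Fin d → ℤ | ∀ i, 0 ≤ a i})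
    (ω : ReversibleSystem.Idx N → ℝ)
    (hsym : ∀ j, ω (ReversibleSystem.bar j) = -ω j)
    (hbound : ∃ C m : ℝ, 0 < C ∧ 0 < m ∧
      ∀ a : N, |ω (a, 1)| ≤ C * ReversibleSystem.size ((a, 1) : ReversibleSystem.Idx N) ^ m)
    (hω : ReversibleSystem.NonResonant ω)
    (F : (ReversibleSystem.Idx N → ℂ) → (ReversibleSystem.Idx N → ℂ))
    (hF : ReversibleSystem.ClassT F) :
    ∀ r : ℕ, 3 ≤ r → ∃ s₀ : ℝ, 0 < s₀ ∧ ∀ s : ℝ, s₀ < s →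
      ∃ (ε C : ℝ) (Ns : ReversibleSystem.Phase N s → ℝ), 0 < ε ∧ 0 < C ∧
        ContinuousOn Ns (Metric.ball 0 ε) ∧
        (∀ z ∈ Metric.ball (0 : ReversibleSystem.Phase N s) ε, 0 ≤ Ns z) ∧
        (∀ z ∈ Metric.ball (0 : ReversibleSystem.Phase N s) ε,
          |Ns z - ‖z‖ ^ 2| ≤ C * ‖z‖ ^ 3) ∧
        ∀ (I : Set ℝ) (z : ℝ → ReversibleSystem.Phase N s),
          ReversibleSystem.IsSolution ω F s I z →
          (∀ t ∈ I, ReversibleSystem.IsRealSeq (z t).seq) →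
          ∀ t ∈ I, z t ∈ Metric.ball (0 : ReversibleSystem.Phase N s) ε →
            ∃ D : ℝ, HasDerivAt (fun τ => Ns (z τ)) D t ∧ |D| ≤ C * ‖z t‖ ^ (r + 1) := by
  intro r hr
  obtain ⟨s₀, hs₀, hmain⟩ := ReversibleSystem.exists_modified_energy hsym hω hF hr
  refine ⟨s₀, hs₀, fun s hs => ?_⟩
  obtain ⟨σ, ε, C, h, hε, hε1, hC, hh, hsol⟩ := hmain s hs
  obtain ⟨C₃, hC₃, hhn⟩ := ReversibleSystem.Tail.norm_le hh
  have habs : ∀ z, |(‖z‖ ^ 2 + (h z).re) - ‖z‖ ^ 2| ≤ ‖h z‖ := fun z => by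
    rw [add_sub_cancel_left]
    exact Complex.abs_re_le_norm _
  refine ⟨min ε (1 / (C₃ + 1)), C + C₃ + 1, fun z => ‖z‖ ^ 2 + (h z).re, lt_min hε (by positivity),
    by positivity, Continuous.continuousOn ((continuous_norm.pow 2).add
      (Complex.continuous_re.comp (ReversibleSystem.Tail.contDiff hh).continuous)),
    fun z hz => ?_, fun z hz => ?_, fun I z hz hreal t ht hzt => ?_⟩
  · rw [mem_ball_zero_iff, lt_min_iff, lt_div_iff₀ (by positivity)] at hz
    have h1 := (habs z).trans (hhn z (hz.1.le.trans hε1))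
    have h2 : C₃ * ‖z‖ ^ 3 ≤ ‖z‖ ^ 2 := by
      rw [pow_succ, ← mul_assoc, mul_comm C₃, mul_assoc]
      refine mul_le_of_le_one_right (by positivity) ?_
      nlinarith [norm_nonneg z, hz.2]
    linarith [neg_abs_le ((‖z‖ ^ 2 + (h z).re) - ‖z‖ ^ 2)]
  · rw [mem_ball_zero_iff, lt_min_iff] at hz
    refine ((habs z).trans (hhn z (hz.1.le.trans hε1))).trans ?_
    exact mul_le_mul_of_nonneg_right (by linarith) (by positivity)
  · rw [mem_ball_zero_iff, lt_min_iff] at hzt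
    obtain ⟨D, hD, hDn⟩ := hsol I z hz t ht hzt.1
    refine ⟨D.re, ?_, (Complex.abs_re_le_norm D).trans (hDn.trans
      (mul_le_mul_of_nonneg_right (by linarith) (by positivity)))⟩
    -- On real sequences the modified energy is the real part of a function differentiable over `ℂ`.
    refine (Complex.reCLM.hasFDerivAt.comp_hasDerivAt t hD).congr_of_eventuallyEq ?_
    filter_upwards [hz.isOpen.mem_nhds ht] with τ hτ
    rw [Function.comp_apply, ReversibleSystem.energy_real (hreal τ hτ), Complex.reCLM_apply,
      Complex.add_re, Complex.ofReal_re]
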